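/- Let $Q$ be a smooth manifold of dimension $n\ge 1$ with a smooth pseudo-Riemannian metric $g$, $G=g^{-1}$, Levi-Civita connection $\nabla$, and gradient $\nabla f=G\,df$. A smooth $(1,1)$-tensor $J$ is called a $J$-tensor for $g$ if $J^{ij}=J^i_kG^{kj}$ is symmetric and $\nabla_hJ^i_j=\alpha_j\delta^i_h+\alpha^i g_{jh}$ for some $1$-form $\alpha$. For an endomorphism $A$, $\operatorname{cof}A$ is the transposed matrix of its signed minors, so $A\operatorname{cof}A=(\det A)I$. For a $(1,1)$-tensor $J$ let, in the coordinates $(q^i,p_i)$ on $T^*Q$ induced by a chart of $Q$, $$\Pi_{nc}(J)=\begin{pmatrix}0&J\\-J^T&\Omega\end{pmatrix},\qquad \Omega_{ij}=\Big(\frac{\partial J^k_i}{\partial q^j}-\frac{\partial J^k_j}{\partial q^i}\Big)p_k,$$ and $\{A,B\}_{\Pi}=\langle dA,\Pi\,dB\rangle$. Let $J_1,J_2$ be everywhere nonsingular $J$-tensors for $g$, $\sigma_i=\det J_i$, and let $V,W$ be smooth functions on $Q$ such that $(\operatorname{cof}J_1)^{-1}\nabla V=(\operatorname{cof}J_2)^{-1}\nabla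 W$ (a bi-cofactor system with force $-(\operatorname{cof}J_1)^{-1}\nabla V$); if $n=1$, assume in addition that $V=W$. Put $H=\frac12p^T(\operatorname{cof}J_1)Gp+V$ and $F=\frac12p^T(\operatorname{cof}J_2)Gp+W$. Then on $T^*Q$ $$\frac1{\sigma_1}\Pi_{nc}(J_1)\,dH=\frac1{\sigma_2}\Pi_{nc}(J_2)\,dF,$$ and the bi-quasi-Hamiltonian system $\frac{d}{dt}(q,p)^T=\frac1{\sigma_1}\Pi_{nc}(J_1)\,dH=\frac1{\sigma_2}\Pi_{nc}(J_2)\,dF$ has the following properties. 1. Define $K_1,\dots,K_n$ by $\operatorname{cof}(J_2+\xi J_1)=\sum_{i=0}^{n-1}K_{n-i}\xi^i$. Then $K_1=\operatorname{cof}J_1$, $K_n=\operatorname{cof}J_2$, and every $K_r$ is a $(1,1)$-Killing tensor of $g$, i.e. $K_{ij}=g_{ik}K^k_j$ is symmetric and $\nabla_{(h}K_{ij)}=0$. 2. For $r=1,\dots,n$ the vector fields $\sigma_1^{-1}K_rJ_1\nabla V$ and $\sigma_2^{-1}K_rJ_2\nabla W$ coincide. Every point of $Q$ has an open neighbourhood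 $U$ on which there are smooth functions $V_1,\dots,V_n$ with $V_1=V$, $V_n=W$ and, for $r=1,\dots,n$, $$\nabla V_r=\frac1{\sigma_1}K_rJ_1\nabla V_1,\qquad\text{or, equivalently,}\qquad \nabla V_r=\frac1{\sigma_2}K_rJ_2\nabla V_n;$$ one may take $U=Q$ if every smooth closed $1$-form on $Q$ is exact. 3. Let $U\subseteq Q$ be open and let $V_1,\dots,V_n$ be any such functions on $U$. Then the functions $$H_r(q,p)=\tfrac12p^TK_rGp+V_r(q),\qquad r=1,\dots,n,$$ on $T^*U$ satisfy $H_1=H$ and $H_n=F$, they are constant along every solution of the bi-quasi-Hamiltonian system lying in $T^*U$, and $$\{H_r,H_s\}_{\Pi_{nc}(J_1)}=\{H_r,H_s\}_{\Pi_{nc}(J_2)}=0\qquad\text{for all } r,s=1,\dots,n.$$ -/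

import Mathlib

open scoped Manifold ContDiff Matrix

noncomputable section

namespace BiCofactor

/-! ### Cofactors of endomorphisms -/

section LinearAlgebra

variable {T : Type*} [AddCommGroup T] [Module ℝ T] [FiniteDimensional ℝ T]

/-- The cofactor `cof A` of an endomorphism: the transposed matrix of signed minors
(Mathlib's `Matrix.adjugate`) of the matrix of `A`. It does not depend on the basis. -/
def cof (A : Module.End ℝ T) : Module.End ℝ T :=
  Matrix.toLin (Module.finBasis ℝ T) (Module.finBasis ℝ T)
    (LinearMap.toMatrix (Module.finBasis ℝ T) (Module.finBasis ℝ T) A).adjugate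

/-- The coefficient of `ξ ^ k` in the polynomial `cof (B + ξ A)`. -/
def cofPencilCoeff (A B : Module.End ℝ T) (k : ℕ) : Module.End ℝ T :=
  Matrix.toLin (Module.finBasis ℝ T) (Module.finBasis ℝ T)
    (Matrix.of fun i j =>
      (((LinearMap.toMatrix (Module.finBasis ℝ T) (Module.finBasis ℝ T) B).map Polynomial.C +
        (Polynomial.X : Polynomial ℝ) •
          (LinearMap.toMatrix (Module.finBasis ℝ T) (Module.finBasis ℝ T) A).map
            Polynomial.C).adjugate i j).coeff k)

end LinearAlgebra

instance instFiniteDimensionalTangentSpace {n : ℕ} {M : Type*} [TopologicalSpace M]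
    [ChartedSpace (EuclideanSpace ℝ (Fin n)) M] (x : M) :
    FiniteDimensional ℝ (TangentSpace (𝓡 n) x) :=
  inferInstanceAs (FiniteDimensional ℝ (EuclideanSpace ℝ (Fin n)))

/-- The cotangent space `T*_x M`. -/
abbrev Cotangent (n : ℕ) {M : Type*} [TopologicalSpace M]
    [ChartedSpace (EuclideanSpace ℝ (Fin n)) M] (x : M) : Type :=
  TangentSpace (𝓡 n) x →L[ℝ] ℝ

/-- The (points of the) phase space `T*M`: pairs `(q, p)` with `q ∈ M` and `p ∈ T*_q M`. -/
abbrev PhaseSpace (n : ℕ) (M : Type*) [TopologicalSpace M]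
    [ChartedSpace (EuclideanSpace ℝ (Fin n)) M] : Type _ :=
  Σ x : M, Cotangent n x

/-- Fields of endomorphisms of the tangent spaces, i.e. (1,1)-tensor fields. -/
abbrev EndField (n : ℕ) (M : Type*) [TopologicalSpace M]
    [ChartedSpace (EuclideanSpace ℝ (Fin n)) M] : Type _ :=
  ∀ x : M, Module.End ℝ (TangentSpace (𝓡 n) x)

/-- Local coordinate systems on an open subset of `M`. -/
abbrev Coords (n : ℕ) (M : Type*) [TopologicalSpace M] : Type _ :=
  OpenPartialHomeomorph M (EuclideanSpace ℝ (Fin n))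

/-- The admissible (smooth) coordinate systems of the manifold `M`. -/
def charts (n : ℕ) (M : Type*) [TopologicalSpace M]
    [ChartedSpace (EuclideanSpace ℝ (Fin n)) M] : Set (Coords n M) :=
  IsManifold.maximalAtlas (𝓡 n) ∞ M

/-- The partial derivative `∂f/∂q^i` of a function of the coordinates. -/
def partialDeriv {n : ℕ} (i : Fin n) (f : EuclideanSpace ℝ (Fin n) → ℝ)
    (y : EuclideanSpace ℝ (Fin n)) : ℝ :=
  fderiv ℝ f y (EuclideanSpace.single i 1)

section Manifold

variable {n : ℕ} {M : Type*} [TopologicalSpace M] [ChartedSpace (EuclideanSpace ℝ (Fin n)) M]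

/-! ### Coordinate frames and components -/

/-- The coordinate differential `dq^i` at the point `x` of the chart domain. -/
def coordForm (e : Coords n M) (x : M) (i : Fin n) : Cotangent n x :=
  (EuclideanSpace.proj i : EuclideanSpace ℝ (Fin n) →L[ℝ] ℝ).comp (mvfderiv (𝓡 n) e x)

/-- The coordinate vector `∂/∂q^i` at the point `x` of the chart domain. -/
def coordVec (e : Coords n M) (x : M) (i : Fin n) : TangentSpace (𝓡 n) x :=
  (mvfderiv (𝓡 n) e x).inverse (EuclideanSpace.single i 1)

/-- The component matrix `A^i_j` (row `i`, column `j`) of a (1,1)-tensor field, as a function of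
the coordinates. -/
def components (e : Coords n M) (A : EndField n M) (y : EuclideanSpace ℝ (Fin n)) :
    Matrix (Fin n) (Fin n) ℝ :=
  Matrix.of fun i j =>
    coordForm e (e.symm y) i (A (e.symm y) (coordVec e (e.symm y) j))

/-- A (1,1)-tensor field is smooth if its components in all charts are. -/
def IsSmoothField (A : EndField n M) : Prop :=
  ∀ e ∈ charts n M, ∀ i j, ContDiffOn ℝ ∞ (fun y => components e A y i j) e.target

/-- The components of a 1-form, as functions of the coordinates. -/
def formComponents (e : Coords n M) (θ : ∀ x : M, Cotangent n x)
    (y : EuclideanSpace ℝ (Fin n)) (i : Fin n) : ℝ :=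
  θ (e.symm y) (coordVec e (e.symm y) i)

/-- Smooth closed 1-forms. -/
def IsClosedForm (θ : ∀ x : M, Cotangent n x) : Prop :=
  ∀ e ∈ charts n M,
    (∀ i, ContDiffOn ℝ ∞ (fun y => formComponents e θ y i) e.target) ∧
    ∀ y ∈ e.target, ∀ i j,
      partialDeriv i (fun y => formComponents e θ y j) y =
        partialDeriv j (fun y => formComponents e θ y i) y

variable (n M) in
/-- The first de Rham cohomology of `M` vanishes: every smooth closed 1-form is the differential
of a smooth function. -/
def ClosedFormsExact : Prop :=
  ∀ θ : (∀ x : M, Cotangent n x), IsClosedForm θ →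
    ∃ f : M → ℝ, ContMDiff (𝓡 n) 𝓘(ℝ) ∞ f ∧ ∀ x, mvfderiv (𝓡 n) f x = θ x

/-! ### Pseudo-Riemannian geometry -/

variable (n M) in
/-- A smooth pseudo-Riemannian metric (of arbitrary signature). -/
structure PseudoMetric where
  /-- the symmetric bilinear form on the tangent space at `x` -/
  form : ∀ x : M, LinearMap.BilinForm ℝ (TangentSpace (𝓡 n) x)
  symm : ∀ x u v, form x u v = form x v u
  nondegenerate : ∀ x, (form x).Nondegenerate
  smooth : ∀ e ∈ charts n M, ∀ i j, ContDiffOn ℝ ∞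
    (fun y => form (e.symm y) (coordVec e (e.symm y) i) (coordVec e (e.symm y) j)) e.target

namespace PseudoMetric

variable (g : PseudoMetric n M)

/-- The contravariant metric `G = g⁻¹`, as the map `T*_x M → T_x M`: `g (G α, v) = α v`. -/
def sharp (x : M) (α : Cotangent n x) : TangentSpace (𝓡 n) x :=
  ((g.form x).toDual (g.nondegenerate x)).symm (α : TangentSpace (𝓡 n) x →ₗ[ℝ] ℝ)

/-- The gradient `∇f = G df`. -/
def grad (f : M → ℝ) (x : M) : TangentSpace (𝓡 n) x :=
  g.sharp x (mvfderiv (𝓡 n) f x)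

/-- The covariant components `g_{ij}`. -/
def lower (e : Coords n M) (y : EuclideanSpace ℝ (Fin n)) : Matrix (Fin n) (Fin n) ℝ :=
  Matrix.of fun i j => g.form (e.symm y) (coordVec e (e.symm y) i) (coordVec e (e.symm y) j)

/-- The contravariant components `G^{ij}`. -/
def upper (e : Coords n M) (y : EuclideanSpace ℝ (Fin n)) : Matrix (Fin n) (Fin n) ℝ :=
  (g.lower e y)⁻¹

/-- The Christoffel symbols `Γ^i_{jk}` of the Levi-Civita connection. -/
def christoffel (e : Coords n M) (y : EuclideanSpace ℝ (Fin n)) (i j k : Fin n) : ℝ :=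
  (1 / 2) * ∑ l, g.upper e y i l *
    (partialDeriv j (fun y => g.lower e y l k) y + partialDeriv k (fun y => g.lower e y l j) y -
      partialDeriv l (fun y => g.lower e y j k) y)

/-- The components `∇_h A^i_j` of the covariant derivative of a (1,1)-tensor field. -/
def covDeriv (e : Coords n M) (A : EndField n M) (y : EuclideanSpace ℝ (Fin n))
    (h i j : Fin n) : ℝ :=
  partialDeriv h (fun y => components e A y i j) y +
    ∑ m, g.christoffel e y i h m * components e A y m j -
    ∑ m, g.christoffel e y m h j * components e A y i m

/-- The components `A_{ij} = g_{ik} A^k_j`. -/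
def lowered (e : Coords n M) (A : EndField n M) (y : EuclideanSpace ℝ (Fin n)) :
    Matrix (Fin n) (Fin n) ℝ :=
  g.lower e y * components e A y

/-- The components `∇_h A_{ij}` of the covariant derivative of the lowered tensor field. -/
def covDerivLowered (e : Coords n M) (A : EndField n M) (y : EuclideanSpace ℝ (Fin n))
    (h i j : Fin n) : ℝ :=
  partialDeriv h (fun y => g.lowered e A y i j) y -
    ∑ m, g.christoffel e y m h i * g.lowered e A y m j -
    ∑ m, g.christoffel e y m h j * g.lowered e A y i m

/-- `J` is a `J`-tensor for the metric: `J^{ij} = J^i_k G^{kj}` is symmetric, and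
`∇_h J^i_j = α_j δ^i_h + α^i g_{jh}` for some 1-form `α`. -/
def IsJTensor (J : EndField n M) : Prop :=
  IsSmoothField J ∧
  (∀ e ∈ charts n M, ∀ y ∈ e.target, (components e J y * g.upper e y).IsSymm) ∧
  ∃ α : (∀ x : M, Cotangent n x), ∀ e ∈ charts n M, ∀ y ∈ e.target, ∀ h i j : Fin n,
    g.covDeriv e J y h i j =
      formComponents e α y j * (if i = h then 1 else 0) +
        (∑ k, g.upper e y i k * formComponents e α y k) * g.lower e y j h

/-- `K` is a (1,1)-Killing tensor: `K_{ij}` is symmetric and `∇_{(h} K_{ij)} = 0`. -/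
def IsKillingTensor (K : EndField n M) : Prop :=
  IsSmoothField K ∧
  ∀ e ∈ charts n M, ∀ y ∈ e.target,
    (g.lowered e K y).IsSymm ∧
    ∀ h i j : Fin n,
      g.covDerivLowered e K y h i j + g.covDerivLowered e K y i j h +
        g.covDerivLowered e K y j h i = 0

/-- The function `½ pᵀ K G p + V(q)` on the phase space. -/
def hamiltonian (K : EndField n M) (V : M → ℝ) (z : PhaseSpace n M) : ℝ :=
  (1 / 2) * z.2 (K z.1 (g.sharp z.1 z.2)) + V z.1

end PseudoMetric

/-! ### Phase space in the coordinates `(q, p)` induced by a chart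

A coordinate vector is a function on `Fin n ⊕ Fin n`: `Sum.inl i` stands for `q^i` and
`Sum.inr i` for `p_i`. -/

/-- The `q`-part of a coordinate vector. -/
def qPart (z : Fin n ⊕ Fin n → ℝ) : EuclideanSpace ℝ (Fin n) :=
  WithLp.toLp 2 fun i => z (Sum.inl i)

/-- The `p`-part of a coordinate vector. -/
def pPart (z : Fin n ⊕ Fin n → ℝ) : Fin n → ℝ := fun i => z (Sum.inr i)

/-- The coordinates `(q^i, p_i)` of a phase space point over the chart domain. -/
def toCoords (e : Coords n M) (z : PhaseSpace n M) : Fin n ⊕ Fin n → ℝ :=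
  Sum.elim (fun i => e z.1 i) (fun i => z.2 (coordVec e z.1 i))

/-- The phase space point with given coordinates: the covector `∑ p_i dq^i` at the point `q`. -/
def ofCoords (e : Coords n M) (z : Fin n ⊕ Fin n → ℝ) : PhaseSpace n M :=
  ⟨e.symm (qPart z), ∑ i, pPart z i • coordForm e (e.symm (qPart z)) i⟩

/-- The differential `(∂F/∂q, ∂F/∂p)` of a function on the phase space, in coordinates. -/
def phaseDiff (e : Coords n M) (F : PhaseSpace n M → ℝ) (z : Fin n ⊕ Fin n → ℝ) :
    Fin n ⊕ Fin n → ℝ :=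
  fun a => fderiv ℝ (fun w => F (ofCoords e w)) z (Pi.single a 1)

/-- The operator `Π_nc(J)`: the matrix with blocks `0`, `J`, `-Jᵀ`, `Ω`, where
`Ω_{ij} = (∂J^k_i/∂q^j - ∂J^k_j/∂q^i) p_k` (row `i`, column `j`). -/
def piNC (e : Coords n M) (J : EndField n M) (z : Fin n ⊕ Fin n → ℝ) :
    Matrix (Fin n ⊕ Fin n) (Fin n ⊕ Fin n) ℝ :=
  Matrix.fromBlocks 0 (components e J (qPart z)) (-(components e J (qPart z))ᵀ)
    (Matrix.of fun i j => ∑ k,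
      (partialDeriv j (fun y => components e J y k i) (qPart z) -
        partialDeriv i (fun y => components e J y k j) (qPart z)) * pPart z k)

/-- The bracket `{F₁, F₂} = ⟨dF₁, Π_nc(J) dF₂⟩`, in coordinates. -/
def bracket (e : Coords n M) (J : EndField n M) (F₁ F₂ : PhaseSpace n M → ℝ)
    (z : Fin n ⊕ Fin n → ℝ) : ℝ :=
  phaseDiff e F₁ z ⬝ᵥ (piNC e J z *ᵥ phaseDiff e F₂ z)

/-- The vector field `(1/σ) Π_nc(J) dF` with `σ = det J`, in coordinates. -/
def quasiHamField (e : Coords n M) (J : EndField n M) (F : PhaseSpace n M → ℝ)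
    (z : Fin n ⊕ Fin n → ℝ) : Fin n ⊕ Fin n → ℝ :=
  (LinearMap.det (J (e.symm (qPart z))))⁻¹ • (piNC e J z *ᵥ phaseDiff e F z)

/-- The curve `γ` in the phase space, defined on the interval `s`, solves
`dγ/dt = (1/σ) Π_nc(J) dF`. -/
def IsTrajectory (J : EndField n M) (F : PhaseSpace n M → ℝ) (s : Set ℝ)
    (γ : ℝ → PhaseSpace n M) : Prop :=
  ContinuousOn (fun t => (γ t).1) s ∧
  ∀ t ∈ s, ∀ e ∈ charts n M, (γ t).1 ∈ e.source →
    HasDerivWithinAt (fun τ => toCoords e (γ τ))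
      (quasiHamField e J F (toCoords e (γ t))) s t

/-! ### Bi-cofactor systems -/

/-- `(cof J₁)⁻¹ ∇V = (cof J₂)⁻¹ ∇W`, with `J₁`, `J₂` nonsingular `J`-tensors and `V`, `W` smooth:
the force `F = -(cof J₁)⁻¹ ∇V = -(cof J₂)⁻¹ ∇W` has two cofactor representations. -/
structure IsBiCofactor (g : PseudoMetric n M) (J₁ J₂ : EndField n M) (V W : M → ℝ) : Prop where
  jTensor₁ : g.IsJTensor J₁
  jTensor₂ : g.IsJTensor J₂
  det_ne_zero₁ : ∀ x, LinearMap.det (J₁ x) ≠ 0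
  det_ne_zero₂ : ∀ x, LinearMap.det (J₂ x) ≠ 0
  smooth₁ : ContMDiff (𝓡 n) 𝓘(ℝ) ∞ V
  smooth₂ : ContMDiff (𝓡 n) 𝓘(ℝ) ∞ W
  force_eq : ∀ x, Ring.inverse (cof (J₁ x)) (g.grad V x) = Ring.inverse (cof (J₂ x)) (g.grad W x)

/-- The tensors `K_r`, `r = 1, …, n`: `K_r` is the coefficient of `ξ^{n-r}` in
`cof (J₂ + ξ J₁)`. -/
def kTensor (J₁ J₂ : EndField n M) (r : ℕ) : EndField n M :=
  fun x => cofPencilCoeff (J₁ x) (J₂ x) (n - r)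

/-- `v 1, …, v n` are smooth functions on the open set `U` with `v 1 = V`, `v n = W` and
`∇v_r = σ₁⁻¹ K_r J₁ ∇v_1`. -/
def IsPotentialFamily (g : PseudoMetric n M) (J₁ J₂ : EndField n M) (V W : M → ℝ)
    (U : Set M) (v : ℕ → M → ℝ) : Prop :=
  (∀ r ∈ Finset.Icc 1 n, ContMDiffOn (𝓡 n) 𝓘(ℝ) ∞ (v r) U) ∧
  (∀ x ∈ U, v 1 x = V x) ∧ (∀ x ∈ U, v n x = W x) ∧
  ∀ r ∈ Finset.Icc 1 n, ∀ x ∈ U,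
    g.grad (v r) x = (LinearMap.det (J₁ x))⁻¹ • kTensor J₁ J₂ r x (J₁ x (g.grad (v 1) x))

end Manifold

end BiCofactor

end

/-!
Fix a point and a chart, let `g` be the metric matrix and `G` its inverse, and put
`X = (cof J₁)⁻¹ ∇V = (cof J₂)⁻¹ ∇W`. Every member `L = J₂ + ξ J₁` of the pencil is again a
`J`-tensor, with a 1-form `lam` that depends linearly on `L`. Let `A = cof L`, `ρ = det L ≠ 0`.
Three facts about a single nonsingular `J`-tensor carry the proof.

* Differentiating `A L = ρ I` expresses `∇A` through `A` and `lam` (`cov_cofactor`). The cyclic sum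
  of the resulting expression vanishes, so `A` is a Killing tensor (`killing_cofactor`).
* If `H` is the Hamiltonian `½ pᵀ A G p` plus a potential with differential `g A X`, then
  `Π_nc(L) dH` is `ρ` times the vector field of the Newton equations with force `-X`
  (`phaseMatrix_mulVec_phaseCovector`). Neither side of `σ⁻¹ Π_nc(J) dH` therefore depends on which
  of the two cofactor representations of the force is taken.
* The exterior derivative of the 1-form `g A X` vanishes if and only if an expression that is
  linear in `(L, lam)` does (`curl_cofactor_eq_zero_iff`). It vanishes for `J₁` and `J₂`, where the
  form is `dV` and `dW`, hence for the whole pencil.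

Involution follows from these facts: the Hamiltonian of a Killing tensor of the pencil is constant
along the Newton field, so the Hamiltonians belonging to the parameters `ξ ≠ η` commute for
`Π_nc(J₂ + ξ J₁)` and for `Π_nc(J₂ + η J₁)`, and by linearity of `Π_nc` for `Π_nc(J₁)` and
`Π_nc(J₂)` (`phaseBracket_cofactor_pencil`).

All of this concerns parameters at which the pencil is nonsingular. The tensors `K_r` are reached
by Lagrange interpolation: since `J₁` is nonsingular, at each point there are `n` distinct parameters
`ξ_a` with `J₂ + ξ_a J₁` nonsingular, and each `K_r` is a combination with constant coefficients of
the cofactors `cof (J₂ + ξ_a J₁)` (`cofPencilCoeff_eq_sum_cof`). The Killing equation, closedness and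
involution are linear or bilinear in the tensors, and so pass to the `K_r`.

The potentials exist locally by the Poincaré lemma. Since the Hamiltonian of the system is `H₁`, the
derivative of `H_r` along a solution is `σ₁⁻¹ {H_r, H₁}`, which is zero.
-/

noncomputable section

namespace BiCofactor

/-! ### Tensor algebra at a point -/

section PointwiseAlgebra

variable {ι : Type*} [Fintype ι] [DecidableEq ι]

/-- The values at one point of the metric matrix `g`, its inverse `G`, and the connection matrices
`Γ h`, where `Γ h i m` is the Christoffel symbol `Γ^i_{hm}`. Only the symmetry of the Christoffel
symbols in their lower indices is recorded; compatibility with the metric enters the lemmas below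
through the formulas for the derivatives of `g` and `G`. -/
structure IsMetricJet (g G : Matrix ι ι ℝ) (Γ : ι → Matrix ι ι ℝ) : Prop where
  symm : gᵀ = g
  mul_eq_one : g * G = 1
  torsionFree : ∀ i j k, Γ i k j = Γ j k i

/-- The value `L` and the covariant derivatives `DL h = ∇_h L` at one point of a `J`-tensor with
1-form `lam`: `g L` is symmetric and `∇_h L^i_j = lam_j δ^i_h + lam^i g_{jh}`. -/
structure IsJTensorJet (g G L : Matrix ι ι ℝ) (DL : ι → Matrix ι ι ℝ) (lam : ι → ℝ) : Prop where
  symm : Lᵀ * g = g * L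
  cov : ∀ h, DL h = Matrix.vecMulVec (Pi.single h 1) lam +
    Matrix.vecMulVec (G *ᵥ lam) (g.col h)

/-- `A` is the cofactor of the nonsingular matrix `L`, and the derivatives `DL`, `DA` satisfy what
differentiating `A L = (det L) I` gives, with the derivative of `det L` written as
`tr (A * DL h)` by Jacobi's formula. Partial and covariant derivatives both satisfy this. -/
structure IsCofactorJet (L : Matrix ι ι ℝ) (DL : ι → Matrix ι ι ℝ) (ρ : ℝ)
    (A : Matrix ι ι ℝ) (DA : ι → Matrix ι ι ℝ) : Prop where
  ne_zero : ρ ≠ 0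
  mul_left : A * L = ρ • 1
  mul_right : L * A = ρ • 1
  deriv : ∀ h, DA h * L + A * DL h = (A * DL h).trace • (1 : Matrix ι ι ℝ)

variable {g G : Matrix ι ι ℝ} {Γ : ι → Matrix ι ι ℝ}

theorem IsMetricJet.mul_eq_one' (hg : IsMetricJet g G Γ) : G * g = 1 :=
  mul_eq_one_comm.mp hg.mul_eq_one

theorem IsMetricJet.symm_inv (hg : IsMetricJet g G Γ) : Gᵀ = G := by
  calc Gᵀ = Gᵀ * (g * G) := by rw [hg.mul_eq_one, mul_one]
    _ = (gᵀ * G)ᵀ * G := by rw [Matrix.transpose_mul, Matrix.transpose_transpose, mul_assoc]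
    _ = G := by rw [hg.symm, hg.mul_eq_one, Matrix.transpose_one, one_mul]

theorem IsMetricJet.lowered_symm (hg : IsMetricJet g G Γ) {K : Matrix ι ι ℝ}
    (h : (K * G)ᵀ = K * G) : Kᵀ * g = g * K := by
  rw [Matrix.transpose_mul, hg.symm_inv] at h
  calc Kᵀ * g = g * (G * Kᵀ) * g := by rw [← mul_assoc, hg.mul_eq_one, one_mul]
    _ = g * K := by rw [h, mul_assoc, mul_assoc, hg.mul_eq_one', mul_one]

theorem IsMetricJet.raised_symm (hg : IsMetricJet g G Γ) {K : Matrix ι ι ℝ}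
    (h : Kᵀ * g = g * K) : G * Kᵀ = K * G := by
  calc G * Kᵀ = G * (Kᵀ * g) * G := by
        rw [mul_assoc, mul_assoc, hg.mul_eq_one, mul_one]
    _ = K * G := by rw [h, ← mul_assoc, hg.mul_eq_one', one_mul]

theorem IsMetricJet.lowered_apply_comm (hg : IsMetricJet g G Γ) {K : Matrix ι ι ℝ}
    (hs : Kᵀ * g = g * K) (i j : ι) : (g * K) i j = (g * K) j i := by
  have h1 := congrFun (congrFun (Matrix.transpose_mul g K) j) i
  rw [hg.symm, hs] at h1
  exact h1

theorem IsCofactorJet.lowered_symm {L A : Matrix ι ι ℝ} {DL DA : ι → Matrix ι ι ℝ} {ρ : ℝ}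
    (hA : IsCofactorJet L DL ρ A DA) (hL : Lᵀ * g = g * L) : Aᵀ * g = g * A := by
  have h1 : Aᵀ * (Lᵀ * g) * A = ρ • (g * A) := by
    rw [← mul_assoc, ← Matrix.transpose_mul, hA.mul_right]; simp
  have h2 : Aᵀ * (Lᵀ * g) * A = ρ • (Aᵀ * g) := by
    rw [hL, ← mul_assoc, mul_assoc, hA.mul_right]; simp
  exact smul_right_injective _ hA.ne_zero (h2.symm.trans h1)

/-- The covariant derivative of the cofactor `A` of a `J`-tensor: with `S = g A` and `a = Aᵀ lam`,
`ρ ∇_h A_{ij} = 2 a_h S_{ij} - S_{ih} a_j - a_i S_{jh}`. The derivative of the determinant is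
`2 a_h`, because both terms of `∇_h L` contribute `a_h` to `tr (A ∇_h L)`. -/
theorem cov_cofactor {L A : Matrix ι ι ℝ} {DL DA : ι → Matrix ι ι ℝ} {ρ : ℝ} {lam : ι → ℝ}
    (hg : IsMetricJet g G Γ) (hL : IsJTensorJet g G L DL lam) (hA : IsCofactorJet L DL ρ A DA)
    (h i j : ι) :
    ρ * (g * DA h) i j = 2 * (lam ᵥ* A) h * (g * A) i j - (g * A) i h * (lam ᵥ* A) j -
      (lam ᵥ* A) i * (g * A) j h := by
  have hs : Aᵀ * g = g * A := hA.lowered_symm hL.symm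
  have hGA : A * G = G * Aᵀ := (hg.raised_symm hs).symm
  have hAGl : A *ᵥ (G *ᵥ lam) = G *ᵥ (lam ᵥ* A) := by
    rw [Matrix.mulVec_mulVec, hGA, ← Matrix.mulVec_mulVec, Matrix.mulVec_transpose]
  have hgG : ∀ w : ι → ℝ, g *ᵥ (G *ᵥ w) = w := fun w => by
    rw [Matrix.mulVec_mulVec, hg.mul_eq_one, Matrix.one_mulVec]
  have hcol : g.col h ᵥ* A = (g * A).col h := by
    ext k
    have := congrFun (congrFun hs k) h
    simpa [Matrix.mul_apply, Matrix.vecMul, dotProduct, mul_comm] using this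
  have hprod : A * DL h = Matrix.vecMulVec (A.col h) lam +
      Matrix.vecMulVec (G *ᵥ (lam ᵥ* A)) (g.col h) := by
    rw [hL.cov, mul_add, Matrix.mul_vecMulVec, Matrix.mul_vecMulVec, hAGl,
      Matrix.mulVec_single_one]
  have htr : (A * DL h).trace = 2 * (lam ᵥ* A) h := by
    have h1 : A.col h ⬝ᵥ lam = (lam ᵥ* A) h := by
      rw [dotProduct_comm]; rfl
    have h2 : (G *ᵥ (lam ᵥ* A)) ⬝ᵥ g.col h = (lam ᵥ* A) h := by
      have := congrFun (hgG (lam ᵥ* A)) h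
      rw [← hg.symm] at this
      rw [dotProduct_comm]
      exact this
    rw [hprod, Matrix.trace_add, Matrix.trace_vecMulVec, Matrix.trace_vecMulVec, h1, h2]
    ring
  have hmain : ρ • DA h = (2 * (lam ᵥ* A) h) • A - Matrix.vecMulVec (A.col h) (lam ᵥ* A) -
      Matrix.vecMulVec (G *ᵥ (lam ᵥ* A)) ((g * A).col h) := by
    have h1 := congrArg (· * A) (hA.deriv h)
    simp only [add_mul, mul_assoc, hA.mul_right] at h1
    rw [htr, ← mul_assoc, hprod, add_mul, Matrix.vecMulVec_mul, Matrix.vecMulVec_mul, hcol] at h1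
    simp only [mul_smul_comm, mul_one, smul_mul_assoc, one_mul] at h1
    rw [← h1]; abel
  have hc : g *ᵥ A.col h = (g * A).col h := rfl
  have h2 : ρ • (g * DA h) = (2 * (lam ᵥ* A) h) • (g * A) -
      Matrix.vecMulVec ((g * A).col h) (lam ᵥ* A) -
      Matrix.vecMulVec (lam ᵥ* A) ((g * A).col h) := by
    rw [← mul_smul_comm, hmain, mul_sub, mul_sub, Matrix.mul_vecMulVec, Matrix.mul_vecMulVec, hgG,
      hc, mul_smul_comm]
  have h3 := congrFun (congrFun h2 i) j
  simpa [Matrix.vecMulVec_apply] using h3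

/-- The cofactor of a nonsingular `J`-tensor is a Killing tensor. -/
theorem killing_cofactor {L A : Matrix ι ι ℝ} {DL DA : ι → Matrix ι ι ℝ} {ρ : ℝ} {lam : ι → ℝ}
    (hg : IsMetricJet g G Γ) (hL : IsJTensorJet g G L DL lam) (hA : IsCofactorJet L DL ρ A DA)
    (h i j : ι) : (g * DA h) i j + (g * DA i) j h + (g * DA j) h i = 0 := by
  have hs := hg.lowered_apply_comm (hA.lowered_symm hL.symm)
  apply mul_left_cancel₀ hA.ne_zero
  rw [mul_add, mul_add, cov_cofactor hg hL hA, cov_cofactor hg hL hA, cov_cofactor hg hL hA,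
    hs j i, hs h j, hs h i]
  ring

/-! ### The quasi-Hamiltonian operator at a point -/

/-- The matrix `Π_nc(L)` at the momentum `p`, where `dL h` is the partial derivative of `L` along
the `h`-th coordinate. -/
def phaseMatrix (p : ι → ℝ) (L : Matrix ι ι ℝ) (dL : ι → Matrix ι ι ℝ) :
    Matrix (ι ⊕ ι) (ι ⊕ ι) ℝ :=
  Matrix.fromBlocks 0 L (-Lᵀ) (Matrix.of fun i j => ∑ k, (dL j k i - dL i k j) * p k)

/-- The differential at `p` of `½ pᵀ K G p + V`, where `K G` is symmetric and `dV = g K X`. The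
potential enters only through the vector `X`, which makes the covector linear in `(K, dK)`. -/
def phaseCovector (g G : Matrix ι ι ℝ) (dG : ι → Matrix ι ι ℝ) (X p : ι → ℝ)
    (K : Matrix ι ι ℝ) (dK : ι → Matrix ι ι ℝ) : ι ⊕ ι → ℝ :=
  Sum.elim (fun i => (1 / 2) * (p ⬝ᵥ ((dK i * G + K * dG i) *ᵥ p)) + (g *ᵥ (K *ᵥ X)) i)
    (K *ᵥ (G *ᵥ p))

/-- The vector field of the Newton equations `∇_{q̇} q̇ = -X` in the coordinates `(q, p)` with
`p = g q̇`. -/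
def newtonField (g G : Matrix ι ι ℝ) (Γ : ι → Matrix ι ι ℝ) (X p : ι → ℝ) : ι ⊕ ι → ℝ :=
  Sum.elim (G *ᵥ p) (fun i => p ⬝ᵥ (Γ i *ᵥ (G *ᵥ p)) - (g *ᵥ X) i)

/-- In covariant terms, `∂H/∂q^i = ½ p (∇_i K) v - p Γ_i K v + (g K X)_i` with `v = G p`. -/
theorem phaseCovector_inl {K : Matrix ι ι ℝ} {dG dK : ι → Matrix ι ι ℝ} (X p : ι → ℝ)
    (hg : IsMetricJet g G Γ) (hdG : ∀ h, dG h = -(Γ h * G) - G * (Γ h)ᵀ)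
    (hK : Kᵀ * g = g * K) (i : ι) :
    phaseCovector g G dG X p K dK (Sum.inl i) =
      (1 / 2) * (p ⬝ᵥ ((dK i + Γ i * K - K * Γ i) *ᵥ (G *ᵥ p))) -
        p ⬝ᵥ (Γ i *ᵥ (K *ᵥ (G *ᵥ p))) + (g *ᵥ (K *ᵥ X)) i := by
  have h1 : p ⬝ᵥ ((K * (G * (Γ i)ᵀ)) *ᵥ p) = p ⬝ᵥ ((Γ i * (K * G)) *ᵥ p) := by
    have : K * (G * (Γ i)ᵀ) = (Γ i * (K * G))ᵀ := by
      rw [Matrix.transpose_mul, Matrix.transpose_mul, hg.symm_inv, hg.raised_symm hK, mul_assoc]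
    rw [this, Matrix.mulVec_transpose, dotProduct_comm, Matrix.dotProduct_mulVec]
  have h2 : dK i * G + K * dG i = (dK i + Γ i * K - K * Γ i) * G - Γ i * (K * G) -
      K * (G * (Γ i)ᵀ) := by
    rw [hdG]; noncomm_ring
  simp only [phaseCovector, Sum.elim_inl]
  rw [h2, Matrix.sub_mulVec, Matrix.sub_mulVec, dotProduct_sub, dotProduct_sub, h1]
  simp only [Matrix.mulVec_mulVec]
  ring

theorem IsMetricJet.sum_vecMul_christoffel (hg : IsMetricJet g G Γ) (w u : ι → ℝ) (i : ι) :
    ∑ j, u j * (w ᵥ* Γ j) i = w ⬝ᵥ (Γ i *ᵥ u) := by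
  simp only [Matrix.vecMul, Matrix.mulVec, dotProduct, Finset.mul_sum]
  rw [Finset.sum_comm]
  refine Finset.sum_congr rfl fun k _ => Finset.sum_congr rfl fun j _ => ?_
  have h : Γ j k i = Γ i k j := hg.torsionFree j i k
  rw [h]
  ring

/-- Contraction of the kinetic part of the differential of the cofactor Hamiltonian with `L`. The
result no longer contains `L` or `ρ`, and it cancels the contribution of the block `Ω` of
`Π_nc(L)` in `phaseMatrix_mulVec_phaseCovector`. -/
theorem sum_dotProduct_cov_cofactor {L A : Matrix ι ι ℝ} {DL DA : ι → Matrix ι ι ℝ} {ρ : ℝ}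
    {lam : ι → ℝ} (hg : IsMetricJet g G Γ) (hL : IsJTensorJet g G L DL lam)
    (hA : IsCofactorJet L DL ρ A DA) (v : ι → ℝ) (i : ι) :
    ∑ k, L k i * ((g *ᵥ v) ⬝ᵥ (DA k *ᵥ v)) =
      2 * lam i * ((g *ᵥ v) ⬝ᵥ (A *ᵥ v)) - 2 * (g *ᵥ v) i * (lam ⬝ᵥ (A *ᵥ v)) := by
  have hmove : ∀ B : Matrix ι ι ℝ, (g *ᵥ v) ⬝ᵥ (B *ᵥ v) = v ⬝ᵥ ((g * B) *ᵥ v) := fun B => by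
    rw [← Matrix.mulVec_mulVec, Matrix.dotProduct_mulVec v, ← Matrix.mulVec_transpose, hg.symm]
  have hs : Aᵀ * g = g * A := hA.lowered_symm hL.symm
  have hk : ∀ k, ρ * ((g *ᵥ v) ⬝ᵥ (DA k *ᵥ v)) =
      2 * (lam ᵥ* A) k * ((g *ᵥ v) ⬝ᵥ (A *ᵥ v)) -
        2 * ((g * A) *ᵥ v) k * (lam ⬝ᵥ (A *ᵥ v)) := by
    intro k
    have hsk : ∀ i, (g * A) i k = (g * A) k i := fun i => hg.lowered_apply_comm hs i k
    have hm : ρ • (g * DA k) = (2 * (lam ᵥ* A) k) • (g * A) -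
        Matrix.vecMulVec ((g * A) k) (lam ᵥ* A) -
        Matrix.vecMulVec (lam ᵥ* A) ((g * A) k) := by
      ext i j
      have := cov_cofactor hg hL hA k i j
      rw [hsk i, hsk j] at this
      simpa [Matrix.vecMulVec_apply] using this
    have h1 : ((g * A) k) ⬝ᵥ v = ((g * A) *ᵥ v) k := rfl
    rw [hmove, hmove, ← smul_eq_mul, ← dotProduct_smul, ← Matrix.smul_mulVec, hm,
      Matrix.sub_mulVec, Matrix.sub_mulVec, dotProduct_sub, dotProduct_sub, Matrix.smul_mulVec,
      dotProduct_smul, Matrix.vecMulVec_mulVec, Matrix.vecMulVec_mulVec, Matrix.dotProduct_mulVec lam]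
    simp only [op_smul_eq_smul, dotProduct_smul, smul_eq_mul]
    simp only [dotProduct_comm v, h1]
    ring
  apply mul_left_cancel₀ hA.ne_zero
  have h1 : ∑ k, L k i * (lam ᵥ* A) k = ρ * lam i := by
    have : (lam ᵥ* A) ᵥ* L = ρ • lam := by
      rw [Matrix.vecMul_vecMul, hA.mul_left, Matrix.vecMul_smul, Matrix.vecMul_one]
    have := congrFun this i
    rw [Matrix.vecMul, dotProduct_comm] at this
    exact this
  have h2 : ∑ k, L k i * ((g * A) *ᵥ v) k = ρ * (g *ᵥ v) i := by
    have : Lᵀ *ᵥ ((g * A) *ᵥ v) = ρ • (g *ᵥ v) := by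
      rw [Matrix.mulVec_mulVec, ← mul_assoc, hL.symm, mul_assoc, hA.mul_right,
        mul_smul_comm, mul_one, Matrix.smul_mulVec]
    exact congrFun this i
  calc ρ * ∑ k, L k i * ((g *ᵥ v) ⬝ᵥ (DA k *ᵥ v))
      = ∑ k, L k i * (ρ * ((g *ᵥ v) ⬝ᵥ (DA k *ᵥ v))) := by
        rw [Finset.mul_sum]; exact Finset.sum_congr rfl fun k _ => by ring
    _ = 2 * ((g *ᵥ v) ⬝ᵥ (A *ᵥ v)) * (∑ k, L k i * (lam ᵥ* A) k) -
        2 * (lam ⬝ᵥ (A *ᵥ v)) * ∑ k, L k i * ((g * A) *ᵥ v) k := by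
        rw [Finset.mul_sum, Finset.mul_sum, ← Finset.sum_sub_distrib]
        exact Finset.sum_congr rfl fun k _ => by rw [hk]; ring
    _ = _ := by rw [h1, h2]; ring

/-- For a nonsingular `J`-tensor `L` with cofactor `A`, applying `Π_nc(L)` to the differential of the
Hamiltonian of `A` gives `det L` times the Newton field, which depends on the metric and on `X`
only. -/
theorem phaseMatrix_mulVec_phaseCovector {L A : Matrix ι ι ℝ} {dL dA dG : ι → Matrix ι ι ℝ} {ρ : ℝ}
    {lam : ι → ℝ} (X p : ι → ℝ)
    (hg : IsMetricJet g G Γ) (hdG : ∀ h, dG h = -(Γ h * G) - G * (Γ h)ᵀ)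
    (hL : IsJTensorJet g G L (fun h => dL h + Γ h * L - L * Γ h) lam)
    (hA : IsCofactorJet L (fun h => dL h + Γ h * L - L * Γ h) ρ A
      (fun h => dA h + Γ h * A - A * Γ h)) :
    phaseMatrix p L dL *ᵥ phaseCovector g G dG X p A dA = ρ • newtonField g G Γ X p := by
  have hs : Aᵀ * g = g * A := hA.lowered_symm hL.symm
  set v := G *ᵥ p with hv
  set u := A *ᵥ v with hu
  have hgv : g *ᵥ v = p := by rw [hv, Matrix.mulVec_mulVec, hg.mul_eq_one, Matrix.one_mulVec]
  have hLu : L *ᵥ u = ρ • v := by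
    rw [hu, Matrix.mulVec_mulVec, hA.mul_right, Matrix.smul_mulVec, Matrix.one_mulVec]
  have hLg : ∀ w : ι → ℝ, Lᵀ *ᵥ (g *ᵥ (A *ᵥ w)) = ρ • (g *ᵥ w) := fun w => by
    rw [Matrix.mulVec_mulVec, Matrix.mulVec_mulVec, hL.symm, mul_assoc, hA.mul_right,
      mul_smul_comm, mul_one, Matrix.smul_mulVec]
  have hq : (fun i => phaseCovector g G dG X p A dA (Sum.inl i)) =
      fun i => (1 / 2) * (p ⬝ᵥ ((dA i + Γ i * A - A * Γ i) *ᵥ v)) -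
        p ⬝ᵥ (Γ i *ᵥ u) + (g *ᵥ (A *ᵥ X)) i :=
    funext fun i => phaseCovector_inl X p hg hdG hs i
  have hp : (fun i => phaseCovector g G dG X p A dA (Sum.inr i)) = u := rfl
  have hsplit : phaseCovector g G dG X p A dA = Sum.elim
      (fun i => phaseCovector g G dG X p A dA (Sum.inl i))
      (fun i => phaseCovector g G dG X p A dA (Sum.inr i)) := by
    ext a; cases a <;> rfl
  -- `hJ` is the `J`-tensor equation; `hdL` rewrites it in terms of partial derivatives
  have hJ : ∀ (j : ι) (w : ι → ℝ), p ⬝ᵥ ((dL j + Γ j * L - L * Γ j) *ᵥ w) =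
      p j * (lam ⬝ᵥ w) + (p ⬝ᵥ (G *ᵥ lam)) * (g *ᵥ w) j := fun j w => by
    have hc : g.col j ⬝ᵥ w = (g *ᵥ w) j := by
      conv_rhs => rw [← hg.symm]
      rfl
    rw [hL.cov j, Matrix.add_mulVec, dotProduct_add, Matrix.vecMulVec_mulVec,
      Matrix.vecMulVec_mulVec, hc]
    simp only [dotProduct_smul, op_smul_eq_smul, smul_eq_mul, dotProduct_single]
    ring
  have hdL : ∀ (j : ι) (w : ι → ℝ), p ⬝ᵥ (dL j *ᵥ w) =
      p j * (lam ⬝ᵥ w) + (p ⬝ᵥ (G *ᵥ lam)) * (g *ᵥ w) j - p ⬝ᵥ (Γ j *ᵥ (L *ᵥ w)) +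
        (p ᵥ* L) ⬝ᵥ (Γ j *ᵥ w) := fun j w => by
    rw [← hJ, ← Matrix.dotProduct_mulVec p L]
    simp only [Matrix.add_mulVec, Matrix.sub_mulVec, dotProduct_add, dotProduct_sub,
      Matrix.mulVec_mulVec]
    ring
  have hΩ : ∀ i, ((Matrix.of fun i j => ∑ k, (dL j k i - dL i k j) * p k) *ᵥ u) i =
      (∑ j, u j * (p ⬝ᵥ (dL j *ᵥ Pi.single i 1))) - p ⬝ᵥ (dL i *ᵥ u) := fun i => by
    simp only [Matrix.mulVec_single_one]
    simp only [Matrix.mulVec, dotProduct, Matrix.of_apply, Finset.mul_sum, Matrix.col_apply]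
    rw [Finset.sum_comm (f := fun k j => p k * (dL i k j * u j)), ← Finset.sum_sub_distrib]
    refine Finset.sum_congr rfl fun j _ => ?_
    rw [Finset.sum_mul, ← Finset.sum_sub_distrib]
    exact Finset.sum_congr rfl fun k _ => by ring
  have hΓ : ∀ (w : ι → ℝ) (i : ι),
      ∑ j, u j * (w ⬝ᵥ (Γ j *ᵥ Pi.single i 1)) = w ⬝ᵥ (Γ i *ᵥ u) := fun w i => by
    rw [← hg.sum_vecMul_christoffel]
    exact Finset.sum_congr rfl fun j _ => by
      rw [Matrix.mulVec_single_one]; rfl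
  have hΓL : ∀ i : ι, ∑ j, u j * (p ⬝ᵥ (Γ j *ᵥ (L *ᵥ Pi.single i 1))) =
      ∑ k, L k i * (p ⬝ᵥ (Γ k *ᵥ u)) := fun i => by
    simp_rw [← hΓ, Finset.mul_sum]
    rw [Finset.sum_comm]
    refine Finset.sum_congr rfl fun j _ => ?_
    have : L *ᵥ Pi.single i 1 = ∑ k, L k i • (Pi.single k 1 : ι → ℝ) := by
      rw [Matrix.mulVec_single_one]
      ext k
      simp [Finset.sum_apply, Pi.single_apply]
    rw [this, Matrix.mulVec_sum, dotProduct_sum, Finset.mul_sum]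
    refine Finset.sum_congr rfl fun k _ => ?_
    rw [Matrix.mulVec_smul, dotProduct_smul, smul_eq_mul]
    ring
  rw [hsplit, hq, hp, phaseMatrix, Matrix.fromBlocks_mulVec]
  ext (i | i)
  · have := congrFun hLu i
    simpa [newtonField] using this
  · have hkin := sum_dotProduct_cov_cofactor hg hL hA v i
    rw [hgv] at hkin
    have hX : ∑ k, L k i * (g *ᵥ (A *ᵥ X)) k = ρ * (g *ᵥ X) i := congrFun (hLg X) i
    have h1 : ∑ j, u j * (p ⬝ᵥ (dL j *ᵥ Pi.single i 1)) =
        lam i * (p ⬝ᵥ u) + (p ⬝ᵥ (G *ᵥ lam)) * (g *ᵥ u) i -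
          (∑ k, L k i * (p ⬝ᵥ (Γ k *ᵥ u))) + (p ᵥ* L) ⬝ᵥ (Γ i *ᵥ u) := by
      simp_rw [hdL]
      rw [← hΓL, ← hΓ]
      have h2 : lam i * (p ⬝ᵥ u) = ∑ j, u j * (p j * (lam ⬝ᵥ Pi.single i 1)) := by
        simp only [dotProduct_single]
        simp only [dotProduct, Finset.mul_sum]
        exact Finset.sum_congr rfl fun j _ => by ring
      have h3 : (p ⬝ᵥ (G *ᵥ lam)) * (g *ᵥ u) i =
          ∑ j, u j * ((p ⬝ᵥ (G *ᵥ lam)) * (g *ᵥ Pi.single i 1) j) := by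
        rw [Matrix.mulVec_single_one]
        have : (g *ᵥ u) i = ∑ j, u j * g.col i j := by
          conv_lhs => rw [← hg.symm]
          exact Finset.sum_congr rfl fun j _ => mul_comm _ _
        rw [this, Finset.mul_sum]
        exact Finset.sum_congr rfl fun j _ => by ring
      rw [h2, h3, ← Finset.sum_add_distrib, ← Finset.sum_sub_distrib, ← Finset.sum_add_distrib]
      exact Finset.sum_congr rfl fun j _ => by ring
    have hLq : (-Lᵀ *ᵥ fun i => (1 / 2) * (p ⬝ᵥ ((dA i + Γ i * A - A * Γ i) *ᵥ v)) -
        p ⬝ᵥ (Γ i *ᵥ u) + (g *ᵥ (A *ᵥ X)) i) i =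
        -((1 / 2) * ∑ k, L k i * (p ⬝ᵥ ((dA k + Γ k * A - A * Γ k) *ᵥ v))) +
          (∑ k, L k i * (p ⬝ᵥ (Γ k *ᵥ u))) - ∑ k, L k i * (g *ᵥ (A *ᵥ X)) k := by
      rw [Finset.mul_sum, ← Finset.sum_neg_distrib, ← Finset.sum_add_distrib,
        ← Finset.sum_sub_distrib]
      refine Finset.sum_congr rfl fun k _ => ?_
      simp only [Matrix.neg_apply, Matrix.transpose_apply]
      ring
    simp only [newtonField, Sum.elim_inr, Function.comp_def, Sum.elim_inl, Pi.add_apply,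
      Pi.smul_apply, smul_eq_mul]
    rw [hLq, hΩ, h1, hdL i u, hLu, hkin, hX, Matrix.mulVec_smul, dotProduct_smul, smul_eq_mul]
    ring

/-- The natural Hamiltonian of a Killing tensor, with potential differential `g K X`, is constant along
the Newton field. -/
theorem phaseCovector_dotProduct_newtonField {K : Matrix ι ι ℝ} {dG dK : ι → Matrix ι ι ℝ}
    (X p : ι → ℝ)
    (hg : IsMetricJet g G Γ) (hdG : ∀ h, dG h = -(Γ h * G) - G * (Γ h)ᵀ)
    (hK : Kᵀ * g = g * K)
    (hkill : ∀ h i j, (g * (dK h + Γ h * K - K * Γ h)) i j +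
      (g * (dK i + Γ i * K - K * Γ i)) j h + (g * (dK j + Γ j * K - K * Γ j)) h i = 0) :
    phaseCovector g G dG X p K dK ⬝ᵥ newtonField g G Γ X p = 0 := by
  set v := G *ᵥ p with hv
  have hgv : g *ᵥ v = p := by rw [hv, Matrix.mulVec_mulVec, hg.mul_eq_one, Matrix.one_mulVec]
  have hsplit : phaseCovector g G dG X p K dK ⬝ᵥ newtonField g G Γ X p =
      ∑ i, phaseCovector g G dG X p K dK (Sum.inl i) * v i +
        ∑ i, (K *ᵥ v) i * (p ⬝ᵥ (Γ i *ᵥ v) - (g *ᵥ X) i) := by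
    simp only [dotProduct, Fintype.sum_sum_type]
    rfl
  have hmove : ∀ B : Matrix ι ι ℝ, p ⬝ᵥ (B *ᵥ v) = v ⬝ᵥ ((g * B) *ᵥ v) := fun B => by
    rw [← hgv, ← Matrix.mulVec_mulVec, Matrix.dotProduct_mulVec v, ← Matrix.mulVec_transpose,
      hg.symm]
  -- the three cyclic rearrangements of the cubic form agree
  have hcubic : ∑ i, (p ⬝ᵥ ((dK i + Γ i * K - K * Γ i) *ᵥ v)) * v i = 0 := by
    simp_rw [hmove]
    set C : ι → ι → ι → ℝ := fun h i j => (g * (dK h + Γ h * K - K * Γ h)) i j with hC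
    have e0 : ∑ h, (v ⬝ᵥ ((g * (dK h + Γ h * K - K * Γ h)) *ᵥ v)) * v h =
        ∑ h, ∑ i, ∑ j, C h i j * (v h * v i * v j) := by
      refine Finset.sum_congr rfl fun h _ => ?_
      simp only [dotProduct, Matrix.mulVec, Finset.mul_sum, Finset.sum_mul, hC]
      exact Finset.sum_congr rfl fun i _ => Finset.sum_congr rfl fun j _ => by ring
    have e1 : ∑ h, ∑ i, ∑ j, C h i j * (v h * v i * v j) =
        ∑ h, ∑ i, ∑ j, C i j h * (v h * v i * v j) := by
      rw [Finset.sum_comm]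
      calc _ = ∑ i, ∑ j, ∑ h, C h i j * (v h * v i * v j) :=
            Finset.sum_congr rfl fun i _ => Finset.sum_comm
        _ = ∑ j, ∑ i, ∑ h, C h i j * (v h * v i * v j) := Finset.sum_comm
        _ = _ := Finset.sum_congr rfl fun j _ => by
            rw [Finset.sum_comm]
            exact Finset.sum_congr rfl fun _ _ => Finset.sum_congr rfl fun _ _ => by ring
    have e2 : ∑ h, ∑ i, ∑ j, C h i j * (v h * v i * v j) =
        ∑ h, ∑ i, ∑ j, C j h i * (v h * v i * v j) := by
      rw [Finset.sum_comm]
      refine Finset.sum_congr rfl fun i _ => ?_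
      rw [Finset.sum_comm]
      exact Finset.sum_congr rfl fun _ _ => Finset.sum_congr rfl fun _ _ => by ring
    have e3 : ∑ h, ∑ i, ∑ j, C h i j * (v h * v i * v j) +
        ∑ h, ∑ i, ∑ j, C i j h * (v h * v i * v j) +
        ∑ h, ∑ i, ∑ j, C j h i * (v h * v i * v j) = 0 := by
      simp only [← Finset.sum_add_distrib, ← add_mul]
      refine Finset.sum_eq_zero fun h _ => Finset.sum_eq_zero fun i _ =>
        Finset.sum_eq_zero fun j _ => ?_
      rw [hkill h i j, zero_mul]
    rw [e0]
    linarith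
  have hΓ : ∑ i, (K *ᵥ v) i * (p ⬝ᵥ (Γ i *ᵥ v)) = ∑ i, (p ⬝ᵥ (Γ i *ᵥ (K *ᵥ v))) * v i := by
    simp_rw [← hg.sum_vecMul_christoffel, Finset.mul_sum, Finset.sum_mul]
    rw [Finset.sum_comm]
    refine Finset.sum_congr rfl fun j _ => ?_
    have : ∀ i, (K *ᵥ v) i * (v j * (p ᵥ* Γ j) i) = v j * ((p ᵥ* Γ j) i * (K *ᵥ v) i) :=
      fun i => by ring
    simp_rw [this, ← Finset.mul_sum]
    rw [show ∑ i, (p ᵥ* Γ j) i * (K *ᵥ v) i = p ⬝ᵥ (Γ j *ᵥ (K *ᵥ v)) from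
      (Matrix.dotProduct_mulVec _ _ _).symm, ← hg.sum_vecMul_christoffel, Finset.mul_sum]
    exact Finset.sum_congr rfl fun i _ => by ring
  have hX : ∑ i, (g *ᵥ (K *ᵥ X)) i * v i = ∑ i, (K *ᵥ v) i * (g *ᵥ X) i := by
    have h1 : ∑ i, (g *ᵥ (K *ᵥ X)) i * v i = v ⬝ᵥ (g *ᵥ (K *ᵥ X)) := dotProduct_comm _ _
    have h2 : ∑ i, (K *ᵥ v) i * (g *ᵥ X) i = (K *ᵥ v) ⬝ᵥ (g *ᵥ X) := rfl
    rw [h1, h2, Matrix.mulVec_mulVec, ← hK, ← Matrix.mulVec_mulVec, Matrix.dotProduct_mulVec,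
      Matrix.vecMul_transpose]
  rw [hsplit]
  simp_rw [phaseCovector_inl X p hg hdG hK, ← hv, add_mul, sub_mul, mul_sub,
    Finset.sum_add_distrib, Finset.sum_sub_distrib, hΓ, hX, mul_assoc, ← Finset.mul_sum, hcubic]
  ring

/-- The bracket of two covectors defined by `Π_nc(L)`. -/
def phaseBracket (p : ι → ℝ) (L : Matrix ι ι ℝ) (dL : ι → Matrix ι ι ℝ) (f h : ι ⊕ ι → ℝ) : ℝ :=
  f ⬝ᵥ (phaseMatrix p L dL *ᵥ h)

omit [DecidableEq ι] in
theorem phaseMatrix_transpose (p : ι → ℝ) (L : Matrix ι ι ℝ) (dL : ι → Matrix ι ι ℝ) :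
    (phaseMatrix p L dL)ᵀ = -phaseMatrix p L dL := by
  rw [phaseMatrix, Matrix.fromBlocks_transpose, Matrix.fromBlocks_neg]
  congr 1
  · simp
  · simp
  · ext i j
    simp only [Matrix.transpose_apply, Matrix.neg_apply, Matrix.of_apply, ← Finset.sum_neg_distrib]
    exact Finset.sum_congr rfl fun k _ => by ring

omit [DecidableEq ι] in
theorem phaseBracket_swap (p : ι → ℝ) (L : Matrix ι ι ℝ) (dL : ι → Matrix ι ι ℝ)
    (f h : ι ⊕ ι → ℝ) : phaseBracket p L dL f h = -phaseBracket p L dL h f := by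
  rw [phaseBracket, phaseBracket, Matrix.dotProduct_mulVec, dotProduct_comm,
    ← Matrix.mulVec_transpose, phaseMatrix_transpose, Matrix.neg_mulVec, dotProduct_neg]

omit [DecidableEq ι] in
theorem phaseMatrix_add_smul (p : ι → ℝ) (L L' : Matrix ι ι ℝ) (dL dL' : ι → Matrix ι ι ℝ)
    (c : ℝ) : phaseMatrix p (L + c • L') (dL + c • dL') =
      phaseMatrix p L dL + c • phaseMatrix p L' dL' := by
  rw [phaseMatrix, phaseMatrix, phaseMatrix, Matrix.fromBlocks_smul, Matrix.fromBlocks_add]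
  congr 1
  · simp
  · rw [Matrix.transpose_add, Matrix.transpose_smul, smul_neg]; abel
  · ext i j
    simp only [Matrix.add_apply, Matrix.smul_apply, Matrix.of_apply, Pi.add_apply, Pi.smul_apply,
      smul_eq_mul, Finset.mul_sum, ← Finset.sum_add_distrib]
    exact Finset.sum_congr rfl fun k _ => by ring

/-! ### Closedness of the forms `g (cof L) X` at a point -/

/-- The obstruction to the closedness of the 1-form `g (cof L) X` for a `J`-tensor `L` with 1-form
`lam`, where column `h` of `Y` is `∇_h X`. It is linear in the pair `(L, lam)`, whereas the 1-form
itself is of degree `n - 1` in `L`. -/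
def curlObstruction (g L : Matrix ι ι ℝ) (lam X : ι → ℝ) (Y : Matrix ι ι ℝ) : Matrix ι ι ℝ :=
  (3 : ℝ) • (Matrix.vecMulVec lam (g *ᵥ X) - Matrix.vecMulVec (g *ᵥ X) lam) +
    ((g * Y * L)ᵀ - g * Y * L)

theorem curlObstruction_add_smul (g L L' : Matrix ι ι ℝ) (lam lam' X : ι → ℝ)
    (Y : Matrix ι ι ℝ) (c : ℝ) :
    curlObstruction g (L + c • L') (lam + c • lam') X Y =
      curlObstruction g L lam X Y + c • curlObstruction g L' lam' X Y := by
  simp only [curlObstruction, mul_add, mul_smul_comm, Matrix.transpose_add, Matrix.transpose_smul,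
    Matrix.vecMulVec_add, Matrix.add_vecMulVec, Matrix.vecMulVec_smul, Matrix.smul_vecMulVec]
  module

/-- The exterior derivative `C` of `g A X`, pulled back by `L` in both arguments, is `ρ` times the
obstruction. -/
theorem curl_cofactor {L A : Matrix ι ι ℝ} {DL DA : ι → Matrix ι ι ℝ} {ρ : ℝ}
    {lam : ι → ℝ} (hg : IsMetricJet g G Γ) (hL : IsJTensorJet g G L DL lam)
    (hA : IsCofactorJet L DL ρ A DA) (X : ι → ℝ) (Y C : Matrix ι ι ℝ)
    (hC : ∀ h j, C h j = (g *ᵥ (DA h *ᵥ X)) j - (g *ᵥ (DA j *ᵥ X)) h +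
      (g * A * Y) j h - (g * A * Y) h j) :
    Lᵀ * C * L = ρ • curlObstruction g L lam X Y := by
  have hs : Aᵀ * g = g * A := hA.lowered_symm hL.symm
  have hsym := hg.lowered_apply_comm hs
  have hD : ∀ h j, ρ * (g *ᵥ (DA h *ᵥ X)) j =
      2 * (lam ᵥ* A) h * ((g * A) *ᵥ X) j - (g * A) j h * ((lam ᵥ* A) ⬝ᵥ X) -
        (lam ᵥ* A) j * ((g * A) *ᵥ X) h := fun h j => by
    rw [Matrix.mulVec_mulVec]
    simp only [Matrix.mulVec, dotProduct, Finset.mul_sum, ← Finset.sum_sub_distrib]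
    refine Finset.sum_congr rfl fun k _ => ?_
    rw [← mul_assoc ρ, cov_cofactor hg hL hA, hsym k h]
    ring
  have hρC : ρ • C = (3 : ℝ) • (Matrix.vecMulVec (lam ᵥ* A) ((g * A) *ᵥ X) -
      Matrix.vecMulVec ((g * A) *ᵥ X) (lam ᵥ* A)) +
      ρ • ((g * A * Y)ᵀ - g * A * Y) := by
    ext h j
    simp only [Matrix.smul_apply, Matrix.add_apply, Matrix.sub_apply, Matrix.vecMulVec_apply,
      Matrix.transpose_apply, smul_eq_mul, hC]
    have h1 := hD h j
    have h2 := hD j h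
    rw [hsym h j] at h2
    linear_combination h1 - h2
  have hlam : Lᵀ *ᵥ (lam ᵥ* A) = ρ • lam := by
    rw [Matrix.mulVec_transpose, Matrix.vecMul_vecMul, hA.mul_left, Matrix.vecMul_smul,
      Matrix.vecMul_one]
  have hLgA : Lᵀ * (g * A) = ρ • g := by
    rw [← mul_assoc, hL.symm, mul_assoc, hA.mul_right, mul_smul_comm, mul_one]
  have hβ : Lᵀ *ᵥ ((g * A) *ᵥ X) = ρ • (g *ᵥ X) := by
    rw [Matrix.mulVec_mulVec, hLgA, Matrix.smul_mulVec]
  have hvv : ∀ a b : ι → ℝ, Lᵀ * Matrix.vecMulVec a b * L =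
      Matrix.vecMulVec (Lᵀ *ᵥ a) (Lᵀ *ᵥ b) := fun a b => by
    rw [Matrix.mul_vecMulVec, Matrix.vecMulVec_mul, Matrix.mulVec_transpose L b]
  have hZ : Lᵀ * (g * A * Y) * L = ρ • (g * Y * L) := by
    rw [← mul_assoc, hLgA, smul_mul_assoc, smul_mul_assoc]
  have hZt : Lᵀ * (g * A * Y)ᵀ * L = ρ • (g * Y * L)ᵀ := by
    have := congrArg Matrix.transpose hZ
    rwa [Matrix.transpose_mul, Matrix.transpose_mul, Matrix.transpose_transpose, ← mul_assoc,
      Matrix.transpose_smul] at this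
  have h := congrArg (fun B => Lᵀ * B * L) hρC
  simp only [mul_add, add_mul, mul_sub, sub_mul, mul_smul_comm, smul_mul_assoc, hvv, hZ, hZt, hlam,
    hβ, Matrix.vecMulVec_smul, Matrix.smul_vecMulVec] at h
  apply smul_right_injective _ hA.ne_zero
  simp only
  rw [h, curlObstruction]
  module

theorem curl_cofactor_eq_zero_iff {L A : Matrix ι ι ℝ} {dL dA dg : ι → Matrix ι ι ℝ} {ρ : ℝ}
    {lam : ι → ℝ} (hg : IsMetricJet g G Γ) (hdg : ∀ h, dg h = (Γ h)ᵀ * g + g * Γ h)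
    (hL : IsJTensorJet g G L (fun h => dL h + Γ h * L - L * Γ h) lam)
    (hA : IsCofactorJet L (fun h => dL h + Γ h * L - L * Γ h) ρ A
      (fun h => dA h + Γ h * A - A * Γ h)) (X : ι → ℝ) (dX : ι → ι → ℝ) :
    (∀ h j, ((dg h * A + g * dA h) *ᵥ X + (g * A) *ᵥ dX h) j =
      ((dg j * A + g * dA j) *ᵥ X + (g * A) *ᵥ dX j) h) ↔
    curlObstruction g L lam X (Matrix.of fun k h => (dX h + Γ h *ᵥ X) k) = 0 := by
  set Y : Matrix ι ι ℝ := Matrix.of fun k h => (dX h + Γ h *ᵥ X) k with hY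
  set b : ι → ι → ℝ := fun h j => ((dg h * A + g * dA h) *ᵥ X + (g * A) *ᵥ dX h) j with hb
  have hbe : ∀ h j, b h j = ((Γ h)ᵀ *ᵥ ((g * A) *ᵥ X)) j +
      (g *ᵥ ((dA h + Γ h * A - A * Γ h) *ᵥ X)) j + (g * A * Y) j h := fun h j => by
    have h1 : (g * A * Y) j h = ((g * A) *ᵥ (dX h + Γ h *ᵥ X)) j := rfl
    have h2 : (dg h * A + g * dA h) *ᵥ X + (g * A) *ᵥ dX h = (Γ h)ᵀ *ᵥ ((g * A) *ᵥ X) +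
        g *ᵥ ((dA h + Γ h * A - A * Γ h) *ᵥ X) + (g * A) *ᵥ (dX h + Γ h *ᵥ X) := by
      simp only [hdg, Matrix.mulVec_add, Matrix.mulVec_sub, add_mul, Matrix.add_mulVec,
        Matrix.sub_mulVec]
      simp only [Matrix.mulVec_mulVec, mul_assoc]
      abel
    rw [h1]
    exact congrFun h2 j
  have hΓ : ∀ (w : ι → ℝ) h j, ((Γ h)ᵀ *ᵥ w) j = ((Γ j)ᵀ *ᵥ w) h := fun w h j => by
    simp only [Matrix.mulVec, dotProduct, Matrix.transpose_apply]
    refine Finset.sum_congr rfl fun k _ => ?_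
    have := hg.torsionFree h j k
    rw [this]
  have hcurl := curl_cofactor hg hL hA X Y (Matrix.of fun h j => b h j - b j h) (fun h j => by
    simp only [Matrix.of_apply, hbe, hΓ _ h j]
    ring)
  constructor
  · intro h0
    have : (Matrix.of fun h j => b h j - b j h) = 0 := by
      ext h j
      exact sub_eq_zero.mpr (h0 h j)
    rw [this, mul_zero, zero_mul] at hcurl
    exact (smul_eq_zero.mp hcurl.symm).resolve_left hA.ne_zero
  · intro h0 h j
    rw [h0, smul_zero] at hcurl
    have h1 : Aᵀ * (Lᵀ * (Matrix.of fun h j => b h j - b j h) * L) * A =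
        (ρ * ρ) • (Matrix.of fun h j => b h j - b j h) := by
      rw [mul_assoc, mul_assoc, mul_assoc, hA.mul_right, ← mul_assoc, ← Matrix.transpose_mul,
        hA.mul_right]
      simp [smul_smul]
    rw [hcurl, mul_zero, zero_mul] at h1
    have h2 := (smul_eq_zero.mp h1.symm).resolve_left (mul_ne_zero hA.ne_zero hA.ne_zero)
    have h3 := congrFun (congrFun h2 h) j
    exact sub_eq_zero.mp h3

/-- The Hamiltonians of two cofactors of the pencil `J₂ + ξ J₁`, with the same `X`, are in
involution for `Π_nc(J₁)` and `Π_nc(J₂)`. They are in involution for the operators of both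
`J₂ + ξ J₁` and `J₂ + η J₁`, since each of these sends the differential of its own Hamiltonian to a
multiple of the Newton field; and `Π_nc` is linear in its argument. -/
theorem phaseBracket_cofactor_pencil {J₁ J₂ A B : Matrix ι ι ℝ}
    {dJ₁ dJ₂ dA dB dG : ι → Matrix ι ι ℝ} {ρ σ ξ η : ℝ} {lam mu : ι → ℝ} (X p : ι → ℝ)
    (hg : IsMetricJet g G Γ) (hdG : ∀ h, dG h = -(Γ h * G) - G * (Γ h)ᵀ)
    (hL : IsJTensorJet g G (J₂ + ξ • J₁) (fun h => (dJ₂ + ξ • dJ₁) h + Γ h * (J₂ + ξ • J₁) -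
      (J₂ + ξ • J₁) * Γ h) lam)
    (hA : IsCofactorJet (J₂ + ξ • J₁) (fun h => (dJ₂ + ξ • dJ₁) h + Γ h * (J₂ + ξ • J₁) -
      (J₂ + ξ • J₁) * Γ h) ρ A (fun h => dA h + Γ h * A - A * Γ h))
    (hL' : IsJTensorJet g G (J₂ + η • J₁) (fun h => (dJ₂ + η • dJ₁) h + Γ h * (J₂ + η • J₁) -
      (J₂ + η • J₁) * Γ h) mu)
    (hB : IsCofactorJet (J₂ + η • J₁) (fun h => (dJ₂ + η • dJ₁) h + Γ h * (J₂ + η • J₁) -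
      (J₂ + η • J₁) * Γ h) σ B (fun h => dB h + Γ h * B - B * Γ h))
    (hξη : ξ ≠ η) :
    phaseBracket p J₁ dJ₁ (phaseCovector g G dG X p A dA) (phaseCovector g G dG X p B dB) = 0 ∧
    phaseBracket p J₂ dJ₂ (phaseCovector g G dG X p A dA) (phaseCovector g G dG X p B dB) = 0 := by
  set f := phaseCovector g G dG X p A dA
  set h := phaseCovector g G dG X p B dB
  have e1 : phaseBracket p (J₂ + ξ • J₁) (dJ₂ + ξ • dJ₁) f h = 0 := by
    rw [phaseBracket_swap, phaseBracket, phaseMatrix_mulVec_phaseCovector X p hg hdG hL hA,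
      dotProduct_smul, phaseCovector_dotProduct_newtonField X p hg hdG (hB.lowered_symm hL'.symm)
        (killing_cofactor hg hL' hB), smul_zero, neg_zero]
  have e2 : phaseBracket p (J₂ + η • J₁) (dJ₂ + η • dJ₁) f h = 0 := by
    rw [phaseBracket, phaseMatrix_mulVec_phaseCovector X p hg hdG hL' hB,
      dotProduct_smul, phaseCovector_dotProduct_newtonField X p hg hdG (hA.lowered_symm hL.symm)
        (killing_cofactor hg hL hA), smul_zero]
  have hexp : ∀ c : ℝ, phaseBracket p (J₂ + c • J₁) (dJ₂ + c • dJ₁) f h =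
      phaseBracket p J₂ dJ₂ f h + c * phaseBracket p J₁ dJ₁ f h := fun c => by
    simp only [phaseBracket, phaseMatrix_add_smul, Matrix.add_mulVec, dotProduct_add,
      Matrix.smul_mulVec, dotProduct_smul, smul_eq_mul]
  rw [hexp] at e1 e2
  have h1 : phaseBracket p J₁ dJ₁ f h = 0 := by
    have : (ξ - η) * phaseBracket p J₁ dJ₁ f h = 0 := by linear_combination e1 - e2
    exact (mul_eq_zero.mp this).resolve_left (sub_ne_zero.mpr hξη)
  exact ⟨h1, by simpa [h1] using e1⟩

theorem IsJTensorJet.add_smul {L L' : Matrix ι ι ℝ} {dL dL' : ι → Matrix ι ι ℝ}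
    {lam lam' : ι → ℝ}
    (h : IsJTensorJet g G L (fun h => dL h + Γ h * L - L * Γ h) lam)
    (h' : IsJTensorJet g G L' (fun h => dL' h + Γ h * L' - L' * Γ h) lam') (c : ℝ) :
    IsJTensorJet g G (L + c • L')
      (fun h => (dL + c • dL') h + Γ h * (L + c • L') - (L + c • L') * Γ h) (lam + c • lam') where
  symm := by
    rw [Matrix.transpose_add, Matrix.transpose_smul, add_mul, smul_mul_assoc, h.symm, h'.symm,
      mul_add, mul_smul_comm]
  cov k := by
    have e : dL k + Γ k * L - L * Γ k = _ := h.cov k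
    have e' : dL' k + Γ k * L' - L' * Γ k = _ := h'.cov k
    rw [Matrix.mulVec_add, Matrix.mulVec_smul, Matrix.vecMulVec_add, Matrix.add_vecMulVec,
      Matrix.vecMulVec_smul, Matrix.smul_vecMulVec]
    calc _ = (dL k + Γ k * L - L * Γ k) + c • (dL' k + Γ k * L' - L' * Γ k) := by
          simp only [Pi.add_apply, Pi.smul_apply, mul_add, add_mul, mul_smul_comm, smul_mul_assoc]
          module
      _ = _ := by rw [e, e']; module

/-- The relations of a cofactor survive the passage from partial to covariant derivatives. -/
theorem IsCofactorJet.covariant {L A : Matrix ι ι ℝ} {dL dA : ι → Matrix ι ι ℝ} {ρ : ℝ}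
    (h : IsCofactorJet L dL ρ A dA) (Γ : ι → Matrix ι ι ℝ) :
    IsCofactorJet L (fun h => dL h + Γ h * L - L * Γ h) ρ A
      (fun h => dA h + Γ h * A - A * Γ h) where
  ne_zero := h.ne_zero
  mul_left := h.mul_left
  mul_right := h.mul_right
  deriv k := by
    have htr : (A * (dL k + Γ k * L - L * Γ k)).trace = (A * dL k).trace := by
      have h1 : (A * (Γ k * L)).trace = (A * (L * Γ k)).trace := by
        rw [Matrix.trace_mul_comm, mul_assoc, h.mul_right, ← mul_assoc, h.mul_left]
        simp
      rw [mul_sub, mul_add, Matrix.trace_sub, Matrix.trace_add, h1]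
      ring
    rw [htr, ← h.deriv k]
    have h2 : A * (L * Γ k) = Γ k * (A * L) := by
      rw [← mul_assoc, h.mul_left]; simp
    have h3 : (dA k + Γ k * A - A * Γ k) * L + A * (dL k + Γ k * L - L * Γ k) =
        dA k * L + A * dL k + (Γ k * (A * L) - A * (L * Γ k)) := by noncomm_ring
    rw [h3, h2]
    simp

end PointwiseAlgebra

/-! ### The cofactor of a pencil of endomorphisms -/

section CofactorPencil

open Polynomial

theorem degree_adjugate_pencil_lt {N : ℕ} (A B : Matrix (Fin N) (Fin N) ℝ) (i j : Fin N) :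
    ((B.map C + (X : ℝ[X]) • A.map C).adjugate i j).degree < N := by
  cases N with
  | zero => exact i.elim0
  | succ m =>
    rw [Matrix.adjugate_fin_succ_eq_det_submatrix, add_comm (B.map C)]
    refine lt_of_le_of_lt (degree_mul_le _ _) ?_
    have h1 : ((-1 : ℝ[X]) ^ (j + i : ℕ)).degree ≤ 0 := by
      rcases neg_one_pow_eq_or ℝ[X] (j + i : ℕ) with h | h <;> rw [h] <;> simp
    have h2 := natDegree_det_X_add_C_le (A.submatrix j.succAbove i.succAbove)
      (B.submatrix j.succAbove i.succAbove)
    rw [Fintype.card_fin] at h2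
    have h3 := degree_le_of_natDegree_le h2
    refine lt_of_le_of_lt (b := 0 + (m : WithBot ℕ)) (add_le_add h1 h3) ?_
    rw [zero_add]
    exact_mod_cast Nat.lt_succ_self m

theorem eval_adjugate_pencil {N : ℕ} (A B : Matrix (Fin N) (Fin N) ℝ) (i j : Fin N) (ξ : ℝ) :
    ((B.map C + (X : ℝ[X]) • A.map C).adjugate i j).eval ξ = (B + ξ • A).adjugate i j := by
  have h := RingHom.map_adjugate (evalRingHom ξ) (B.map C + (X : ℝ[X]) • A.map C)
  have h2 : (evalRingHom ξ).mapMatrix (B.map C + (X : ℝ[X]) • A.map C) = B + ξ • A := by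
    ext k l
    simp
    ring
  rw [h2] at h
  exact congrFun (congrFun h i) j

theorem coeff_adjugate_pencil_top {m : ℕ} (A B : Matrix (Fin (m + 1)) (Fin (m + 1)) ℝ)
    (i j : Fin (m + 1)) :
    ((B.map C + (X : ℝ[X]) • A.map C).adjugate i j).coeff m = A.adjugate i j := by
  rw [Matrix.adjugate_fin_succ_eq_det_submatrix, Matrix.adjugate_fin_succ_eq_det_submatrix,
    add_comm (B.map C)]
  have h := coeff_det_X_add_C_card (A.submatrix j.succAbove i.succAbove)
      (B.submatrix j.succAbove i.succAbove)
  rw [Fintype.card_fin] at h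
  rw [← h]
  rcases neg_one_pow_eq_or ℝ[X] (j + i : ℕ) with h1 | h1 <;>
  rcases neg_one_pow_eq_or ℝ (j + i : ℕ) with h2 | h2
  · rw [h1, h2, one_mul, one_mul]; rfl
  · have := congrArg (eval 0) h1
    simp [h2] at this
    norm_num at this
  · have := congrArg (eval 0) h1
    simp [h2] at this
    norm_num at this
  · rw [h1, h2, neg_one_mul, neg_one_mul, coeff_neg]; rfl

variable {T : Type*} [AddCommGroup T] [Module ℝ T] [FiniteDimensional ℝ T]

theorem toMatrix_finBasis_cof (A : Module.End ℝ T) :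
    LinearMap.toMatrix (Module.finBasis ℝ T) (Module.finBasis ℝ T) (cof A) =
      (LinearMap.toMatrix (Module.finBasis ℝ T) (Module.finBasis ℝ T) A).adjugate :=
  LinearMap.toMatrix_toLin _ _ _

/-- The cofactor does not depend on the basis. -/
theorem toMatrix_cof {ι : Type*} [Fintype ι] [DecidableEq ι] (b : Module.Basis ι ℝ T)
    (A : Module.End ℝ T) :
    LinearMap.toMatrix b b (cof A) = (LinearMap.toMatrix b b A).adjugate := by
  set c := Module.finBasis ℝ T with hc
  let e : ι ≃ Fin (Module.finrank ℝ T) :=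
    Fintype.equivFinOfCardEq (Module.finrank_eq_card_basis b).symm
  have key : LinearMap.toMatrix (b.reindex e) (b.reindex e) (cof A) =
      (LinearMap.toMatrix (b.reindex e) (b.reindex e) A).adjugate := by
    have h1 : (b.reindex e).toMatrix c * c.toMatrix (b.reindex e) = 1 :=
      Module.Basis.toMatrix_mul_toMatrix_flip _ _
    have h2 : c.toMatrix (b.reindex e) * (b.reindex e).toMatrix c = 1 :=
      Module.Basis.toMatrix_mul_toMatrix_flip _ _
    rw [← basis_toMatrix_mul_linearMap_toMatrix_mul_basis_toMatrix (b.reindex e) c (b.reindex e) c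
      (cof A), ← basis_toMatrix_mul_linearMap_toMatrix_mul_basis_toMatrix (b.reindex e) c
      (b.reindex e) c A, hc, toMatrix_finBasis_cof, ← hc, Matrix.adjugate_mul_distrib,
      Matrix.adjugate_mul_distrib]
    set P := (b.reindex e).toMatrix c
    set Q := c.toMatrix (b.reindex e)
    have hd : P.det * Q.det = 1 := by rw [← Matrix.det_mul, h1, Matrix.det_one]
    have hP : P.adjugate = P.det • Q := by
      calc P.adjugate = P.adjugate * (P * Q) := by rw [h1, mul_one]
        _ = P.det • Q := by rw [← mul_assoc, Matrix.adjugate_mul, smul_mul_assoc, one_mul]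
    have hQ : Q.adjugate = Q.det • P := by
      calc Q.adjugate = Q.adjugate * (Q * P) := by rw [h2, mul_one]
        _ = Q.det • P := by rw [← mul_assoc, Matrix.adjugate_mul, smul_mul_assoc, one_mul]
    rw [hP, hQ, mul_smul_comm, smul_mul_assoc, mul_smul_comm, smul_smul, mul_comm Q.det, hd, one_smul,
      mul_assoc]
  have hre : ∀ D : Module.End ℝ T, LinearMap.toMatrix (b.reindex e) (b.reindex e) D =
      Matrix.reindex e e (LinearMap.toMatrix b b D) := fun D => by
    ext i j
    simp [LinearMap.toMatrix_apply]
  rw [hre, hre, Matrix.adjugate_reindex] at key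
  exact (Matrix.reindex e e).injective key

theorem cof_mul (A : Module.End ℝ T) : cof A * A = LinearMap.det A • 1 := by
  apply (LinearMap.toMatrix (Module.finBasis ℝ T) (Module.finBasis ℝ T)).injective
  rw [LinearMap.toMatrix_mul, toMatrix_finBasis_cof, Matrix.adjugate_mul, LinearMap.det_toMatrix,
    map_smul, LinearMap.toMatrix_one]

theorem mul_cof (A : Module.End ℝ T) : A * cof A = LinearMap.det A • 1 := by
  apply (LinearMap.toMatrix (Module.finBasis ℝ T) (Module.finBasis ℝ T)).injective
  rw [LinearMap.toMatrix_mul, toMatrix_finBasis_cof, Matrix.mul_adjugate, LinearMap.det_toMatrix,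
    map_smul, LinearMap.toMatrix_one]

theorem isUnit_cof {A : Module.End ℝ T} (h : LinearMap.det A ≠ 0) : IsUnit (cof A) :=
  ⟨⟨cof A, (LinearMap.det A)⁻¹ • A, by rw [mul_smul_comm, cof_mul, inv_smul_smul₀ h],
    by rw [smul_mul_assoc, mul_cof, inv_smul_smul₀ h]⟩, rfl⟩

theorem inverse_cof {A : Module.End ℝ T} (h : LinearMap.det A ≠ 0) :
    Ring.inverse (cof A) = (LinearMap.det A)⁻¹ • A := by
  have h1 : Ring.inverse (cof A) * cof A = 1 := Ring.inverse_mul_cancel _ (isUnit_cof h)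
  calc Ring.inverse (cof A) = Ring.inverse (cof A) * (cof A * ((LinearMap.det A)⁻¹ • A)) := by
        rw [mul_smul_comm, cof_mul, inv_smul_smul₀ h, mul_one]
    _ = _ := by rw [← mul_assoc, h1, one_mul]

theorem toMatrix_finBasis_cofPencilCoeff (A B : Module.End ℝ T) (k : ℕ) (i j) :
    LinearMap.toMatrix (Module.finBasis ℝ T) (Module.finBasis ℝ T) (cofPencilCoeff A B k) i j =
      (((LinearMap.toMatrix (Module.finBasis ℝ T) (Module.finBasis ℝ T) B).map C +
        (X : ℝ[X]) • (LinearMap.toMatrix (Module.finBasis ℝ T) (Module.finBasis ℝ T) A).map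
            C).adjugate i j).coeff k := by
  rw [cofPencilCoeff, LinearMap.toMatrix_toLin]
  rfl

theorem toMatrix_finBasis_cof_pencil (A B : Module.End ℝ T) (ξ : ℝ) (i j) :
    LinearMap.toMatrix (Module.finBasis ℝ T) (Module.finBasis ℝ T) (cof (B + ξ • A)) i j =
      (((LinearMap.toMatrix (Module.finBasis ℝ T) (Module.finBasis ℝ T) B).map C +
        (X : ℝ[X]) • (LinearMap.toMatrix (Module.finBasis ℝ T) (Module.finBasis ℝ T) A).map
            C).adjugate i j).eval ξ := by
  rw [toMatrix_finBasis_cof, eval_adjugate_pencil, map_add, map_smul]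

theorem cof_pencil_eq_sum (A B : Module.End ℝ T) (ξ : ℝ) :
    cof (B + ξ • A) =
      ∑ i ∈ Finset.range (Module.finrank ℝ T), ξ ^ i • cofPencilCoeff A B i := by
  apply (LinearMap.toMatrix (Module.finBasis ℝ T) (Module.finBasis ℝ T)).injective
  ext i j
  rw [toMatrix_finBasis_cof_pencil, eval_eq_sum_range'
    (n := Module.finrank ℝ T) ?_, map_sum, Matrix.sum_apply]
  · refine Finset.sum_congr rfl fun k _ => ?_
    rw [map_smul, Matrix.smul_apply, toMatrix_finBasis_cofPencilCoeff, smul_eq_mul, mul_comm]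
  · have hd := degree_adjugate_pencil_lt
      (LinearMap.toMatrix (Module.finBasis ℝ T) (Module.finBasis ℝ T) A)
      (LinearMap.toMatrix (Module.finBasis ℝ T) (Module.finBasis ℝ T) B) i j
    rcases eq_or_ne (((LinearMap.toMatrix (Module.finBasis ℝ T) (Module.finBasis ℝ T) B).map C +
        (X : ℝ[X]) • (LinearMap.toMatrix (Module.finBasis ℝ T) (Module.finBasis ℝ T) A).map
            C).adjugate i j) 0 with h | h
    · rw [h, natDegree_zero]
      exact i.pos
    · exact (natDegree_lt_iff_degree_lt h).mpr hd

theorem cofPencilCoeff_zero (A B : Module.End ℝ T) : cofPencilCoeff A B 0 = cof B := by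
  apply (LinearMap.toMatrix (Module.finBasis ℝ T) (Module.finBasis ℝ T)).injective
  ext i j
  have := toMatrix_finBasis_cof_pencil A B 0 i j
  rw [zero_smul, add_zero] at this
  rw [this, toMatrix_finBasis_cofPencilCoeff, coeff_zero_eq_eval_zero]

theorem cofPencilCoeff_top (A B : Module.End ℝ T) :
    cofPencilCoeff A B (Module.finrank ℝ T - 1) = cof A := by
  apply (LinearMap.toMatrix (Module.finBasis ℝ T) (Module.finBasis ℝ T)).injective
  ext i j
  rw [toMatrix_finBasis_cofPencilCoeff, toMatrix_finBasis_cof]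
  generalize LinearMap.toMatrix (Module.finBasis ℝ T) (Module.finBasis ℝ T) A = P
  generalize LinearMap.toMatrix (Module.finBasis ℝ T) (Module.finBasis ℝ T) B = Q
  clear A B
  generalize Module.finrank ℝ T = N at *
  cases N with
  | zero => exact i.elim0
  | succ m => exact coeff_adjugate_pencil_top P Q i j

/-- The weights that express the coefficient of `X ^ k` of a polynomial of degree less than `N` as a
combination of its values at the nodes `ξ`. -/
def lagrangeCoeff {N : ℕ} (ξ : Fin N → ℝ) (k : ℕ) (a : Fin N) : ℝ :=
  (Lagrange.basis Finset.univ ξ a).coeff k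

/-- Every coefficient of `cof (B + ξ A)` is a combination, with universal weights, of the values at
any `N` distinct nodes. -/
theorem cofPencilCoeff_eq_sum_cof {N : ℕ} (hN : Module.finrank ℝ T = N) {ξ : Fin N → ℝ}
    (hξ : Function.Injective ξ) (A B : Module.End ℝ T) (k : ℕ) :
    cofPencilCoeff A B k = ∑ a, lagrangeCoeff ξ k a • cof (B + ξ a • A) := by
  apply (LinearMap.toMatrix (Module.finBasis ℝ T) (Module.finBasis ℝ T)).injective
  ext i j
  rw [toMatrix_finBasis_cofPencilCoeff, map_sum, Matrix.sum_apply]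
  simp_rw [map_smul, Matrix.smul_apply, toMatrix_finBasis_cof_pencil]
  have hd := degree_adjugate_pencil_lt
    (LinearMap.toMatrix (Module.finBasis ℝ T) (Module.finBasis ℝ T) A)
    (LinearMap.toMatrix (Module.finBasis ℝ T) (Module.finBasis ℝ T) B) i j
  generalize ((((LinearMap.toMatrix (Module.finBasis ℝ T) (Module.finBasis ℝ T)) B).map C +
    (X : ℝ[X]) • ((LinearMap.toMatrix (Module.finBasis ℝ T) (Module.finBasis ℝ T)) A).map
      C).adjugate i j) = P at hd ⊢
  have h := Lagrange.eq_interpolate (s := Finset.univ) (v := ξ) (f := P) hξ.injOn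
    (by rwa [Finset.card_univ, Fintype.card_fin, ← hN])
  conv_lhs => rw [h, Lagrange.interpolate_apply, finsetSum_coeff]
  refine Finset.sum_congr rfl fun a _ => ?_
  rw [coeff_C_mul, lagrangeCoeff, smul_eq_mul, mul_comm]

/-- If `A` is nonsingular, then there are arbitrarily many parameters at which `B + ξ A` is
nonsingular: the leading coefficient of `det (B + ξ A)` is `det A`. -/
theorem exists_injective_det_pencil_ne_zero {ι : Type*} [Fintype ι] [DecidableEq ι] (N : ℕ)
    (A B : Matrix ι ι ℝ) (hA : A.det ≠ 0) :
    ∃ ξ : Fin N → ℝ, Function.Injective ξ ∧ ∀ a, (B + ξ a • A).det ≠ 0 := by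
  set P : ℝ[X] := ((X : ℝ[X]) • A.map C + B.map C).det with hP
  have hP0 : P ≠ 0 := fun h => hA (by
    rw [← coeff_det_X_add_C_card A B, ← hP, h, coeff_zero])
  have hinf : (P.rootSet ℝ)ᶜ.Infinite := (P.rootSet_finite ℝ).infinite_compl
  have := hinf.to_subtype
  let f := Infinite.natEmbedding ((P.rootSet ℝ)ᶜ : Set ℝ)
  refine ⟨fun a => f a, fun a b h => Fin.ext (f.injective (Subtype.ext h)), fun a h0 => ?_⟩
  refine (f a).2 ?_
  rw [mem_rootSet]
  refine ⟨hP0, ?_⟩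
  have h1 := (evalRingHom (f a : ℝ)).map_det ((X : ℝ[X]) • A.map C + B.map C)
  have h2 : (evalRingHom (f a : ℝ)).mapMatrix ((X : ℝ[X]) • A.map C + B.map C) =
      B + (f a : ℝ) • A := by
    ext k l
    simp
    ring
  rw [h2, h0, ← hP] at h1
  simpa using h1

end CofactorPencil

/-! ### Calculus of matrix fields -/

section MatrixCalculus

open scoped Topology

variable {n : ℕ} {y : EuclideanSpace ℝ (Fin n)}

theorem partialDeriv_congr {f f' : EuclideanSpace ℝ (Fin n) → ℝ} (h : f =ᶠ[𝓝 y] f') (i : Fin n) :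
    partialDeriv i f y = partialDeriv i f' y := by
  rw [partialDeriv, partialDeriv, h.fderiv_eq]

theorem partialDeriv_add {f f' : EuclideanSpace ℝ (Fin n) → ℝ} (hf : DifferentiableAt ℝ f y)
    (hf' : DifferentiableAt ℝ f' y) (i : Fin n) :
    partialDeriv i (fun y => f y + f' y) y = partialDeriv i f y + partialDeriv i f' y := by
  simp only [partialDeriv]
  rw [fderiv_fun_add hf hf']
  rfl

theorem partialDeriv_const_mul {f : EuclideanSpace ℝ (Fin n) → ℝ} (hf : DifferentiableAt ℝ f y)
    (c : ℝ) (i : Fin n) : partialDeriv i (fun y => c * f y) y = c * partialDeriv i f y := by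
  simp only [partialDeriv]
  rw [fderiv_const_mul hf]
  rfl

theorem partialDeriv_mul {f f' : EuclideanSpace ℝ (Fin n) → ℝ} (hf : DifferentiableAt ℝ f y)
    (hf' : DifferentiableAt ℝ f' y) (i : Fin n) :
    partialDeriv i (fun y => f y * f' y) y =
      partialDeriv i f y * f' y + f y * partialDeriv i f' y := by
  simp only [partialDeriv]
  rw [fderiv_fun_mul hf hf']
  simp only [add_apply, smul_apply, smul_eq_mul]
  ring

theorem partialDeriv_sum {κ : Type*} {s : Finset κ} {f : κ → EuclideanSpace ℝ (Fin n) → ℝ}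
    (hf : ∀ k ∈ s, DifferentiableAt ℝ (f k) y) (i : Fin n) :
    partialDeriv i (fun y => ∑ k ∈ s, f k y) y = ∑ k ∈ s, partialDeriv i (f k) y := by
  simp only [partialDeriv]
  rw [fderiv_fun_sum hf, sum_apply]

theorem partialDeriv_const (c : ℝ) (i : Fin n) : partialDeriv i (fun _ => c) y = 0 := by
  simp [partialDeriv]

theorem partialDeriv_comm {f : EuclideanSpace ℝ (Fin n) → ℝ} (hf : ContDiffAt ℝ ∞ f y)
    (i j : Fin n) :
    partialDeriv i (fun y => partialDeriv j f y) y =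
      partialDeriv j (fun y => partialDeriv i f y) y := by
  have hd : DifferentiableAt ℝ (fderiv ℝ f) y :=
    (hf.fderiv_right (m := ∞) (by simp)).differentiableAt (by simp)
  have h : ∀ k l : Fin n, partialDeriv k (fun y => partialDeriv l f y) y =
      fderiv ℝ (fderiv ℝ f) y (EuclideanSpace.single k 1) (EuclideanSpace.single l 1) := by
    intro k l
    simp only [partialDeriv]
    rw [fderiv_clm_apply hd (by fun_prop)]
    simp
  rw [h, h]
  exact (hf.isSymmSndFDerivAt (by
    rw [minSmoothness_of_isRCLikeNormedField]
    exact WithTop.coe_le_coe.mpr le_top)) _ _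

theorem contDiffAt_partialDeriv {f : EuclideanSpace ℝ (Fin n) → ℝ} (hf : ContDiffAt ℝ ∞ f y)
    (i : Fin n) : ContDiffAt ℝ ∞ (fun y => partialDeriv i f y) y :=
  (hf.fderiv_right (m := ∞) (by simp)).clm_apply contDiffAt_const

variable {ι κ μ : Type*}

/-- The entries of the matrix field `F` are smooth at `y`. -/
def SmoothEntriesAt (F : EuclideanSpace ℝ (Fin n) → Matrix ι κ ℝ)
    (y : EuclideanSpace ℝ (Fin n)) : Prop :=
  ∀ i j, ContDiffAt ℝ ∞ (fun y => F y i j) y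

/-- The entrywise partial derivative of a matrix field. -/
def matrixPartial (h : Fin n) (F : EuclideanSpace ℝ (Fin n) → Matrix ι κ ℝ)
    (y : EuclideanSpace ℝ (Fin n)) : Matrix ι κ ℝ :=
  Matrix.of fun i j => partialDeriv h (fun y => F y i j) y

/-- The entrywise partial derivative of a vector field. -/
def vectorPartial (h : Fin n) (F : EuclideanSpace ℝ (Fin n) → ι → ℝ)
    (y : EuclideanSpace ℝ (Fin n)) : ι → ℝ :=
  fun i => partialDeriv h (fun y => F y i) y

theorem SmoothEntriesAt.differentiableAt {F : EuclideanSpace ℝ (Fin n) → Matrix ι κ ℝ}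
    (hF : SmoothEntriesAt F y) (i : ι) (j : κ) : DifferentiableAt ℝ (fun y => F y i j) y :=
  (hF i j).differentiableAt (by simp)

theorem SmoothEntriesAt.congr {F K : EuclideanSpace ℝ (Fin n) → Matrix ι κ ℝ}
    (hF : SmoothEntriesAt F y) (h : K =ᶠ[𝓝 y] F) : SmoothEntriesAt K y := fun i j =>
  (hF i j).congr_of_eventuallyEq (h.mono fun z hz => by simp only [hz])

theorem matrixPartial_congr {F K : EuclideanSpace ℝ (Fin n) → Matrix ι κ ℝ}
    (h : F =ᶠ[𝓝 y] K) (i : Fin n) : matrixPartial i F y = matrixPartial i K y := by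
  ext k l
  exact partialDeriv_congr (h.mono fun z hz => by simp only [hz]) i

theorem SmoothEntriesAt.add {F K : EuclideanSpace ℝ (Fin n) → Matrix ι κ ℝ}
    (hF : SmoothEntriesAt F y) (hK : SmoothEntriesAt K y) :
    SmoothEntriesAt (fun y => F y + K y) y := fun i j => (hF i j).add (hK i j)

theorem SmoothEntriesAt.const_smul {F : EuclideanSpace ℝ (Fin n) → Matrix ι κ ℝ}
    (hF : SmoothEntriesAt F y) (c : ℝ) :
    SmoothEntriesAt (fun y => c • F y) y := fun i j => contDiffAt_const.mul (hF i j)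

theorem SmoothEntriesAt.smul {F : EuclideanSpace ℝ (Fin n) → Matrix ι κ ℝ}
    {c : EuclideanSpace ℝ (Fin n) → ℝ}
    (hF : SmoothEntriesAt F y) (hc : ContDiffAt ℝ ∞ c y) :
    SmoothEntriesAt (fun y => c y • F y) y := fun i j => hc.mul (hF i j)

theorem SmoothEntriesAt.sum {α : Type*} {s : Finset α}
    {F : α → EuclideanSpace ℝ (Fin n) → Matrix ι κ ℝ}
    (hF : ∀ a ∈ s, SmoothEntriesAt (F a) y) :
    SmoothEntriesAt (fun y => ∑ a ∈ s, F a y) y := fun i j => by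
  simp only [Matrix.sum_apply]
  exact ContDiffAt.sum fun a ha => hF a ha i j

theorem matrixPartial_sum_smul {α : Type*} {s : Finset α}
    {F : α → EuclideanSpace ℝ (Fin n) → Matrix ι κ ℝ} (c : α → ℝ)
    (hF : ∀ a ∈ s, SmoothEntriesAt (F a) y) (h : Fin n) :
    matrixPartial h (fun y => ∑ a ∈ s, c a • F a y) y = ∑ a ∈ s, c a • matrixPartial h (F a) y := by
  ext i j
  simp only [matrixPartial, Matrix.of_apply, Matrix.sum_apply, Matrix.smul_apply, smul_eq_mul]
  rw [partialDeriv_sum fun a ha => ((hF a ha).differentiableAt i j).const_mul _]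
  exact Finset.sum_congr rfl fun a ha => partialDeriv_const_mul ((hF a ha).differentiableAt i j) _ h

theorem matrixPartial_add_smul {F K : EuclideanSpace ℝ (Fin n) → Matrix ι κ ℝ} (c : ℝ)
    (hF : SmoothEntriesAt F y) (hK : SmoothEntriesAt K y) (h : Fin n) :
    matrixPartial h (fun y => F y + c • K y) y = matrixPartial h F y + c • matrixPartial h K y := by
  ext i j
  simp only [matrixPartial, Matrix.of_apply, Matrix.add_apply, Matrix.smul_apply, smul_eq_mul]
  rw [partialDeriv_add (hF.differentiableAt i j) ((hK.differentiableAt i j).const_mul _),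
    partialDeriv_const_mul (hK.differentiableAt i j)]

section Products

variable [Fintype κ]

theorem SmoothEntriesAt.mul {F : EuclideanSpace ℝ (Fin n) → Matrix ι κ ℝ}
    {K : EuclideanSpace ℝ (Fin n) → Matrix κ μ ℝ}
    (hF : SmoothEntriesAt F y) (hK : SmoothEntriesAt K y) :
    SmoothEntriesAt (fun y => F y * K y) y := fun i j => by
  simp only [Matrix.mul_apply]
  exact ContDiffAt.sum fun k _ => (hF i k).mul (hK k j)

theorem SmoothEntriesAt.mulVec {F : EuclideanSpace ℝ (Fin n) → Matrix ι κ ℝ}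
    {X : EuclideanSpace ℝ (Fin n) → κ → ℝ}
    (hF : SmoothEntriesAt F y) (hX : ∀ k, ContDiffAt ℝ ∞ (fun y => X y k) y) (i : ι) :
    ContDiffAt ℝ ∞ (fun y => (F y *ᵥ X y) i) y := by
  simp only [Matrix.mulVec, dotProduct]
  exact ContDiffAt.sum fun k _ => (hF i k).mul (hX k)

theorem matrixPartial_mul {F : EuclideanSpace ℝ (Fin n) → Matrix ι κ ℝ}
    {K : EuclideanSpace ℝ (Fin n) → Matrix κ μ ℝ}
    (hF : SmoothEntriesAt F y) (hK : SmoothEntriesAt K y) (h : Fin n) :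
    matrixPartial h (fun y => F y * K y) y =
      matrixPartial h F y * K y + F y * matrixPartial h K y := by
  ext i j
  simp only [matrixPartial, Matrix.of_apply, Matrix.mul_apply, Matrix.add_apply]
  rw [partialDeriv_sum (f := fun k y => F y i k * K y k j)
      fun k _ => (hF.differentiableAt i k).mul (hK.differentiableAt k j),
    ← Finset.sum_add_distrib]
  exact Finset.sum_congr rfl fun k _ =>
    partialDeriv_mul (hF.differentiableAt i k) (hK.differentiableAt k j) h

theorem vectorPartial_mulVec {F : EuclideanSpace ℝ (Fin n) → Matrix ι κ ℝ}
    {X : EuclideanSpace ℝ (Fin n) → κ → ℝ}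
    (hF : SmoothEntriesAt F y) (hX : ∀ k, ContDiffAt ℝ ∞ (fun y => X y k) y) (h : Fin n) :
    vectorPartial h (fun y => F y *ᵥ X y) y =
      matrixPartial h F y *ᵥ X y + F y *ᵥ vectorPartial h X y := by
  ext i
  simp only [matrixPartial, vectorPartial, Matrix.of_apply, Matrix.mulVec, dotProduct,
    Pi.add_apply]
  have hX' : ∀ k, DifferentiableAt ℝ (fun y => X y k) y := fun k =>
    (hX k).differentiableAt (by simp)
  rw [partialDeriv_sum (f := fun k y => F y i k * X y k)
      fun k _ => (hF.differentiableAt i k).mul (hX' k), ← Finset.sum_add_distrib]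
  exact Finset.sum_congr rfl fun k _ => partialDeriv_mul (hF.differentiableAt i k) (hX' k) h

end Products

variable [Fintype ι] [DecidableEq ι]

theorem SmoothEntriesAt.det {F : EuclideanSpace ℝ (Fin n) → Matrix ι ι ℝ}
    (hF : SmoothEntriesAt F y) : ContDiffAt ℝ ∞ (fun y => (F y).det) y := by
  simp only [Matrix.det_apply]
  refine ContDiffAt.sum fun σ _ => ContDiffAt.const_smul _ ?_
  exact contDiffAt_prod fun i _ => hF _ _

theorem SmoothEntriesAt.adjugate {F : EuclideanSpace ℝ (Fin n) → Matrix ι ι ℝ}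
    (hF : SmoothEntriesAt F y) : SmoothEntriesAt (fun y => (F y).adjugate) y := fun i j => by
  simp only [Matrix.adjugate_apply]
  refine SmoothEntriesAt.det fun k l => ?_
  by_cases h : k = j
  · subst h
    simp only [Matrix.updateRow_self]
    exact contDiffAt_const
  · simp only [Matrix.updateRow_ne h]
    exact hF k l

theorem SmoothEntriesAt.inv {F : EuclideanSpace ℝ (Fin n) → Matrix ι ι ℝ}
    (hF : SmoothEntriesAt F y) (h0 : (F y).det ≠ 0) :
    SmoothEntriesAt (fun y => (F y)⁻¹) y := by
  simp only [Matrix.inv_def, Ring.inverse_eq_inv']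
  exact hF.adjugate.smul (hF.det.inv h0)

/-- Jacobi's formula for the derivative of a determinant. -/
theorem partialDeriv_det {F : EuclideanSpace ℝ (Fin n) → Matrix ι ι ℝ}
    (hF : SmoothEntriesAt F y) (h : Fin n) :
    partialDeriv h (fun y => (F y).det) y = ((F y).adjugate * matrixPartial h F y).trace := by
  let D : ContinuousMultilinearMap ℝ (fun _ : ι => ι → ℝ) ℝ :=
    { (Matrix.detRowAlternating : (ι → ℝ) [⋀^ι]→ₗ[ℝ] ℝ).toMultilinearMap with
      cont := Continuous.matrix_det continuous_id }
  have hD : ∀ A : Matrix ι ι ℝ, D A = A.det := fun A => rfl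
  let F' : EuclideanSpace ℝ (Fin n) → ι → ι → ℝ := fun y i j => F y i j
  have hF' : DifferentiableAt ℝ F' y :=
    differentiableAt_pi.mpr fun i => differentiableAt_pi.mpr fun j => hF.differentiableAt i j
  have hcomp : HasFDerivAt (fun y => D (F' y)) ((D.linearDeriv (F' y)).comp (fderiv ℝ F' y)) y :=
    (D.hasFDerivAt (F' y)).comp y hF'.hasFDerivAt
  have hentry : ∀ i j, fderiv ℝ F' y (EuclideanSpace.single h 1) i j = matrixPartial h F y i j := by
    intro i j
    have h1 : HasFDerivAt (fun y => F y i j)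
        (((ContinuousLinearMap.proj (R := ℝ) (φ := fun _ : ι => ℝ) j).comp
          (ContinuousLinearMap.proj (R := ℝ) (φ := fun _ : ι => ι → ℝ) i)).comp
            (fderiv ℝ F' y)) y :=
      ((ContinuousLinearMap.proj (R := ℝ) (φ := fun _ : ι => ℝ) j).comp
          (ContinuousLinearMap.proj (R := ℝ) (φ := fun _ : ι => ι → ℝ) i)).hasFDerivAt.comp y
        hF'.hasFDerivAt
    simp only [matrixPartial, Matrix.of_apply, partialDeriv]
    rw [h1.fderiv]
    rfl
  calc partialDeriv h (fun y => (F y).det) y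
      = D.linearDeriv (F' y) (fderiv ℝ F' y (EuclideanSpace.single h 1)) := by
        simp only [partialDeriv]
        have : (fun y => (F y).det) = fun y => D (F' y) := rfl
        rw [this, hcomp.fderiv]
        rfl
    _ = ∑ i, ((F y).updateRow i (matrixPartial h F y i)).det := by
        rw [ContinuousMultilinearMap.linearDeriv_apply]
        refine Finset.sum_congr rfl fun i _ => ?_
        have : fderiv ℝ F' y (EuclideanSpace.single h 1) i = matrixPartial h F y i :=
          funext fun j => hentry i j
        rw [this]
        rfl
    _ = ∑ i, ∑ j, (F y).adjugate j i * matrixPartial h F y i j := by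
        refine Finset.sum_congr rfl fun i _ => ?_
        rw [← Matrix.cramer_transpose_apply, Matrix.cramer_eq_adjugate_mulVec,
          ← Matrix.adjugate_transpose]
        rfl
    _ = _ := by
        rw [Matrix.trace, Finset.sum_comm]
        rfl

theorem matrixPartial_adjugate {F : EuclideanSpace ℝ (Fin n) → Matrix ι ι ℝ}
    (hF : SmoothEntriesAt F y) (h : Fin n) :
    matrixPartial h (fun y => (F y).adjugate) y * F y + (F y).adjugate * matrixPartial h F y =
      ((F y).adjugate * matrixPartial h F y).trace • (1 : Matrix ι ι ℝ) := by
  rw [← matrixPartial_mul hF.adjugate hF, ← partialDeriv_det hF]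
  simp only [Matrix.adjugate_mul]
  ext i j
  simp only [matrixPartial, Matrix.of_apply, Matrix.smul_apply, smul_eq_mul]
  simp_rw [mul_comm _ ((1 : Matrix ι ι ℝ) i j)]
  exact partialDeriv_const_mul (hF.det.differentiableAt (by simp)) _ h

theorem isCofactorJet_adjugate {F : EuclideanSpace ℝ (Fin n) → Matrix (Fin n) (Fin n) ℝ}
    (hF : SmoothEntriesAt F y) (h0 : (F y).det ≠ 0) :
    IsCofactorJet (F y) (fun h => matrixPartial h F y) (F y).det (F y).adjugate
      (fun h => matrixPartial h (fun y => (F y).adjugate) y) where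
  ne_zero := h0
  mul_left := Matrix.adjugate_mul _
  mul_right := Matrix.mul_adjugate _
  deriv h := matrixPartial_adjugate hF h

/-- The connection matrices of the Levi-Civita connection of `g`: the entry `(i, m)` of the `h`-th
one is `Γ^i_{hm}`. -/
def christoffelMatrix (g : EuclideanSpace ℝ (Fin n) → Matrix (Fin n) (Fin n) ℝ)
    (y : EuclideanSpace ℝ (Fin n)) (h : Fin n) : Matrix (Fin n) (Fin n) ℝ :=
  Matrix.of fun i m => (1 / 2) * ∑ l, (g y)⁻¹ i l *
    (matrixPartial h g y l m + matrixPartial m g y l h - matrixPartial l g y h m)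

theorem matrixPartial_symm {g : EuclideanSpace ℝ (Fin n) → Matrix (Fin n) (Fin n) ℝ}
    (hsymm : ∀ z, (g z)ᵀ = g z) (h i j : Fin n) :
    matrixPartial h g y i j = matrixPartial h g y j i := by
  simp only [matrixPartial, Matrix.of_apply]
  congr 1
  funext z
  exact congrFun (congrFun (hsymm z) j) i

theorem isMetricJet_christoffelMatrix {g : EuclideanSpace ℝ (Fin n) → Matrix (Fin n) (Fin n) ℝ}
    (hsymm : ∀ z, (g z)ᵀ = g z) (h0 : (g y).det ≠ 0) :
    IsMetricJet (g y) (g y)⁻¹ (christoffelMatrix g y) where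
  symm := hsymm y
  mul_eq_one := Matrix.mul_nonsing_inv _ (isUnit_iff_ne_zero.mpr h0)
  torsionFree i j k := by
    simp only [christoffelMatrix, Matrix.of_apply]
    congr 1
    refine Finset.sum_congr rfl fun l _ => ?_
    rw [matrixPartial_symm hsymm l i j]
    ring

theorem matrixPartial_metric {g : EuclideanSpace ℝ (Fin n) → Matrix (Fin n) (Fin n) ℝ}
    (hsymm : ∀ z, (g z)ᵀ = g z) (h0 : (g y).det ≠ 0) (h : Fin n) :
    matrixPartial h g y = (christoffelMatrix g y h)ᵀ * g y + g y * christoffelMatrix g y h := by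
  have hc : g y * christoffelMatrix g y h = Matrix.of fun i m => (1 / 2) *
      (matrixPartial h g y i m + matrixPartial m g y i h - matrixPartial i g y h m) := by
    have : christoffelMatrix g y h = (g y)⁻¹ * Matrix.of fun i m => (1 / 2) *
      (matrixPartial h g y i m + matrixPartial m g y i h - matrixPartial i g y h m) := by
      ext i m
      simp only [christoffelMatrix, Matrix.of_apply, Matrix.mul_apply, Finset.mul_sum]
      exact Finset.sum_congr rfl fun l _ => by ring
    rw [this, ← mul_assoc, Matrix.mul_nonsing_inv _ (isUnit_iff_ne_zero.mpr h0), one_mul]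
  have hct : (christoffelMatrix g y h)ᵀ * g y = (g y * christoffelMatrix g y h)ᵀ := by
    rw [Matrix.transpose_mul, hsymm]
  rw [hct, hc]
  ext i m
  simp only [Matrix.add_apply, Matrix.transpose_apply, Matrix.of_apply]
  rw [matrixPartial_symm hsymm h m i, matrixPartial_symm hsymm i h m,
    matrixPartial_symm hsymm m h i]
  ring

theorem matrixPartial_metric_inv {g : EuclideanSpace ℝ (Fin n) → Matrix (Fin n) (Fin n) ℝ}
    (hsymm : ∀ z, (g z)ᵀ = g z) (hg : SmoothEntriesAt g y) (h0 : (g y).det ≠ 0) (h : Fin n) :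
    matrixPartial h (fun y => (g y)⁻¹) y =
      -(christoffelMatrix g y h * (g y)⁻¹) - (g y)⁻¹ * (christoffelMatrix g y h)ᵀ := by
  have hu : IsUnit (g y).det := isUnit_iff_ne_zero.mpr h0
  have hev : (fun y => (g y)⁻¹ * g y) =ᶠ[𝓝 y] fun _ => 1 :=
    (hg.det.continuousAt.eventually_ne h0).mono fun z hz =>
      Matrix.nonsing_inv_mul _ (isUnit_iff_ne_zero.mpr hz)
  have h1 := matrixPartial_congr hev h
  rw [matrixPartial_mul (hg.inv h0) hg] at h1
  have h2 : matrixPartial h (fun _ => (1 : Matrix (Fin n) (Fin n) ℝ)) y = 0 := by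
    ext i j
    exact partialDeriv_const _ h
  rw [h2] at h1
  calc matrixPartial h (fun y => (g y)⁻¹) y
      = matrixPartial h (fun y => (g y)⁻¹) y * g y * (g y)⁻¹ := by
        rw [mul_assoc, Matrix.mul_nonsing_inv _ hu, mul_one]
    _ = -((g y)⁻¹ * matrixPartial h g y * (g y)⁻¹) := by
        rw [eq_neg_of_add_eq_zero_left h1, neg_mul]
    _ = _ := by
        rw [matrixPartial_metric hsymm h0, mul_add, add_mul, ← mul_assoc, ← mul_assoc,
          Matrix.nonsing_inv_mul _ hu, one_mul, mul_assoc ((g y)⁻¹ * _), 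
          Matrix.mul_nonsing_inv _ hu, mul_one]
        abel

end MatrixCalculus

/-! ### Pencils of `J`-tensors in coordinates -/

section LocalTheory

open scoped Topology

variable {n : ℕ} {y : EuclideanSpace ℝ (Fin n)}

/-- The covariant derivative `∇_h K` of a (1,1)-tensor field in coordinates. -/
def covariantPartial (g K : EuclideanSpace ℝ (Fin n) → Matrix (Fin n) (Fin n) ℝ)
    (y : EuclideanSpace ℝ (Fin n)) (h : Fin n) : Matrix (Fin n) (Fin n) ℝ :=
  matrixPartial h K y + christoffelMatrix g y h * K y - K y * christoffelMatrix g y h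

/-- `g` is a symmetric matrix field, smooth and nonsingular at `y`. -/
structure IsLocalMetric (g : EuclideanSpace ℝ (Fin n) → Matrix (Fin n) (Fin n) ℝ)
    (y : EuclideanSpace ℝ (Fin n)) : Prop where
  symm : ∀ z, (g z)ᵀ = g z
  smooth : SmoothEntriesAt g y
  det_ne_zero : (g y).det ≠ 0

/-- `J` is smooth at `y` and satisfies the `J`-tensor conditions for `g` there. -/
def IsLocalJTensor (g J : EuclideanSpace ℝ (Fin n) → Matrix (Fin n) (Fin n) ℝ)
    (y : EuclideanSpace ℝ (Fin n)) : Prop :=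
  SmoothEntriesAt J y ∧
    ∃ lam, IsJTensorJet (g y) (g y)⁻¹ (J y) (covariantPartial g J y) lam

variable {g J₁ J₂ : EuclideanSpace ℝ (Fin n) → Matrix (Fin n) (Fin n) ℝ}

theorem IsLocalMetric.jet (hg : IsLocalMetric g y) :
    IsMetricJet (g y) (g y)⁻¹ (christoffelMatrix g y) :=
  isMetricJet_christoffelMatrix hg.symm hg.det_ne_zero

theorem isJTensorJet_pencil {lam₁ lam₂ : Fin n → ℝ}
    (hs₁ : SmoothEntriesAt J₁ y) (hs₂ : SmoothEntriesAt J₂ y)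
    (h₁ : IsJTensorJet (g y) (g y)⁻¹ (J₁ y) (covariantPartial g J₁ y) lam₁)
    (h₂ : IsJTensorJet (g y) (g y)⁻¹ (J₂ y) (covariantPartial g J₂ y) lam₂) (ξ : ℝ) :
    IsJTensorJet (g y) (g y)⁻¹ (J₂ y + ξ • J₁ y)
      (covariantPartial g (fun y => J₂ y + ξ • J₁ y) y) (lam₂ + ξ • lam₁) := by
  have := h₂.add_smul (Γ := christoffelMatrix g y) h₁ ξ
  have e : (fun h => matrixPartial h (fun y => J₂ y + ξ • J₁ y) y) =
      (fun h => matrixPartial h J₂ y) + ξ • fun h => matrixPartial h J₁ y :=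
    funext fun h => matrixPartial_add_smul ξ hs₂ hs₁ h
  rw [← e] at this
  exact this

theorem isCofactorJet_covariant {F : EuclideanSpace ℝ (Fin n) → Matrix (Fin n) (Fin n) ℝ}
    (hF : SmoothEntriesAt F y) (h0 : (F y).det ≠ 0) :
    IsCofactorJet (F y) (covariantPartial g F y) (F y).det (F y).adjugate
      (covariantPartial g (fun y => (F y).adjugate) y) :=
  (isCofactorJet_adjugate hF h0).covariant (christoffelMatrix g y)

/-- The combination of cofactors `∑ c_a cof (J₂ + ξ_a J₁)`. With Lagrange weights `c` it is one of
the tensors `K_r`. -/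
def cofCombination (J₁ J₂ : EuclideanSpace ℝ (Fin n) → Matrix (Fin n) (Fin n) ℝ)
    (c ξ : Fin n → ℝ) (y : EuclideanSpace ℝ (Fin n)) : Matrix (Fin n) (Fin n) ℝ :=
  ∑ a, c a • (J₂ y + ξ a • J₁ y).adjugate

theorem smoothEntriesAt_cof_pencil (h₁ : SmoothEntriesAt J₁ y) (h₂ : SmoothEntriesAt J₂ y)
    (ξ : ℝ) : SmoothEntriesAt (fun y => (J₂ y + ξ • J₁ y).adjugate) y :=
  (h₂.add (h₁.const_smul ξ)).adjugate

theorem smoothEntriesAt_cofCombination (h₁ : SmoothEntriesAt J₁ y) (h₂ : SmoothEntriesAt J₂ y)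
    (c ξ : Fin n → ℝ) : SmoothEntriesAt (cofCombination J₁ J₂ c ξ) y :=
  SmoothEntriesAt.sum fun a _ => (smoothEntriesAt_cof_pencil h₁ h₂ (ξ a)).const_smul (c a)

theorem matrixPartial_cofCombination (h₁ : SmoothEntriesAt J₁ y) (h₂ : SmoothEntriesAt J₂ y)
    (c ξ : Fin n → ℝ) (h : Fin n) :
    matrixPartial h (cofCombination J₁ J₂ c ξ) y =
      ∑ a, c a • matrixPartial h (fun y => (J₂ y + ξ a • J₁ y).adjugate) y :=
  matrixPartial_sum_smul c (fun a _ => smoothEntriesAt_cof_pencil h₁ h₂ (ξ a)) h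

theorem covariantPartial_cofCombination (h₁ : SmoothEntriesAt J₁ y) (h₂ : SmoothEntriesAt J₂ y)
    (c ξ : Fin n → ℝ) (h : Fin n) :
    covariantPartial g (cofCombination J₁ J₂ c ξ) y h =
      ∑ a, c a • covariantPartial g (fun y => (J₂ y + ξ a • J₁ y).adjugate) y h := by
  rw [covariantPartial, matrixPartial_cofCombination h₁ h₂, cofCombination, Finset.mul_sum,
    Finset.sum_mul, ← Finset.sum_add_distrib, ← Finset.sum_sub_distrib]
  refine Finset.sum_congr rfl fun a _ => ?_
  rw [covariantPartial, mul_smul_comm, smul_mul_assoc, smul_sub, smul_add]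

section Combination

variable {c c' ξ : Fin n → ℝ} (hg : IsLocalMetric g y) (h₁ : IsLocalJTensor g J₁ y)
  (h₂ : IsLocalJTensor g J₂ y) (hξ : ∀ a, (J₂ y + ξ a • J₁ y).det ≠ 0)

include h₁ h₂ hξ in
theorem cofCombination_symm :
    (cofCombination J₁ J₂ c ξ y)ᵀ * g y = g y * cofCombination J₁ J₂ c ξ y := by
  obtain ⟨s₁, lam₁, j₁⟩ := h₁
  obtain ⟨s₂, lam₂, j₂⟩ := h₂
  rw [cofCombination, Matrix.transpose_sum, Finset.sum_mul, Finset.mul_sum]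
  refine Finset.sum_congr rfl fun a _ => ?_
  rw [Matrix.transpose_smul, smul_mul_assoc, mul_smul_comm,
    (isCofactorJet_covariant (g := g) (s₂.add (s₁.const_smul (ξ a))) (hξ a)).lowered_symm
      (isJTensorJet_pencil s₁ s₂ j₁ j₂ (ξ a)).symm]

include hg h₁ h₂ hξ in
theorem cofCombination_killing (h i j : Fin n) :
    (g y * covariantPartial g (cofCombination J₁ J₂ c ξ) y h) i j +
      (g y * covariantPartial g (cofCombination J₁ J₂ c ξ) y i) j h +
      (g y * covariantPartial g (cofCombination J₁ J₂ c ξ) y j) h i = 0 := by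
  obtain ⟨s₁, lam₁, j₁⟩ := h₁
  obtain ⟨s₂, lam₂, j₂⟩ := h₂
  simp only [covariantPartial_cofCombination s₁ s₂, Finset.mul_sum, Matrix.sum_apply,
    mul_smul_comm, Matrix.smul_apply, ← Finset.sum_add_distrib, ← smul_add]
  refine Finset.sum_eq_zero fun a _ => ?_
  rw [killing_cofactor hg.jet (isJTensorJet_pencil s₁ s₂ j₁ j₂ (ξ a))
    (isCofactorJet_covariant (s₂.add (s₁.const_smul (ξ a))) (hξ a)), smul_zero]

include hg in
theorem vectorPartial_lowered {K : EuclideanSpace ℝ (Fin n) → Matrix (Fin n) (Fin n) ℝ}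
    {X : EuclideanSpace ℝ (Fin n) → Fin n → ℝ}
    (hK : SmoothEntriesAt K y) (hX : ∀ k, ContDiffAt ℝ ∞ (fun y => X y k) y) (h : Fin n) :
    vectorPartial h (fun y => g y *ᵥ (K y *ᵥ X y)) y =
      (matrixPartial h g y * K y + g y * matrixPartial h K y) *ᵥ X y +
        (g y * K y) *ᵥ vectorPartial h X y := by
  simp_rw [Matrix.mulVec_mulVec]
  rw [vectorPartial_mulVec (hg.smooth.mul hK) hX, matrixPartial_mul hg.smooth hK]

/-- The 1-form with components `b` is closed at `y`, in the sense that its partial derivatives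
there are symmetric. -/
def IsClosedAt (b : EuclideanSpace ℝ (Fin n) → Fin n → ℝ) (y : EuclideanSpace ℝ (Fin n)) : Prop :=
  ∀ h j, vectorPartial h b y j = vectorPartial j b y h

include hg in
theorem isClosedAt_cofactor_iff {F : EuclideanSpace ℝ (Fin n) → Matrix (Fin n) (Fin n) ℝ}
    {X : EuclideanSpace ℝ (Fin n) → Fin n → ℝ} {lam : Fin n → ℝ}
    (hF : SmoothEntriesAt F y) (h0 : (F y).det ≠ 0)
    (hX : ∀ k, ContDiffAt ℝ ∞ (fun y => X y k) y)
    (hJ : IsJTensorJet (g y) (g y)⁻¹ (F y) (covariantPartial g F y) lam) :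
    IsClosedAt (fun y => g y *ᵥ ((F y).adjugate *ᵥ X y)) y ↔
      curlObstruction (g y) (F y) lam (X y)
        (Matrix.of fun k h => (vectorPartial h X y + christoffelMatrix g y h *ᵥ X y) k) = 0 := by
  rw [← curl_cofactor_eq_zero_iff (dg := fun h => matrixPartial h g y)
    (dL := fun h => matrixPartial h F y) (dA := fun h => matrixPartial h (fun y => (F y).adjugate) y)
    hg.jet (matrixPartial_metric hg.symm hg.det_ne_zero) hJ
    (isCofactorJet_covariant hF h0) (X y) (fun h => vectorPartial h X y)]
  simp only [IsClosedAt, vectorPartial_lowered hg hF.adjugate hX]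

include hg h₁ h₂ hξ in
/-- If `g (cof J₁) X` and `g (cof J₂) X` are closed, then so are all `g K X` for combinations `K` of
cofactors of the pencil, as the obstruction to closedness is linear in the `J`-tensor. -/
theorem isClosedAt_cofCombination {X : EuclideanSpace ℝ (Fin n) → Fin n → ℝ}
    (hX : ∀ k, ContDiffAt ℝ ∞ (fun y => X y k) y)
    (d₁ : (J₁ y).det ≠ 0) (d₂ : (J₂ y).det ≠ 0)
    (hc₁ : IsClosedAt (fun y => g y *ᵥ ((J₁ y).adjugate *ᵥ X y)) y)
    (hc₂ : IsClosedAt (fun y => g y *ᵥ ((J₂ y).adjugate *ᵥ X y)) y) :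
    IsClosedAt (fun y => g y *ᵥ (cofCombination J₁ J₂ c ξ y *ᵥ X y)) y := by
  obtain ⟨s₁, lam₁, j₁⟩ := h₁
  obtain ⟨s₂, lam₂, j₂⟩ := h₂
  have hs : ∀ a, SmoothEntriesAt (fun y => J₂ y + ξ a • J₁ y) y :=
    fun a => s₂.add (s₁.const_smul (ξ a))
  have hpencil : ∀ a, IsClosedAt (fun y => g y *ᵥ ((J₂ y + ξ a • J₁ y).adjugate *ᵥ X y)) y :=
    fun a => by
    rw [isClosedAt_cofactor_iff hg s₁ d₁ hX j₁] at hc₁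
    rw [isClosedAt_cofactor_iff hg s₂ d₂ hX j₂] at hc₂
    refine (isClosedAt_cofactor_iff hg (hs a) (hξ a) hX
      (isJTensorJet_pencil s₁ s₂ j₁ j₂ (ξ a))).mpr ?_
    rw [curlObstruction_add_smul, hc₁, hc₂, smul_zero, add_zero]
  have hsum : ∀ h, vectorPartial h (fun y => g y *ᵥ (cofCombination J₁ J₂ c ξ y *ᵥ X y)) y =
      ∑ a, c a • vectorPartial h (fun y => g y *ᵥ ((J₂ y + ξ a • J₁ y).adjugate *ᵥ X y)) y := by
    intro h
    rw [vectorPartial_lowered hg (smoothEntriesAt_cofCombination s₁ s₂ c ξ) hX,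
      matrixPartial_cofCombination s₁ s₂]
    simp_rw [vectorPartial_lowered hg (hs _).adjugate hX, cofCombination]
    simp only [Finset.mul_sum, ← Finset.sum_add_distrib, Matrix.sum_mulVec, mul_smul_comm,
      Matrix.smul_mulVec, smul_add, Matrix.add_mulVec]
  intro h j
  rw [hsum, hsum, Finset.sum_apply, Finset.sum_apply]
  refine Finset.sum_congr rfl fun a _ => ?_
  rw [Pi.smul_apply, Pi.smul_apply, hpencil a h j]

/-- The differential at the point with coordinates `(y, p)` of `½ pᵀ K g⁻¹ p + V`, where
`dV = g K X` at `y`. -/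
def kineticCovector (g K : EuclideanSpace ℝ (Fin n) → Matrix (Fin n) (Fin n) ℝ) (X p : Fin n → ℝ)
    (y : EuclideanSpace ℝ (Fin n)) : Fin n ⊕ Fin n → ℝ :=
  phaseCovector (g y) (g y)⁻¹ (fun h => matrixPartial h (fun y => (g y)⁻¹) y) X p (K y)
    (fun h => matrixPartial h K y)

omit c c' ξ in
theorem kineticCovector_cofCombination (s₁ : SmoothEntriesAt J₁ y) (s₂ : SmoothEntriesAt J₂ y)
    (c ξ : Fin n → ℝ) (X p : Fin n → ℝ) :
    kineticCovector g (cofCombination J₁ J₂ c ξ) X p y =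
      ∑ a, c a • kineticCovector g (fun y => (J₂ y + ξ a • J₁ y).adjugate) X p y := by
  ext (i | i)
  · simp only [kineticCovector, phaseCovector, Sum.elim_inl, Finset.sum_apply, Pi.smul_apply,
      smul_eq_mul]
    rw [matrixPartial_cofCombination s₁ s₂, cofCombination]
    simp only [Finset.sum_mul, smul_mul_assoc, ← Finset.sum_add_distrib, ← smul_add,
      Matrix.sum_mulVec, Matrix.mulVec_sum, Matrix.smul_mulVec, Matrix.mulVec_smul,
      dotProduct_sum, dotProduct_smul, Finset.mul_sum, Finset.sum_apply, Pi.smul_apply,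
      smul_eq_mul]
    exact Finset.sum_congr rfl fun a _ => by ring
  · simp only [kineticCovector, phaseCovector, Sum.elim_inr, Finset.sum_apply, Pi.smul_apply,
      cofCombination, Matrix.sum_mulVec, Matrix.smul_mulVec]

include hg h₁ h₂ hξ in
theorem phaseBracket_cofCombination (hinj : Function.Injective ξ) (X p : Fin n → ℝ) :
    phaseBracket p (J₁ y) (fun h => matrixPartial h J₁ y)
        (kineticCovector g (cofCombination J₁ J₂ c ξ) X p y)
        (kineticCovector g (cofCombination J₁ J₂ c' ξ) X p y) = 0 ∧
      phaseBracket p (J₂ y) (fun h => matrixPartial h J₂ y)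
        (kineticCovector g (cofCombination J₁ J₂ c ξ) X p y)
        (kineticCovector g (cofCombination J₁ J₂ c' ξ) X p y) = 0 := by
  obtain ⟨s₁, lam₁, j₁⟩ := h₁
  obtain ⟨s₂, lam₂, j₂⟩ := h₂
  have hexp : ∀ (L : Matrix (Fin n) (Fin n) ℝ) (dL : Fin n → Matrix (Fin n) (Fin n) ℝ),
      phaseBracket p L dL (kineticCovector g (cofCombination J₁ J₂ c ξ) X p y)
        (kineticCovector g (cofCombination J₁ J₂ c' ξ) X p y) =
      ∑ a, ∑ b, c a * (c' b * phaseBracket p L dL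
        (kineticCovector g (fun y => (J₂ y + ξ a • J₁ y).adjugate) X p y)
        (kineticCovector g (fun y => (J₂ y + ξ b • J₁ y).adjugate) X p y)) := fun L dL => by
    simp only [kineticCovector_cofCombination s₁ s₂, phaseBracket, Matrix.mulVec_sum,
      sum_dotProduct, dotProduct_sum, Matrix.mulVec_smul, smul_dotProduct, dotProduct_smul,
      smul_eq_mul, Finset.mul_sum]
    rw [Finset.sum_comm]
    exact Finset.sum_congr rfl fun a _ => Finset.sum_congr rfl fun b _ => by ring
  have hpair : ∀ a b, phaseBracket p (J₁ y) (fun h => matrixPartial h J₁ y)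
        (kineticCovector g (fun y => (J₂ y + ξ a • J₁ y).adjugate) X p y)
        (kineticCovector g (fun y => (J₂ y + ξ b • J₁ y).adjugate) X p y) = 0 ∧
      phaseBracket p (J₂ y) (fun h => matrixPartial h J₂ y)
        (kineticCovector g (fun y => (J₂ y + ξ a • J₁ y).adjugate) X p y)
        (kineticCovector g (fun y => (J₂ y + ξ b • J₁ y).adjugate) X p y) = 0 := by
    intro a b
    rcases eq_or_ne a b with rfl | hab
    · exact ⟨self_eq_neg.mp (phaseBracket_swap _ _ _ _ _),
        self_eq_neg.mp (phaseBracket_swap _ _ _ _ _)⟩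
    · have hJ : ∀ a, _ := fun a => isJTensorJet_pencil s₁ s₂ j₁ j₂ (ξ a)
      have hC : ∀ a, _ := fun a =>
        isCofactorJet_covariant (g := g) (s₂.add (s₁.const_smul (ξ a))) (hξ a)
      unfold covariantPartial at hJ hC
      have hd : ∀ a h, matrixPartial h (fun y => J₂ y + ξ a • J₁ y) y =
        ((fun h => matrixPartial h J₂ y) + ξ a • fun h => matrixPartial h J₁ y) h :=
        fun a h => matrixPartial_add_smul (ξ a) s₂ s₁ h
      simp only [hd] at hJ hC
      exact phaseBracket_cofactor_pencil X p hg.jet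
        (matrixPartial_metric_inv hg.symm hg.smooth hg.det_ne_zero) (hJ a) (hC a) (hJ b) (hC b)
        (hinj.ne hab)
  constructor
  · rw [hexp]
    exact Finset.sum_eq_zero fun a _ => Finset.sum_eq_zero fun b _ => by
      rw [(hpair a b).1, mul_zero, mul_zero]
  · rw [hexp]
    exact Finset.sum_eq_zero fun a _ => Finset.sum_eq_zero fun b _ => by
      rw [(hpair a b).2, mul_zero, mul_zero]

include hg in
theorem phaseMatrix_mulVec_kineticCovector
    {F : EuclideanSpace ℝ (Fin n) → Matrix (Fin n) (Fin n) ℝ} (hF : IsLocalJTensor g F y)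
    (h0 : (F y).det ≠ 0) (X p : Fin n → ℝ) :
    phaseMatrix p (F y) (fun h => matrixPartial h F y) *ᵥ
        kineticCovector g (fun y => (F y).adjugate) X p y =
      (F y).det • newtonField (g y) (g y)⁻¹ (christoffelMatrix g y) X p := by
  obtain ⟨s, lam, j⟩ := hF
  exact phaseMatrix_mulVec_phaseCovector X p hg.jet
    (matrixPartial_metric_inv hg.symm hg.smooth hg.det_ne_zero) j (isCofactorJet_covariant s h0)

end Combination

end LocalTheory

/-! ### Coordinate frames of a chart -/

section Charts

open scoped Topology

variable {n : ℕ} {M : Type*} [TopologicalSpace M] [ChartedSpace (EuclideanSpace ℝ (Fin n)) M]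
  {e : Coords n M} {x : M} {y : EuclideanSpace ℝ (Fin n)}

theorem mdifferentiable_of_mem_charts (he : e ∈ charts n M) :
    e.MDifferentiable (𝓡 n) (𝓡 n) :=
  ⟨(contMDiffOn_of_mem_maximalAtlas he).mdifferentiableOn (by simp),
    (contMDiffOn_symm_of_mem_maximalAtlas he).mdifferentiableOn (by simp)⟩

/-- The differential of a chart, as an isomorphism of the tangent space with the model space. -/
def chartDifferential (he : e ∈ charts n M) (hx : x ∈ e.source) :
    TangentSpace (𝓡 n) x ≃L[ℝ] EuclideanSpace ℝ (Fin n) :=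
  ((mdifferentiable_of_mem_charts he).mfderiv hx).trans
    (NormedSpace.fromTangentSpace (e x))

theorem coe_chartDifferential (he : e ∈ charts n M) (hx : x ∈ e.source) :
    (chartDifferential he hx : TangentSpace (𝓡 n) x →L[ℝ] EuclideanSpace ℝ (Fin n)) =
      mvfderiv (𝓡 n) e x := rfl

/-- The coordinate vectors `∂/∂q^i`, as a basis of the tangent space. -/
def coordFrame (he : e ∈ charts n M) (hx : x ∈ e.source) :
    Module.Basis (Fin n) ℝ (TangentSpace (𝓡 n) x) :=
  (EuclideanSpace.basisFun (Fin n) ℝ).toBasis.map (chartDifferential he hx).symm.toLinearEquiv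

theorem coordFrame_apply (he : e ∈ charts n M) (hx : x ∈ e.source) (i : Fin n) :
    coordFrame he hx i = coordVec e x i := by
  rw [coordVec, ← coe_chartDifferential he hx, ContinuousLinearMap.inverse_equiv]
  simp [coordFrame]

theorem coordFrame_repr (he : e ∈ charts n M) (hx : x ∈ e.source) (v : TangentSpace (𝓡 n) x)
    (i : Fin n) : (coordFrame he hx).repr v i = coordForm e x i v := by
  rw [coordForm, ← coe_chartDifferential he hx]
  simp [coordFrame]

theorem coordForm_coordVec (he : e ∈ charts n M) (hx : x ∈ e.source) (i j : Fin n) :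
    coordForm e x i (coordVec e x j) = if i = j then 1 else 0 := by
  rw [← coordFrame_repr he hx, ← coordFrame_apply he hx, Module.Basis.repr_self,
    Finsupp.single_apply]
  simp only [eq_comm]

theorem components_eq_toMatrix (he : e ∈ charts n M) (hy : y ∈ e.target) (A : EndField n M) :
    components e A y = LinearMap.toMatrix (coordFrame he (e.map_target hy))
      (coordFrame he (e.map_target hy)) (A (e.symm y)) := by
  ext i j
  rw [LinearMap.toMatrix_apply, coordFrame_repr, coordFrame_apply]
  rfl

theorem components_mulVec (he : e ∈ charts n M) (hy : y ∈ e.target) (A : EndField n M)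
    (v : TangentSpace (𝓡 n) (e.symm y)) (i : Fin n) :
    coordForm e (e.symm y) i (A (e.symm y) v) =
      (components e A y *ᵥ fun j => coordForm e (e.symm y) j v) i := by
  rw [components_eq_toMatrix he hy]
  simp_rw [← coordFrame_repr he (e.map_target hy)]
  exact congrFun (LinearMap.toMatrix_mulVec_repr _ _ _ _).symm i

theorem det_components (he : e ∈ charts n M) (hy : y ∈ e.target) (A : EndField n M) :
    (components e A y).det = LinearMap.det (A (e.symm y)) := by
  rw [components_eq_toMatrix he hy, LinearMap.det_toMatrix]

theorem components_cof (he : e ∈ charts n M) (hy : y ∈ e.target) (A : EndField n M) :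
    components e (fun x => cof (A x)) y = (components e A y).adjugate := by
  rw [components_eq_toMatrix he hy, components_eq_toMatrix he hy, toMatrix_cof]

theorem finrank_tangentSpace (x : M) : Module.finrank ℝ (TangentSpace (𝓡 n) x) = n :=
  finrank_euclideanSpace_fin (𝕜 := ℝ) (n := n)

theorem components_kTensor (he : e ∈ charts n M) (hy : y ∈ e.target) (J₁ J₂ : EndField n M)
    (r : ℕ) {ξ : Fin n → ℝ} (hξ : Function.Injective ξ) :
    components e (kTensor J₁ J₂ r) y =
      cofCombination (components e J₁) (components e J₂) (lagrangeCoeff ξ (n - r)) ξ y := by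
  rw [components_eq_toMatrix he hy, cofCombination, components_eq_toMatrix he hy J₁,
    components_eq_toMatrix he hy J₂, kTensor,
    cofPencilCoeff_eq_sum_cof (finrank_tangentSpace _) hξ, map_sum]
  refine Finset.sum_congr rfl fun a _ => ?_
  rw [map_smul, toMatrix_cof, map_add, map_smul]

omit [ChartedSpace (EuclideanSpace ℝ (Fin n)) M] in
theorem eventually_mem_target (hy : y ∈ e.target) : ∀ᶠ z in 𝓝 y, z ∈ e.target :=
  e.open_target.mem_nhds hy

theorem smoothEntriesAt_components {A : EndField n M} (hA : IsSmoothField A) (he : e ∈ charts n M)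
    (hy : y ∈ e.target) : SmoothEntriesAt (components e A) y := fun i j =>
  (hA e he i j).contDiffAt (e.open_target.mem_nhds hy)

theorem isSmoothField_kTensor {J₁ J₂ : EndField n M} (h₁ : IsSmoothField J₁)
    (h₂ : IsSmoothField J₂) (r : ℕ) : IsSmoothField (kTensor J₁ J₂ r) := by
  intro e he i j y hy
  -- the components of `K_r` are a fixed combination of smooth cofactors, here at the nodes `0, …, n - 1`
  have hinj : Function.Injective (fun a : Fin n => (a : ℝ)) := fun a b h => by
    simpa [Fin.ext_iff] using h
  have := smoothEntriesAt_cofCombination (smoothEntriesAt_components h₁ he hy)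
    (smoothEntriesAt_components h₂ he hy) (lagrangeCoeff (fun a : Fin n => (a : ℝ)) (n - r))
    (fun a : Fin n => (a : ℝ))
  refine ((this.congr ?_) i j).contDiffWithinAt
  exact (eventually_mem_target hy).mono fun z hz => components_kTensor he hz J₁ J₂ r hinj

/-! ### The metric and `J`-tensors in coordinates -/

variable (g : PseudoMetric n M)

theorem isLocalMetric_lower (he : e ∈ charts n M) (hy : y ∈ e.target) :
    IsLocalMetric (g.lower e) y where
  symm z := by
    ext i j
    exact g.symm _ _ _
  smooth i j := (g.smooth e he i j).contDiffAt (e.open_target.mem_nhds hy)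
  det_ne_zero := by
    have h := (LinearMap.BilinForm.nondegenerate_iff_det_ne_zero
      (coordFrame he (e.map_target hy))).mp (g.nondegenerate (e.symm y))
    convert h using 2
    ext i j
    rw [LinearMap.BilinForm.toMatrix_apply, coordFrame_apply, coordFrame_apply]
    rfl

theorem christoffel_eq (e : Coords n M) (y : EuclideanSpace ℝ (Fin n)) (i j k : Fin n) :
    g.christoffel e y i j k = christoffelMatrix (g.lower e) y j i k := rfl

theorem covDeriv_eq (e : Coords n M) (A : EndField n M) (y : EuclideanSpace ℝ (Fin n))
    (h i j : Fin n) :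
    g.covDeriv e A y h i j = covariantPartial (g.lower e) (components e A) y h i j := by
  simp only [PseudoMetric.covDeriv, covariantPartial, Matrix.sub_apply, Matrix.add_apply,
    Matrix.mul_apply, christoffel_eq, mul_comm (christoffelMatrix _ _ _ _ j)]
  rfl

theorem isLocalJTensor_components {J : EndField n M} (hJ : g.IsJTensor J) (he : e ∈ charts n M)
    (hy : y ∈ e.target) : IsLocalJTensor (g.lower e) (components e J) y := by
  obtain ⟨hs, hsymm, α, hα⟩ := hJ
  refine ⟨smoothEntriesAt_components hs he hy, formComponents e α y, ?_, fun h => ?_⟩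
  · exact (isLocalMetric_lower g he hy).jet.lowered_symm (hsymm e he y hy)
  · ext i j
    rw [← covDeriv_eq, hα e he y hy h i j, Matrix.add_apply, Matrix.vecMulVec_apply,
      Matrix.vecMulVec_apply, Pi.single_apply, mul_comm]
    rfl

theorem covDerivLowered_eq {A : EndField n M} (hA : IsSmoothField A) (he : e ∈ charts n M)
    (hy : y ∈ e.target) (h i j : Fin n) :
    g.covDerivLowered e A y h i j =
      (g.lower e y * covariantPartial (g.lower e) (components e A) y h) i j := by
  have hg := isLocalMetric_lower g he hy
  have h1 : matrixPartial h (g.lowered e A) y = _ :=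
    matrixPartial_mul hg.smooth (smoothEntriesAt_components hA he hy) h
  have h2 : g.covDerivLowered e A y h i j = (matrixPartial h (g.lowered e A) y -
      (christoffelMatrix (g.lower e) y h)ᵀ * g.lowered e A y -
      g.lowered e A y * christoffelMatrix (g.lower e) y h) i j := by
    simp only [PseudoMetric.covDerivLowered, Matrix.sub_apply, Matrix.mul_apply, christoffel_eq,
      Matrix.transpose_apply, mul_comm (christoffelMatrix _ _ _ _ j)]
    rfl
  rw [h2, h1, matrixPartial_metric hg.symm hg.det_ne_zero, PseudoMetric.lowered, covariantPartial]
  noncomm_ring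

theorem coordForm_sharp (he : e ∈ charts n M) (hy : y ∈ e.target) (α : Cotangent n (e.symm y))
    (i : Fin n) : coordForm e (e.symm y) i (g.sharp (e.symm y) α) =
      ((g.lower e y)⁻¹ *ᵥ fun j => α (coordVec e (e.symm y) j)) i := by
  have hg := isLocalMetric_lower g he hy
  set v := g.sharp (e.symm y) α with hv
  have h1 : ∀ w, g.form (e.symm y) v w = α w := fun w =>
    LinearMap.BilinForm.apply_toDual_symm_apply (hB := g.nondegenerate (e.symm y))
      (α : TangentSpace (𝓡 n) (e.symm y) →ₗ[ℝ] ℝ) w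
  have h2 : (fun j => α (coordVec e (e.symm y) j)) =
      g.lower e y *ᵥ fun j => coordForm e (e.symm y) j v := by
    ext j
    rw [← h1, g.symm]
    conv_lhs => rw [← (coordFrame he (e.map_target hy)).sum_repr v]
    rw [map_sum]
    refine Finset.sum_congr rfl fun k _ => ?_
    rw [map_smul, coordFrame_repr, coordFrame_apply, smul_eq_mul, mul_comm]
    rfl
  rw [h2, Matrix.mulVec_mulVec, Matrix.nonsing_inv_mul _ (isUnit_iff_ne_zero.mpr hg.det_ne_zero),
    Matrix.one_mulVec]

/-! ### Differentials of functions in coordinates -/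

theorem contDiffAt_comp_symm {f : M → ℝ} {U : Set M} (hU : IsOpen U)
    (hf : ContMDiffOn (𝓡 n) 𝓘(ℝ) ∞ f U)
    (he : e ∈ charts n M) (hy : y ∈ e.target) (hyU : e.symm y ∈ U) :
    ContDiffAt ℝ ∞ (fun z => f (e.symm z)) y := by
  rw [← contMDiffAt_iff_contDiffAt]
  exact ((hf _ hyU).contMDiffAt (hU.mem_nhds hyU)).comp y
    (contMDiffAt_symm_of_mem_maximalAtlas he hy)

theorem mvfderiv_eq_fderiv_comp {f : M → ℝ} {u : EuclideanSpace ℝ (Fin n) → ℝ}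
    {L : EuclideanSpace ℝ (Fin n) →L[ℝ] ℝ} (he : e ∈ charts n M) (hx : x ∈ e.source)
    (hu : HasFDerivAt u L (e x)) (hfu : f =ᶠ[𝓝 x] u ∘ e) :
    mvfderiv (𝓡 n) f x = L.comp (mvfderiv (𝓡 n) e x) := by
  have h1 : HasMFDerivAt (𝓡 n) 𝓘(ℝ) u (e x) L := hu.hasMFDerivAt
  have h2 := ((mdifferentiable_of_mem_charts he).mdifferentiableAt hx).hasMFDerivAt
  have h3 := (h1.comp x h2).congr_of_eventuallyEq hfu
  rw [mvfderiv, h3.mfderiv]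
  rfl

theorem mvfderiv_coordVec {f : M → ℝ} (he : e ∈ charts n M) (hy : y ∈ e.target)
    (hf : DifferentiableAt ℝ (fun z => f (e.symm z)) y) (i : Fin n) :
    mvfderiv (𝓡 n) f (e.symm y) (coordVec e (e.symm y) i) =
      partialDeriv i (fun z => f (e.symm z)) y := by
  have hx := e.map_target hy
  have hev : f =ᶠ[𝓝 (e.symm y)] (fun z => f (e.symm z)) ∘ e :=
    (e.open_source.mem_nhds hx |> Filter.eventually_of_mem) fun z hz => by
      simp [e.left_inv hz]
  have hd : HasFDerivAt (fun z => f (e.symm z)) (fderiv ℝ (fun z => f (e.symm z)) y)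
      (e (e.symm y)) := by
    rw [e.right_inv hy]; exact hf.hasFDerivAt
  rw [mvfderiv_eq_fderiv_comp he hx hd hev, ← coe_chartDifferential he hx, ← coordFrame_apply he hx]
  simp [coordFrame, partialDeriv]

theorem cotangent_ext (he : e ∈ charts n M) (hx : x ∈ e.source) {θ θ' : Cotangent n x}
    (h : ∀ i, θ (coordVec e x i) = θ' (coordVec e x i)) : θ = θ' := by
  apply ContinuousLinearMap.coe_injective
  refine (coordFrame he hx).ext fun i => ?_
  rw [coordFrame_apply]
  exact h i

end Charts

/-! ### Natural Hamiltonians in coordinates -/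

section PhaseSpace

open scoped Topology

variable {n : ℕ} {M : Type*} [TopologicalSpace M] [ChartedSpace (EuclideanSpace ℝ (Fin n)) M]
  {e : Coords n M} {x : M} {y : EuclideanSpace ℝ (Fin n)} (g : PseudoMetric n M)

theorem dotProduct_coordForm (he : e ∈ charts n M) (hy : y ∈ e.target) (p : Fin n → ℝ)
    (j : Fin n) : (∑ i, p i • coordForm e (e.symm y) i) (coordVec e (e.symm y) j) = p j := by
  simp [sum_apply, coordForm_coordVec he (e.map_target hy)]

theorem hamiltonian_ofCoords (he : e ∈ charts n M) (K : EndField n M) (V : M → ℝ)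
    {z : Fin n ⊕ Fin n → ℝ} (hz : qPart z ∈ e.target) :
    g.hamiltonian K V (ofCoords e z) =
      (1 / 2) * (pPart z ⬝ᵥ ((components e K (qPart z) * (g.lower e (qPart z))⁻¹) *ᵥ pPart z)) +
        V (e.symm (qPart z)) := by
  have h1 : ∀ v : TangentSpace (𝓡 n) (e.symm (qPart z)),
      (∑ i, pPart z i • coordForm e (e.symm (qPart z)) i) v =
        pPart z ⬝ᵥ fun i => coordForm e (e.symm (qPart z)) i v := fun v => by
    simp [sum_apply, dotProduct]
  have h0 : g.hamiltonian K V (ofCoords e z) =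
      (1 / 2) * (∑ i, pPart z i • coordForm e (e.symm (qPart z)) i)
        (K (e.symm (qPart z)) (g.sharp (e.symm (qPart z))
          (∑ i, pPart z i • coordForm e (e.symm (qPart z)) i))) + V (e.symm (qPart z)) := rfl
  rw [h0, h1]
  congr 3
  funext i
  rw [components_mulVec he hz, ← Matrix.mulVec_mulVec]
  congr 2
  funext j
  rw [coordForm_sharp g he hz]
  congr 2
  funext k
  exact dotProduct_coordForm he hz _ _

/-- The projection `(q, p) ↦ q`, as a continuous linear map. -/
def qProj (n : ℕ) : (Fin n ⊕ Fin n → ℝ) →L[ℝ] EuclideanSpace ℝ (Fin n) :=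
  (EuclideanSpace.equiv (Fin n) ℝ).symm.toContinuousLinearMap.comp
    (ContinuousLinearMap.pi fun i => ContinuousLinearMap.proj (Sum.inl i))

theorem qProj_apply (z : Fin n ⊕ Fin n → ℝ) : qProj n z = qPart z := rfl

theorem qPart_single_inl (i : Fin n) :
    qPart (Pi.single (Sum.inl i) (1 : ℝ)) = EuclideanSpace.single i 1 := by
  ext j
  simp [qPart, Pi.single_apply]

theorem qPart_single_inr (i : Fin n) :
    qPart (Pi.single (Sum.inr i) (1 : ℝ)) = (0 : EuclideanSpace ℝ (Fin n)) := by
  ext j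
  simp [qPart]

theorem hasFDerivAt_quadratic {S : EuclideanSpace ℝ (Fin n) → Matrix (Fin n) (Fin n) ℝ}
    {u : EuclideanSpace ℝ (Fin n) → ℝ} {z : Fin n ⊕ Fin n → ℝ}
    (hS : SmoothEntriesAt S (qPart z)) (hu : DifferentiableAt ℝ u (qPart z)) :
    HasFDerivAt (fun w => (1 / 2) * (pPart w ⬝ᵥ (S (qPart w) *ᵥ pPart w)) + u (qPart w))
      ((1 / 2 : ℝ) • (∑ i, ∑ j, ((z (Sum.inr i) * S (qPart z) i j) •
          ContinuousLinearMap.proj (R := ℝ) (φ := fun _ : Fin n ⊕ Fin n => ℝ) (Sum.inr j) +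
        z (Sum.inr j) • (z (Sum.inr i) • (fderiv ℝ (fun y => S y i j) (qPart z)).comp (qProj n) +
          S (qPart z) i j •
            ContinuousLinearMap.proj (R := ℝ) (φ := fun _ : Fin n ⊕ Fin n => ℝ) (Sum.inr i)))) +
        (fderiv ℝ u (qPart z)).comp (qProj n)) z := by
  have hq : HasFDerivAt (fun w : Fin n ⊕ Fin n → ℝ => qPart w) (qProj n) z :=
    (qProj n).hasFDerivAt
  have hp : ∀ i : Fin n, HasFDerivAt (fun w : Fin n ⊕ Fin n → ℝ => w (Sum.inr i))
      (ContinuousLinearMap.proj (R := ℝ) (φ := fun _ : Fin n ⊕ Fin n => ℝ) (Sum.inr i)) z :=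
    fun i => (ContinuousLinearMap.proj (R := ℝ) (φ := fun _ : Fin n ⊕ Fin n => ℝ)
      (Sum.inr i)).hasFDerivAt
  have hSq : ∀ i j, HasFDerivAt (fun w => S (qPart w) i j)
      ((fderiv ℝ (fun y => S y i j) (qPart z)).comp (qProj n)) z := fun i j =>
    ((hS.differentiableAt i j).hasFDerivAt).comp z hq
  have hsum : (fun w : Fin n ⊕ Fin n → ℝ =>
      (1 / 2) * (pPart w ⬝ᵥ (S (qPart w) *ᵥ pPart w)) + u (qPart w)) =
      fun w => (1 / 2) * (∑ i, ∑ j, w (Sum.inr i) * S (qPart w) i j * w (Sum.inr j)) +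
        u (qPart w) := by
    funext w
    simp only [pPart, dotProduct, Matrix.mulVec, Finset.mul_sum, mul_assoc]
  rw [hsum]
  refine HasFDerivAt.add ?_ ((hu.hasFDerivAt).comp z hq)
  refine HasFDerivAt.const_mul ?_ _
  refine HasFDerivAt.fun_sum fun i _ => HasFDerivAt.fun_sum fun j _ => ?_
  exact ((hp i).mul (hSq i j)).mul (hp j)

theorem hasFDerivAt_hamiltonian (he : e ∈ charts n M) {K : EndField n M} {V : M → ℝ}
    {z : Fin n ⊕ Fin n → ℝ} (hz : qPart z ∈ e.target)
    (hK : SmoothEntriesAt (components e K) (qPart z))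
    (hV : DifferentiableAt ℝ (fun y => V (e.symm y)) (qPart z)) :
    HasFDerivAt (fun w => g.hamiltonian K V (ofCoords e w))
      (fderiv ℝ (fun w => g.hamiltonian K V (ofCoords e w)) z) z := by
  have hg := isLocalMetric_lower g he hz
  have h := hasFDerivAt_quadratic (hK.mul (hg.smooth.inv hg.det_ne_zero)) hV
  have hev : (fun w => g.hamiltonian K V (ofCoords e w)) =ᶠ[𝓝 z] fun w =>
      (1 / 2) * (pPart w ⬝ᵥ ((components e K (qPart w) * (g.lower e (qPart w))⁻¹) *ᵥ pPart w)) +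
        V (e.symm (qPart w)) := by
    have : ∀ᶠ w in 𝓝 z, qPart w ∈ e.target :=
      (qProj n).continuous.continuousAt.eventually (e.open_target.mem_nhds hz)
    exact this.mono fun w hw => hamiltonian_ofCoords g he K V hw
  exact (h.congr_of_eventuallyEq hev).differentiableAt.hasFDerivAt

theorem phaseDiff_hamiltonian (he : e ∈ charts n M) {K : EndField n M} {V : M → ℝ}
    {z : Fin n ⊕ Fin n → ℝ} (hz : qPart z ∈ e.target)
    (hK : SmoothEntriesAt (components e K) (qPart z))
    (hsymm : (components e K (qPart z))ᵀ * g.lower e (qPart z) =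
      g.lower e (qPart z) * components e K (qPart z))
    (hV : DifferentiableAt ℝ (fun y => V (e.symm y)) (qPart z)) {X : Fin n → ℝ}
    (hX : ∀ i, partialDeriv i (fun y => V (e.symm y)) (qPart z) =
      (g.lower e (qPart z) *ᵥ (components e K (qPart z) *ᵥ X)) i) :
    phaseDiff e (g.hamiltonian K V) z =
      kineticCovector (g.lower e) (components e K) X (pPart z) (qPart z) := by
  have hg := isLocalMetric_lower g he hz
  set S := fun y => components e K y * (g.lower e y)⁻¹ with hSdef
  have hS : SmoothEntriesAt S (qPart z) := hK.mul (hg.smooth.inv hg.det_ne_zero)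
  have h := hasFDerivAt_quadratic hS hV
  have hev : (fun w => g.hamiltonian K V (ofCoords e w)) =ᶠ[𝓝 z] fun w =>
      (1 / 2) * (pPart w ⬝ᵥ (S (qPart w) *ᵥ pPart w)) + V (e.symm (qPart w)) := by
    have : ∀ᶠ w in 𝓝 z, qPart w ∈ e.target :=
      (qProj n).continuous.continuousAt.eventually (e.open_target.mem_nhds hz)
    exact this.mono fun w hw => hamiltonian_ofCoords g he K V hw
  have hsymmS : ∀ i j, S (qPart z) i j = S (qPart z) j i := fun i j => by
    have h1 := hg.jet.raised_symm hsymm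
    have h2 : (S (qPart z))ᵀ = S (qPart z) := by
      rw [hSdef]
      simp only
      rw [Matrix.transpose_mul, hg.jet.symm_inv, h1]
    exact congrFun (congrFun h2 j) i
  ext (a | a)
  · rw [phaseDiff, hev.fderiv_eq, h.fderiv]
    simp only [kineticCovector, phaseCovector, Sum.elim_inl, ← hX]
    rw [← matrixPartial_mul hK (hg.smooth.inv hg.det_ne_zero)]
    simp only [add_apply, smul_apply, sum_apply, ContinuousLinearMap.comp_apply, qProj_apply,
      qPart_single_inl, ContinuousLinearMap.proj_apply, smul_eq_mul, partialDeriv]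
    congr 2
    simp only [dotProduct, Matrix.mulVec, Finset.mul_sum, matrixPartial, Matrix.of_apply,
      partialDeriv]
    refine Finset.sum_congr rfl fun i _ => Finset.sum_congr rfl fun j _ => ?_
    simp only [ne_eq, reduceCtorEq, not_false_eq_true, Pi.single_eq_of_ne, mul_zero, add_zero,
      zero_add, pPart]
    ring
  · rw [phaseDiff, hev.fderiv_eq, h.fderiv]
    simp only [kineticCovector, phaseCovector, Sum.elim_inr]
    rw [Matrix.mulVec_mulVec]
    simp only [add_apply, smul_apply, sum_apply, ContinuousLinearMap.comp_apply, qProj_apply,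
      qPart_single_inr, ContinuousLinearMap.proj_apply, smul_eq_mul, map_zero, mul_zero, add_zero,
      zero_add, Pi.single_apply, Sum.inr.injEq, mul_ite, mul_one]
    simp only [Finset.sum_add_distrib]
    rw [Finset.sum_comm (f := fun i j => if i = a then z (Sum.inr j) * S (qPart z) i j else 0)]
    simp only [Finset.sum_ite_eq', Finset.mem_univ, if_true, hsymmS _ a]
    have h1 : ((components e K (qPart z) * (g.lower e (qPart z))⁻¹) *ᵥ pPart z) a =
        ∑ i, z (Sum.inr i) * S (qPart z) a i := by
      change ∑ i, S (qPart z) a i * z (Sum.inr i) = _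
      exact Finset.sum_congr rfl fun i _ => mul_comm (S (qPart z) a i) (z (Sum.inr i))
    rw [h1]
    ring

end PhaseSpace

/-! ### Bi-cofactor systems -/

section BiCofactorSystem

open scoped Topology

variable {n : ℕ} {M : Type*} [TopologicalSpace M] [ChartedSpace (EuclideanSpace ℝ (Fin n)) M]
  {e : Coords n M} {y : EuclideanSpace ℝ (Fin n)} {g : PseudoMetric n M} {J₁ J₂ : EndField n M}
  {V W : M → ℝ}

/-- The components of the differential of `f` in the chart `e`. -/
def chartGradient (e : Coords n M) (f : M → ℝ) (y : EuclideanSpace ℝ (Fin n)) : Fin n → ℝ :=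
  fun i => partialDeriv i (fun z => f (e.symm z)) y

/-- The components of `(cof J)⁻¹ ∇V = (det J)⁻¹ J ∇V`, the negative of the force of the cofactor
system. -/
def forceVector (g : PseudoMetric n M) (J : EndField n M) (V : M → ℝ) (e : Coords n M)
    (y : EuclideanSpace ℝ (Fin n)) : Fin n → ℝ :=
  (((components e J y).det)⁻¹ • components e J y) *ᵥ ((g.lower e y)⁻¹ *ᵥ chartGradient e V y)

theorem coordForm_grad (he : e ∈ charts n M) (hy : y ∈ e.target) {f : M → ℝ}
    (hf : DifferentiableAt ℝ (fun z => f (e.symm z)) y) (i : Fin n) :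
    coordForm e (e.symm y) i (g.grad f (e.symm y)) =
      ((g.lower e y)⁻¹ *ᵥ chartGradient e f y) i := by
  rw [PseudoMetric.grad, coordForm_sharp g he hy]
  congr 2
  funext j
  exact mvfderiv_coordVec he hy hf j

theorem coordForm_force (he : e ∈ charts n M) (hy : y ∈ e.target)
    (hV : DifferentiableAt ℝ (fun z => V (e.symm z)) y) (K J : EndField n M) (i : Fin n) :
    coordForm e (e.symm y) i ((LinearMap.det (J (e.symm y)))⁻¹ •
      K (e.symm y) (J (e.symm y) (g.grad V (e.symm y)))) =
      (components e K y *ᵥ forceVector g J V e y) i := by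
  have h1 : (fun j => coordForm e (e.symm y) j (J (e.symm y) (g.grad V (e.symm y)))) =
      components e J y *ᵥ ((g.lower e y)⁻¹ *ᵥ chartGradient e V y) := by
    funext j
    rw [components_mulVec he hy]
    simp_rw [coordForm_grad he hy hV]
  rw [map_smul, components_mulVec he hy, h1, forceVector, det_components he hy, Matrix.smul_mulVec,
    Matrix.mulVec_smul]
  rfl

theorem tangent_ext (he : e ∈ charts n M) (hy : y ∈ e.target)
    {v w : TangentSpace (𝓡 n) (e.symm y)}
    (h : ∀ i, coordForm e (e.symm y) i v = coordForm e (e.symm y) i w) : v = w :=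
  (coordFrame he (e.map_target hy)).ext_elem fun i => by
    rw [coordFrame_repr, coordFrame_repr, h]

/-- The equation `∇f = (det J)⁻¹ K J ∇V` for a potential `f` says in coordinates that `df = g K X`
with `X = (cof J)⁻¹ ∇V`. -/
theorem grad_eq_iff (he : e ∈ charts n M) (hy : y ∈ e.target) {f : M → ℝ}
    (hf : DifferentiableAt ℝ (fun z => f (e.symm z)) y)
    (hV : DifferentiableAt ℝ (fun z => V (e.symm z)) y) (K J : EndField n M) :
    g.grad f (e.symm y) = (LinearMap.det (J (e.symm y)))⁻¹ •
        K (e.symm y) (J (e.symm y) (g.grad V (e.symm y))) ↔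
      chartGradient e f y = g.lower e y *ᵥ (components e K y *ᵥ forceVector g J V e y) := by
  have hg := isLocalMetric_lower g he hy
  constructor
  · intro h
    have h1 : (g.lower e y)⁻¹ *ᵥ chartGradient e f y =
        components e K y *ᵥ forceVector g J V e y := funext fun i => by
      rw [← coordForm_grad he hy hf, ← coordForm_force he hy hV, h]
    rw [← h1, Matrix.mulVec_mulVec, hg.jet.mul_eq_one, Matrix.one_mulVec]
  · intro h
    refine tangent_ext he hy fun i => ?_
    rw [coordForm_grad he hy hf, coordForm_force he hy hV, h, Matrix.mulVec_mulVec,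
      hg.jet.mul_eq_one', Matrix.one_mulVec]

omit [ChartedSpace (EuclideanSpace ℝ (Fin n)) M] in
theorem contDiffAt_chartGradient {f : M → ℝ}
    (hf : ContDiffAt ℝ ∞ (fun z => f (e.symm z)) y) (i : Fin n) :
    ContDiffAt ℝ ∞ (fun y => chartGradient e f y i) y :=
  contDiffAt_partialDeriv hf i

omit [ChartedSpace (EuclideanSpace ℝ (Fin n)) M] in
theorem chartGradient_isClosedAt {f : M → ℝ}
    (hf : ContDiffAt ℝ ∞ (fun z => f (e.symm z)) y) : IsClosedAt (chartGradient e f) y :=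
  fun h j => partialDeriv_comm hf h j

theorem IsClosedAt.congr {b b' : EuclideanSpace ℝ (Fin n) → Fin n → ℝ} (hb : IsClosedAt b y)
    (h : b' =ᶠ[𝓝 y] b) : IsClosedAt b' y := by
  have h1 : ∀ i, vectorPartial i b' y = vectorPartial i b y := fun i =>
    funext fun j => partialDeriv_congr (h.mono fun z hz => by simp only [hz]) i
  intro i j
  rw [h1, h1, hb]

section System

variable (hsys : IsBiCofactor g J₁ J₂ V W) (he : e ∈ charts n M) (hy : y ∈ e.target)

include hsys he hy

theorem IsBiCofactor.contDiffAt₁ : ContDiffAt ℝ ∞ (fun z => V (e.symm z)) y :=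
  contDiffAt_comp_symm isOpen_univ hsys.smooth₁.contMDiffOn he hy trivial

theorem IsBiCofactor.contDiffAt₂ : ContDiffAt ℝ ∞ (fun z => W (e.symm z)) y :=
  contDiffAt_comp_symm isOpen_univ hsys.smooth₂.contMDiffOn he hy trivial

theorem IsBiCofactor.det_components_ne_zero₁ : (components e J₁ y).det ≠ 0 := by
  rw [det_components he hy]; exact hsys.det_ne_zero₁ _

theorem IsBiCofactor.det_components_ne_zero₂ : (components e J₂ y).det ≠ 0 := by
  rw [det_components he hy]; exact hsys.det_ne_zero₂ _

omit he hy in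
theorem IsBiCofactor.force_eq' (x : M) :
    (LinearMap.det (J₁ x))⁻¹ • J₁ x (g.grad V x) =
      (LinearMap.det (J₂ x))⁻¹ • J₂ x (g.grad W x) := by
  have h := hsys.force_eq x
  rw [inverse_cof (hsys.det_ne_zero₁ x), inverse_cof (hsys.det_ne_zero₂ x)] at h
  exact h

omit he hy in
theorem IsBiCofactor.grad_eq₁ (x : M) :
    g.grad V x = (LinearMap.det (J₁ x))⁻¹ • cof (J₁ x) (J₁ x (g.grad V x)) := by
  rw [← Module.End.mul_apply, cof_mul, LinearMap.smul_apply, Module.End.one_apply,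
    inv_smul_smul₀ (hsys.det_ne_zero₁ x)]

omit he hy in
theorem IsBiCofactor.grad_eq₂ (x : M) :
    g.grad W x = (LinearMap.det (J₁ x))⁻¹ • cof (J₂ x) (J₁ x (g.grad V x)) := by
  rw [← map_smul, hsys.force_eq', map_smul, ← Module.End.mul_apply, cof_mul, LinearMap.smul_apply,
    Module.End.one_apply, inv_smul_smul₀ (hsys.det_ne_zero₂ x)]

theorem IsBiCofactor.chartGradient₁ : chartGradient e V y =
    g.lower e y *ᵥ ((components e J₁ y).adjugate *ᵥ forceVector g J₁ V e y) := by
  have hV := (hsys.contDiffAt₁ he hy).differentiableAt (by simp)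
  rw [← components_cof he hy]
  exact (grad_eq_iff he hy hV hV (fun x => cof (J₁ x)) J₁).mp (hsys.grad_eq₁ _)

theorem IsBiCofactor.chartGradient₂ : chartGradient e W y =
    g.lower e y *ᵥ ((components e J₂ y).adjugate *ᵥ forceVector g J₁ V e y) := by
  have hV := (hsys.contDiffAt₁ he hy).differentiableAt (by simp)
  have hW := (hsys.contDiffAt₂ he hy).differentiableAt (by simp)
  rw [← components_cof he hy]
  exact (grad_eq_iff he hy hW hV (fun x => cof (J₂ x)) J₁).mp (hsys.grad_eq₂ _)

theorem IsBiCofactor.contDiffAt_forceVector (k : Fin n) :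
    ContDiffAt ℝ ∞ (fun y => forceVector g J₁ V e y k) y := by
  have hg := isLocalMetric_lower g he hy
  have hJ := smoothEntriesAt_components hsys.jTensor₁.1 he hy
  exact (hJ.smul (hJ.det.inv (hsys.det_components_ne_zero₁ he hy))).mulVec
    (fun k => (hg.smooth.inv hg.det_ne_zero).mulVec
      (contDiffAt_chartGradient (hsys.contDiffAt₁ he hy)) k) k

/-- At any point there are `n` distinct parameters at which the pencil is nonsingular. -/
theorem IsBiCofactor.exists_generic :
    ∃ ξ : Fin n → ℝ, Function.Injective ξ ∧
      ∀ a, (components e J₂ y + ξ a • components e J₁ y).det ≠ 0 :=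
  exists_injective_det_pencil_ne_zero n _ _ (hsys.det_components_ne_zero₁ he hy)

omit hsys in
theorem components_kTensor_eventuallyEq (J₁ J₂ : EndField n M) (r : ℕ) {ξ : Fin n → ℝ}
    (hξ : Function.Injective ξ) :
    components e (kTensor J₁ J₂ r) =ᶠ[𝓝 y]
      cofCombination (components e J₁) (components e J₂) (lagrangeCoeff ξ (n - r)) ξ :=
  (eventually_mem_target hy).mono fun _ hz => components_kTensor he hz J₁ J₂ r hξ

omit he hy in
theorem IsBiCofactor.isKillingTensor_kTensor (r : ℕ) : g.IsKillingTensor (kTensor J₁ J₂ r) := by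
  have hs := isSmoothField_kTensor hsys.jTensor₁.1 hsys.jTensor₂.1 r
  refine ⟨hs, fun e he y hy => ?_⟩
  obtain ⟨ξ, hinj, hξ⟩ := hsys.exists_generic he hy
  have hg := isLocalMetric_lower g he hy
  have h₁ := isLocalJTensor_components g hsys.jTensor₁ he hy
  have h₂ := isLocalJTensor_components g hsys.jTensor₂ he hy
  have hev := components_kTensor_eventuallyEq he hy J₁ J₂ r hinj
  constructor
  · rw [Matrix.IsSymm, PseudoMetric.lowered, Matrix.transpose_mul, hg.symm, hev.eq_of_nhds]
    exact cofCombination_symm h₁ h₂ hξ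
  · intro h i j
    have hc : covariantPartial (g.lower e) (components e (kTensor J₁ J₂ r)) y =
        covariantPartial (g.lower e) (cofCombination (components e J₁) (components e J₂)
          (lagrangeCoeff ξ (n - r)) ξ) y := by
      funext h
      rw [covariantPartial, covariantPartial, matrixPartial_congr hev, hev.eq_of_nhds]
    rw [covDerivLowered_eq g hs he hy, covDerivLowered_eq g hs he hy,
      covDerivLowered_eq g hs he hy, hc]
    exact cofCombination_killing hg h₁ h₂ hξ h i j

/-- The 1-forms `g K_r X` are closed: for the two cofactors this holds because they are `dV` and
`dW`, and it passes to all `K_r`. -/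
theorem IsBiCofactor.isClosedAt_kTensor (r : ℕ) :
    IsClosedAt (fun y => g.lower e y *ᵥ
      (components e (kTensor J₁ J₂ r) y *ᵥ forceVector g J₁ V e y)) y := by
  obtain ⟨ξ, hinj, hξ⟩ := hsys.exists_generic he hy
  have hg := isLocalMetric_lower g he hy
  refine (isClosedAt_cofCombination (c := lagrangeCoeff ξ (n - r)) hg
    (isLocalJTensor_components g hsys.jTensor₁ he hy)
    (isLocalJTensor_components g hsys.jTensor₂ he hy) hξ
    (hsys.contDiffAt_forceVector he hy) (hsys.det_components_ne_zero₁ he hy)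
    (hsys.det_components_ne_zero₂ he hy) ?_ ?_).congr ?_
  · exact (chartGradient_isClosedAt (hsys.contDiffAt₁ he hy)).congr
      ((eventually_mem_target hy).mono fun z hz => (hsys.chartGradient₁ he hz).symm)
  · exact (chartGradient_isClosedAt (hsys.contDiffAt₂ he hy)).congr
      ((eventually_mem_target hy).mono fun z hz => (hsys.chartGradient₂ he hz).symm)
  · exact (components_kTensor_eventuallyEq he hy J₁ J₂ r hinj).mono fun z hz => by
      simp only [hz]

theorem IsBiCofactor.contDiffAt_potentialForm (r : ℕ) (i : Fin n) :
    ContDiffAt ℝ ∞ (fun y => (g.lower e y *ᵥ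
      (components e (kTensor J₁ J₂ r) y *ᵥ forceVector g J₁ V e y)) i) y :=
  (isLocalMetric_lower g he hy).smooth.mulVec (fun k =>
    (smoothEntriesAt_components (isSmoothField_kTensor hsys.jTensor₁.1 hsys.jTensor₂.1 r)
      he hy).mulVec (hsys.contDiffAt_forceVector he hy) k) i

end System

theorem kTensor_one (J₁ J₂ : EndField n M) (x : M) :
    kTensor J₁ J₂ 1 x = cof (J₁ x) := by
  have := cofPencilCoeff_top (J₁ x) (J₂ x)
  rwa [finrank_tangentSpace] at this

theorem kTensor_last (J₁ J₂ : EndField n M) (x : M) :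
    kTensor J₁ J₂ n x = cof (J₂ x) := by
  rw [kTensor, Nat.sub_self, cofPencilCoeff_zero]

theorem cof_pencil_eq_sum_kTensor (J₁ J₂ : EndField n M) (x : M) (ξ : ℝ) :
    cof (J₂ x + ξ • J₁ x) = ∑ i ∈ Finset.range n, ξ ^ i • kTensor J₁ J₂ (n - i) x := by
  rw [cof_pencil_eq_sum, finrank_tangentSpace]
  refine Finset.sum_congr rfl fun i hi => ?_
  rw [kTensor, Nat.sub_sub_self (Finset.mem_range.mp hi).le]

end BiCofactorSystem

/-! ### Existence of the potentials -/

section Potentials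

open scoped Topology

variable {n : ℕ}

/-- The Poincaré lemma for a smooth closed 1-form, given by its components, on a convex open set. -/
theorem exists_potential_of_convex {b : EuclideanSpace ℝ (Fin n) → Fin n → ℝ}
    {s : Set (EuclideanSpace ℝ (Fin n))} (hs : Convex ℝ s) (ho : IsOpen s)
    (hb : ∀ y ∈ s, ∀ i, ContDiffAt ℝ ∞ (fun y => b y i) y) (hc : ∀ y ∈ s, IsClosedAt b y) :
    ∃ u : EuclideanSpace ℝ (Fin n) → ℝ, ContDiffOn ℝ ∞ u s ∧
      ∀ y ∈ s, ∀ i, partialDeriv i u y = b y i := by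
  let θ : EuclideanSpace ℝ (Fin n) → EuclideanSpace ℝ (Fin n) →L[ℝ] ℝ := fun y =>
    ∑ i, b y i • (EuclideanSpace.proj i : EuclideanSpace ℝ (Fin n) →L[ℝ] ℝ)
  have hθ : ∀ y ∈ s, ContDiffAt ℝ ∞ θ y := fun y hy =>
    ContDiffAt.sum fun i _ => (hb y hy i).smul contDiffAt_const
  have hderiv : ∀ y ∈ s, ∀ v w, fderiv ℝ θ y v w =
      ∑ i, ∑ j, partialDeriv j (fun y => b y i) y * (v j * w i) := by
    intro y hy v w
    have h1 : HasFDerivAt θ (∑ i, (fderiv ℝ (fun y => b y i) y).smulRight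
        (EuclideanSpace.proj i : EuclideanSpace ℝ (Fin n) →L[ℝ] ℝ)) y :=
      HasFDerivAt.fun_sum fun i _ =>
        (((hb y hy i).differentiableAt (by simp)).hasFDerivAt).smul_const
          (EuclideanSpace.proj i : EuclideanSpace ℝ (Fin n) →L[ℝ] ℝ)
    rw [h1.fderiv]
    simp only [sum_apply, ContinuousLinearMap.smulRight_apply, smul_apply, smul_eq_mul]
    refine Finset.sum_congr rfl fun i _ => ?_
    have hv : v = ∑ j, v j • EuclideanSpace.single j (1 : ℝ) := by
      have := (EuclideanSpace.basisFun (Fin n) ℝ).sum_repr v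
      simpa using this.symm
    conv_lhs => rw [hv]
    rw [map_sum, Finset.sum_mul]
    refine Finset.sum_congr rfl fun j _ => ?_
    rw [map_smul, smul_eq_mul, partialDeriv]
    have hw : (EuclideanSpace.proj i : EuclideanSpace ℝ (Fin n) →L[ℝ] ℝ) w = w i := rfl
    rw [hw]
    ring
  obtain ⟨u, hu⟩ : ∃ u : EuclideanSpace ℝ (Fin n) → ℝ,
      ∀ y ∈ s, HasFDerivWithinAt u (θ y) s y :=
    hs.exists_forall_hasFDerivWithinAt_of_fderivWithin_symmetric
    (fun y hy => ((hθ y hy).differentiableAt (by simp)).differentiableWithinAt)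
    (fun y hy v _ w _ => by
      rw [fderivWithin_of_isOpen ho hy, hderiv y hy, hderiv y hy, Finset.sum_comm]
      refine Finset.sum_congr rfl fun j _ => Finset.sum_congr rfl fun i _ => ?_
      have : partialDeriv j (fun y => b y i) y = partialDeriv i (fun y => b y j) y :=
        hc y hy j i
      rw [this]
      ring)
  have hu' : ∀ y ∈ s, HasFDerivAt u (θ y) y := fun y hy => (hu y hy).hasFDerivAt (ho.mem_nhds hy)
  refine ⟨u, (contDiffOn_infty_iff_fderiv_of_isOpen ho).mpr
    ⟨fun y hy => (hu y hy).differentiableWithinAt, fun y hy => ?_⟩, fun y hy i => ?_⟩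
  · exact ((hθ y hy).contDiffWithinAt).congr (fun z hz => (hu' z hz).fderiv) (hu' y hy).fderiv
  · rw [partialDeriv, (hu' y hy).fderiv]
    simp [θ, sum_apply]

variable {M : Type*} [TopologicalSpace M] [ChartedSpace (EuclideanSpace ℝ (Fin n)) M]
  {e : Coords n M} {y : EuclideanSpace ℝ (Fin n)} {g : PseudoMetric n M} {J₁ J₂ : EndField n M}
  {V W : M → ℝ}

/-- Any potentials can be completed to a family with `v 1 = V` and `v n = W`. The hypothesis `hVW` is
what makes these two requirements compatible for `n = 1`. -/
theorem IsBiCofactor.exists_isPotentialFamily (hsys : IsBiCofactor g J₁ J₂ V W)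
    (hVW : n = 1 → V = W) {U : Set M} (f : ℕ → M → ℝ)
    (hf : ∀ r, ContMDiffOn (𝓡 n) 𝓘(ℝ) ∞ (f r) U)
    (hgrad : ∀ r, ∀ x ∈ U, g.grad (f r) x =
      (LinearMap.det (J₁ x))⁻¹ • kTensor J₁ J₂ r x (J₁ x (g.grad V x))) :
    ∃ v : ℕ → M → ℝ, IsPotentialFamily g J₁ J₂ V W U v := by
  have hv1 : (fun r => if r = 1 then V else if r = n then W else f r) 1 = V := if_pos rfl
  refine ⟨fun r => if r = 1 then V else if r = n then W else f r, ?_, ?_, ?_, ?_⟩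
  · intro r _
    by_cases h1 : r = 1
    · simp only [if_pos h1]; exact hsys.smooth₁.contMDiffOn
    by_cases h2 : r = n
    · simp only [if_neg h1, if_pos h2]; exact hsys.smooth₂.contMDiffOn
    · simp only [if_neg h1, if_neg h2]; exact hf r
  · intro x _
    exact congrFun hv1 x
  · intro x _
    by_cases h1 : n = 1
    · simp only [if_pos h1]; rw [hVW h1]
    · simp only [if_neg h1, if_true]
  · intro r _ x hx
    simp only [if_true]
    by_cases h1 : r = 1
    · simp only [if_pos h1]
      rw [h1, kTensor_one]
      exact hsys.grad_eq₁ x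
    by_cases h2 : r = n
    · simp only [if_neg h1, if_pos h2]
      rw [h2, kTensor_last]
      exact hsys.grad_eq₂ x
    · simp only [if_neg h1, if_neg h2]; exact hgrad r x hx

instance instT2SpaceTangentSpace (x : M) : T2Space (TangentSpace (𝓡 n) x) :=
  inferInstanceAs (T2Space (EuclideanSpace ℝ (Fin n)))

/-- The 1-form `g ((det J₁)⁻¹ K_r J₁ ∇V, ·)`, whose primitives are the potentials `V_r`. -/
def potentialForm (g : PseudoMetric n M) (J₁ J₂ : EndField n M) (V : M → ℝ) (r : ℕ) (x : M) :
    Cotangent n x :=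
  LinearMap.toContinuousLinearMap (g.form x
    ((LinearMap.det (J₁ x))⁻¹ • kTensor J₁ J₂ r x (J₁ x (g.grad V x))))

theorem sharp_potentialForm (r : ℕ) (x : M) : g.sharp x (potentialForm g J₁ J₂ V r x) =
    (LinearMap.det (J₁ x))⁻¹ • kTensor J₁ J₂ r x (J₁ x (g.grad V x)) := by
  rw [PseudoMetric.sharp, LinearEquiv.symm_apply_eq]
  rfl

theorem IsBiCofactor.formComponents_potentialForm (hsys : IsBiCofactor g J₁ J₂ V W)
    (he : e ∈ charts n M) (hy : y ∈ e.target) (r : ℕ) (i : Fin n) :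
    formComponents e (potentialForm g J₁ J₂ V r) y i =
      (g.lower e y *ᵥ (components e (kTensor J₁ J₂ r) y *ᵥ forceVector g J₁ V e y)) i := by
  have hg := isLocalMetric_lower g he hy
  have h1 : (fun i => coordForm e (e.symm y) i (g.sharp (e.symm y)
      (potentialForm g J₁ J₂ V r (e.symm y)))) =
      components e (kTensor J₁ J₂ r) y *ᵥ forceVector g J₁ V e y := funext fun i => by
    rw [sharp_potentialForm]
    exact coordForm_force he hy ((hsys.contDiffAt₁ he hy).differentiableAt (by simp)) _ _ i
  simp_rw [coordForm_sharp g he hy] at h1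
  rw [← h1]
  simp only [Matrix.mulVec_mulVec]
  rw [hg.jet.mul_eq_one, Matrix.one_mulVec]
  rfl

theorem IsBiCofactor.isClosedForm_potentialForm (hsys : IsBiCofactor g J₁ J₂ V W) (r : ℕ) :
    IsClosedForm (potentialForm g J₁ J₂ V r) := by
  intro e he
  constructor
  · intro i y hy
    exact (hsys.contDiffAt_potentialForm he hy r i).contDiffWithinAt.congr
      (fun z hz => hsys.formComponents_potentialForm he hz r i)
      (hsys.formComponents_potentialForm he hy r i)
  · intro y hy i j
    have := (hsys.isClosedAt_kTensor he hy r).congr (b' := formComponents e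
      (potentialForm g J₁ J₂ V r)) ((eventually_mem_target hy).mono fun z hz =>
        funext fun i => hsys.formComponents_potentialForm he hz r i)
    exact this i j

theorem IsBiCofactor.exists_isPotentialFamily_univ (hsys : IsBiCofactor g J₁ J₂ V W)
    (hVW : n = 1 → V = W) (hM : ClosedFormsExact n M) :
    ∃ v : ℕ → M → ℝ, IsPotentialFamily g J₁ J₂ V W Set.univ v := by
  choose f hf hdf using fun r => hM _ (hsys.isClosedForm_potentialForm r)
  refine hsys.exists_isPotentialFamily hVW f (fun r => (hf r).contMDiffOn) fun r x _ => ?_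
  rw [PseudoMetric.grad, hdf, sharp_potentialForm]

theorem IsBiCofactor.exists_isPotentialFamily_nhds [IsManifold (𝓡 n) ∞ M]
    (hsys : IsBiCofactor g J₁ J₂ V W) (hVW : n = 1 → V = W) (x : M) :
    ∃ U : Set M, IsOpen U ∧ x ∈ U ∧
      ∃ v : ℕ → M → ℝ, IsPotentialFamily g J₁ J₂ V W U v := by
  let e : Coords n M := chartAt (EuclideanSpace ℝ (Fin n)) x
  have he : e ∈ charts n M := IsManifold.chart_mem_maximalAtlas x
  have hx : x ∈ e.source := mem_chart_source _ x
  obtain ⟨ε, hε, hball⟩ := Metric.isOpen_iff.mp e.open_target (e x) (e.map_source hx)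
  have hpot := fun r => exists_potential_of_convex (convex_ball (e x) ε) Metric.isOpen_ball
    (b := fun y => g.lower e y *ᵥ
      (components e (kTensor J₁ J₂ r) y *ᵥ forceVector g J₁ V e y))
    (fun y hy i => hsys.contDiffAt_potentialForm he (hball hy) r i)
    (fun y hy => hsys.isClosedAt_kTensor he (hball hy) r)
  choose u hu hdu using hpot
  refine ⟨e.source ∩ e ⁻¹' Metric.ball (e x) ε, e.isOpen_inter_preimage Metric.isOpen_ball,
    ⟨hx, Metric.mem_ball_self hε⟩,
    hsys.exists_isPotentialFamily hVW (fun r => u r ∘ e) (fun r => ?_) fun r z hz => ?_⟩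
  · exact (hu r).contMDiffOn.comp ((contMDiffOn_of_mem_maximalAtlas he).mono Set.inter_subset_left)
      fun z hz => hz.2
  · obtain ⟨y, hy, rfl⟩ : ∃ y ∈ e.target, e.symm y = z := ⟨e z, e.map_source hz.1, e.left_inv hz.1⟩
    have hyb : y ∈ Metric.ball (e x) ε := by
      have := hz.2
      rwa [Set.mem_preimage, e.right_inv hy] at this
    have hev : (fun z => (u r ∘ e) (e.symm z)) =ᶠ[𝓝 y] u r :=
      (eventually_mem_target hy).mono fun z hz => by simp [e.right_inv hz]
    have hd : DifferentiableAt ℝ (u r) y :=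
      ((hu r).contDiffAt (Metric.isOpen_ball.mem_nhds hyb)).differentiableAt (by simp)
    refine (grad_eq_iff he hy (hev.differentiableAt_iff.mpr hd)
      ((hsys.contDiffAt₁ he hy).differentiableAt (by simp)) (kTensor J₁ J₂ r) J₁).mpr ?_
    funext i
    rw [chartGradient, partialDeriv_congr hev, hdu r y hyb]

end Potentials

/-! ### Involution and constants of motion -/

section Dynamics

open scoped Topology

variable {n : ℕ} {M : Type*} [TopologicalSpace M] [ChartedSpace (EuclideanSpace ℝ (Fin n)) M]
  {e : Coords n M} {g : PseudoMetric n M} {J₁ J₂ : EndField n M} {V W : M → ℝ}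

theorem kineticCovector_congr {g K K' : EuclideanSpace ℝ (Fin n) → Matrix (Fin n) (Fin n) ℝ}
    {y : EuclideanSpace ℝ (Fin n)} (h : K =ᶠ[𝓝 y] K') (X p : Fin n → ℝ) :
    kineticCovector g K X p y = kineticCovector g K' X p y := by
  rw [kineticCovector, kineticCovector, h.eq_of_nhds]
  congr 1
  exact funext fun i => matrixPartial_congr h i

variable {z : Fin n ⊕ Fin n → ℝ}

theorem components_cof_eventuallyEq (he : e ∈ charts n M) {y : EuclideanSpace ℝ (Fin n)}
    (hy : y ∈ e.target) (A : EndField n M) :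
    components e (fun x => cof (A x)) =ᶠ[𝓝 y] fun y => (components e A y).adjugate :=
  (eventually_mem_target hy).mono fun _ hz => components_cof he hz A

/-- The quasi-Hamiltonian field of a cofactor system is the Newton field of its force, and so does not
depend on the cofactor representation of the force. -/
theorem quasiHamField_cof (he : e ∈ charts n M) (hz : qPart z ∈ e.target)
    {J : EndField n M} (hJ : g.IsJTensor J) (hdet : ∀ x, LinearMap.det (J x) ≠ 0)
    (hV : ContDiffAt ℝ ∞ (fun y => V (e.symm y)) (qPart z)) {X : Fin n → ℝ}
    (hX : chartGradient e V (qPart z) = g.lower e (qPart z) *ᵥ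
      ((components e J (qPart z)).adjugate *ᵥ X)) :
    quasiHamField e J (g.hamiltonian (fun x => cof (J x)) V) z =
      newtonField (g.lower e (qPart z)) (g.lower e (qPart z))⁻¹
        (christoffelMatrix (g.lower e) (qPart z)) X (pPart z) := by
  have hg := isLocalMetric_lower g he hz
  have hJ' := isLocalJTensor_components g hJ he hz
  have hd : (components e J (qPart z)).det ≠ 0 := by
    rw [det_components he hz]; exact hdet _
  have hev := components_cof_eventuallyEq he hz J
  have hsymm : ((components e J (qPart z)).adjugate)ᵀ * g.lower e (qPart z) =
      g.lower e (qPart z) * (components e J (qPart z)).adjugate := by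
    obtain ⟨s, lam, j⟩ := hJ'
    exact (isCofactorJet_covariant (g := g.lower e) s hd).lowered_symm j.symm
  have hdiff : phaseDiff e (g.hamiltonian (fun x => cof (J x)) V) z =
      kineticCovector (g.lower e) (fun y => (components e J y).adjugate) X (pPart z) (qPart z) := by
    rw [← kineticCovector_congr hev]
    refine phaseDiff_hamiltonian g he hz (hJ'.1.adjugate.congr hev) ?_
      (hV.differentiableAt (by simp)) ?_
    · rw [hev.eq_of_nhds, hsymm]
    · intro i
      rw [hev.eq_of_nhds]
      exact congrFun hX i
  have hpi : piNC e J z = phaseMatrix (pPart z) (components e J (qPart z))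
      (fun h => matrixPartial h (components e J) (qPart z)) := rfl
  rw [quasiHamField, hdiff, hpi, phaseMatrix_mulVec_kineticCovector hg hJ' hd,
    ← det_components he hz, inv_smul_smul₀ hd]

theorem IsBiCofactor.quasiHamField_eq (hsys : IsBiCofactor g J₁ J₂ V W) (he : e ∈ charts n M)
    (hz : qPart z ∈ e.target) :
    quasiHamField e J₁ (g.hamiltonian (fun x => cof (J₁ x)) V) z =
      quasiHamField e J₂ (g.hamiltonian (fun x => cof (J₂ x)) W) z := by
  rw [quasiHamField_cof he hz hsys.jTensor₁ hsys.det_ne_zero₁ (hsys.contDiffAt₁ he hz)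
      (hsys.chartGradient₁ he hz),
    quasiHamField_cof he hz hsys.jTensor₂ hsys.det_ne_zero₂ (hsys.contDiffAt₂ he hz)
      (hsys.chartGradient₂ he hz)]

variable {U : Set M} {v : ℕ → M → ℝ}

theorem IsPotentialFamily.contDiffAt (hv : IsPotentialFamily g J₁ J₂ V W U v) (hU : IsOpen U)
    (he : e ∈ charts n M) {y : EuclideanSpace ℝ (Fin n)} (hy : y ∈ e.target)
    (hyU : e.symm y ∈ U) {r : ℕ} (hr : r ∈ Finset.Icc 1 n) :
    ContDiffAt ℝ ∞ (fun y => v r (e.symm y)) y :=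
  contDiffAt_comp_symm hU (hv.1 r hr) he hy hyU

theorem IsPotentialFamily.chartGradient_eq (hv : IsPotentialFamily g J₁ J₂ V W U v)
    (hsys : IsBiCofactor g J₁ J₂ V W) (hU : IsOpen U)
    (he : e ∈ charts n M) {y : EuclideanSpace ℝ (Fin n)} (hy : y ∈ e.target)
    (hyU : e.symm y ∈ U) {r : ℕ} (hr : r ∈ Finset.Icc 1 n) :
    chartGradient e (v r) y = g.lower e y *ᵥ
      (components e (kTensor J₁ J₂ r) y *ᵥ forceVector g J₁ V e y) := by
  refine (grad_eq_iff he hy ((hv.contDiffAt hU he hy hyU hr).differentiableAt (by simp))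
    ((hsys.contDiffAt₁ he hy).differentiableAt (by simp)) (kTensor J₁ J₂ r) J₁).mp ?_
  have h1 : g.grad (v 1) (e.symm y) = g.grad V (e.symm y) := by
    have hev : v 1 =ᶠ[𝓝 (e.symm y)] V := Filter.eventually_of_mem (hU.mem_nhds hyU) hv.2.1
    rw [PseudoMetric.grad, PseudoMetric.grad, mvfderiv, mvfderiv, hev.mfderiv_eq]
    rfl
  rw [← h1]
  exact hv.2.2.2 r hr _ hyU

theorem IsPotentialFamily.phaseDiff_eq (hv : IsPotentialFamily g J₁ J₂ V W U v)
    (hsys : IsBiCofactor g J₁ J₂ V W) (hU : IsOpen U)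
    (he : e ∈ charts n M) (hz : qPart z ∈ e.target)
    (hzU : e.symm (qPart z) ∈ U) {r : ℕ} (hr : r ∈ Finset.Icc 1 n) :
    phaseDiff e (g.hamiltonian (kTensor J₁ J₂ r) (v r)) z =
      kineticCovector (g.lower e) (components e (kTensor J₁ J₂ r))
        (forceVector g J₁ V e (qPart z)) (pPart z) (qPart z) := by
  have hg := isLocalMetric_lower g he hz
  have hk := hsys.isKillingTensor_kTensor r
  refine phaseDiff_hamiltonian g he hz (smoothEntriesAt_components hk.1 he hz) ?_
    ((hv.contDiffAt hU he hz hzU hr).differentiableAt (by simp))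
    fun i => congrFun (hv.chartGradient_eq hsys hU he hz hzU hr) i
  have := (hk.2 e he _ hz).1
  rw [Matrix.IsSymm, PseudoMetric.lowered, Matrix.transpose_mul, hg.symm] at this
  exact this

theorem IsPotentialFamily.bracket_eq_zero (hv : IsPotentialFamily g J₁ J₂ V W U v)
    (hsys : IsBiCofactor g J₁ J₂ V W) (hU : IsOpen U)
    (he : e ∈ charts n M) (hz : qPart z ∈ e.target)
    (hzU : e.symm (qPart z) ∈ U) {r s : ℕ} (hr : r ∈ Finset.Icc 1 n) (hs : s ∈ Finset.Icc 1 n) :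
    bracket e J₁ (g.hamiltonian (kTensor J₁ J₂ r) (v r))
        (g.hamiltonian (kTensor J₁ J₂ s) (v s)) z = 0 ∧
      bracket e J₂ (g.hamiltonian (kTensor J₁ J₂ r) (v r))
        (g.hamiltonian (kTensor J₁ J₂ s) (v s)) z = 0 := by
  obtain ⟨ξ, hinj, hξ⟩ := hsys.exists_generic he hz
  rw [bracket, bracket, hv.phaseDiff_eq hsys hU he hz hzU hr,
    hv.phaseDiff_eq hsys hU he hz hzU hs,
    kineticCovector_congr (components_kTensor_eventuallyEq he hz J₁ J₂ r hinj),
    kineticCovector_congr (components_kTensor_eventuallyEq he hz J₁ J₂ s hinj)]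
  exact phaseBracket_cofCombination (isLocalMetric_lower g he hz)
    (isLocalJTensor_components g hsys.jTensor₁ he hz)
    (isLocalJTensor_components g hsys.jTensor₂ he hz) hξ hinj _ _

theorem qPart_toCoords (e : Coords n M) (w : PhaseSpace n M) : qPart (toCoords e w) = e w.1 := rfl

theorem ofCoords_toCoords (he : e ∈ charts n M) (w : PhaseSpace n M) (hw : w.1 ∈ e.source) :
    ofCoords e (toCoords e w) = w := by
  obtain ⟨x, p⟩ := w
  have key : ∀ x' : M, x' = x → (⟨x', ∑ i, p (coordVec e x i) • coordForm e x' i⟩ :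
      PhaseSpace n M) = ⟨x, p⟩ := by
    rintro _ rfl
    congr 1
    refine cotangent_ext he hw fun j => ?_
    simp [sum_apply, coordForm_coordVec he hw]
  exact key _ (e.left_inv hw)

theorem IsPotentialFamily.constant_of_motion [IsManifold (𝓡 n) ∞ M] (hn : 1 ≤ n)
    (hv : IsPotentialFamily g J₁ J₂ V W U v)
    (hsys : IsBiCofactor g J₁ J₂ V W) (hU : IsOpen U) {s : Set ℝ} {γ : ℝ → PhaseSpace n M}
    (hs : s.OrdConnected) (hγU : ∀ t ∈ s, (γ t).1 ∈ U)
    (hγ : IsTrajectory J₁ (g.hamiltonian (fun x => cof (J₁ x)) V) s γ) {r : ℕ}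
    (hr : r ∈ Finset.Icc 1 n) {t t' : ℝ} (ht : t ∈ s) (ht' : t' ∈ s) :
    g.hamiltonian (kTensor J₁ J₂ r) (v r) (γ t) =
      g.hamiltonian (kTensor J₁ J₂ r) (v r) (γ t') := by
  have hderiv : ∀ t ∈ s, HasDerivWithinAt
      (fun τ => g.hamiltonian (kTensor J₁ J₂ r) (v r) (γ τ)) 0 s t := by
    intro t ht
    let e : Coords n M := chartAt (EuclideanSpace ℝ (Fin n)) (γ t).1
    have he : e ∈ charts n M := IsManifold.chart_mem_maximalAtlas _
    have hx : (γ t).1 ∈ e.source := mem_chart_source _ _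
    set z := toCoords e (γ t) with hzdef
    have hz : qPart z ∈ e.target := e.map_source hx
    have hzU : e.symm (qPart z) ∈ U := by
      rw [hzdef, qPart_toCoords, e.left_inv hx]
      exact hγU t ht
    have h1 : (1 : ℕ) ∈ Finset.Icc 1 n := Finset.mem_Icc.mpr ⟨le_rfl, hn⟩
    -- the Hamiltonian of the system and `H₁` have the same differential
    have hH : phaseDiff e (g.hamiltonian (fun x => cof (J₁ x)) V) z =
        phaseDiff e (g.hamiltonian (kTensor J₁ J₂ 1) (v 1)) z := by
      have hk : kTensor J₁ J₂ 1 = fun x => cof (J₁ x) := funext fun x => kTensor_one J₁ J₂ x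
      funext a
      simp only [phaseDiff]
      congr 1
      refine Filter.EventuallyEq.fderiv_eq ?_
      have hopen : ∀ᶠ w in 𝓝 z, qPart w ∈ e.target ∩ e.symm ⁻¹' U :=
        (qProj n).continuous.continuousAt.eventually
          ((e.isOpen_inter_preimage_symm hU).mem_nhds ⟨hz, hzU⟩)
      refine hopen.mono fun w hw => ?_
      have : v 1 (ofCoords e w).1 = V (ofCoords e w).1 := hv.2.1 _ hw.2
      simp only [PseudoMetric.hamiltonian, hk, this]
    have hfield : phaseDiff e (g.hamiltonian (kTensor J₁ J₂ r) (v r)) z ⬝ᵥ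
        quasiHamField e J₁ (g.hamiltonian (fun x => cof (J₁ x)) V) z = 0 := by
      have := (hv.bracket_eq_zero hsys hU he hz hzU hr h1).1
      rw [bracket] at this
      rw [quasiHamField, dotProduct_smul, hH, this, smul_zero]
    have hF := hasFDerivAt_hamiltonian g he hz
      (smoothEntriesAt_components (isSmoothField_kTensor hsys.jTensor₁.1 hsys.jTensor₂.1 r) he hz)
      ((hv.contDiffAt hU he hz hzU hr).differentiableAt (by simp))
    have hcomp := hF.comp_hasDerivWithinAt t (hγ.2 t ht e he hx)
    have hzero : fderiv ℝ (fun w => g.hamiltonian (kTensor J₁ J₂ r) (v r) (ofCoords e w)) z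
        (quasiHamField e J₁ (g.hamiltonian (fun x => cof (J₁ x)) V) z) = 0 := by
      rw [← hfield]
      set q := quasiHamField e J₁ (g.hamiltonian (fun x => cof (J₁ x)) V) z
      conv_lhs => rw [pi_eq_sum_univ' q]
      rw [map_sum]
      refine Finset.sum_congr rfl fun a _ => ?_
      rw [map_smul, smul_eq_mul, mul_comm, phaseDiff]
    rw [hzero] at hcomp
    refine hcomp.congr_of_eventuallyEq ?_ ?_
    · have hev : ∀ᶠ τ in 𝓝[s] t, (γ τ).1 ∈ e.source :=
        (hγ.1 t ht).eventually (e.open_source.mem_nhds hx)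
      exact hev.mono fun τ hτ => by
        simp only [Function.comp_apply, ofCoords_toCoords he _ hτ]
    · simp only [Function.comp_apply, ofCoords_toCoords he _ hx]
  have := hs.convex.norm_image_sub_le_of_norm_hasDerivWithin_le (C := 0) hderiv
    (fun _ _ => by simp) ht ht'
  rw [zero_mul, norm_le_zero_iff, sub_eq_zero] at this
  exact this.symm

end Dynamics

end BiCofactor

end
open BiCofactor in
theorem mainTheorem1 {n : ℕ} (hn : 1 ≤ n) {M : Type*} [TopologicalSpace M]
    [ChartedSpace (EuclideanSpace ℝ (Fin n)) M] [IsManifold (𝓡 n) ∞ M]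
    (g : PseudoMetric n M) (J₁ J₂ : EndField n M) (V W : M → ℝ)
    (hsys : IsBiCofactor g J₁ J₂ V W) (hVW : n = 1 → V = W) :
    -- the bi-quasi-Hamiltonian form of the system
    (∀ e ∈ charts n M, ∀ z : Fin n ⊕ Fin n → ℝ, qPart z ∈ e.target →
      quasiHamField e J₁ (g.hamiltonian (fun x => cof (J₁ x)) V) z =
        quasiHamField e J₂ (g.hamiltonian (fun x => cof (J₂ x)) W) z) ∧
    -- the tensors `K_r` are generated by the cofactor of the pencil
    (∀ (x : M) (ξ : ℝ),
      cof (J₂ x + ξ • J₁ x) = ∑ i ∈ Finset.range n, ξ ^ i • kTensor J₁ J₂ (n - i) x) ∧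
    (∀ x : M, kTensor J₁ J₂ 1 x = cof (J₁ x)) ∧
    (∀ x : M, kTensor J₁ J₂ n x = cof (J₂ x)) ∧
    (∀ r ∈ Finset.Icc 1 n, g.IsKillingTensor (kTensor J₁ J₂ r)) ∧
    -- the two formulas for the potentials are equivalent
    (∀ r ∈ Finset.Icc 1 n, ∀ x : M,
      (LinearMap.det (J₁ x))⁻¹ • kTensor J₁ J₂ r x (J₁ x (g.grad V x)) =
        (LinearMap.det (J₂ x))⁻¹ • kTensor J₁ J₂ r x (J₂ x (g.grad W x))) ∧
    -- the potentials exist locally, and globally if closed 1-forms on `M` are exact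
    (∀ x : M, ∃ U : Set M, IsOpen U ∧ x ∈ U ∧
      ∃ v : ℕ → M → ℝ, IsPotentialFamily g J₁ J₂ V W U v) ∧
    (ClosedFormsExact n M →
      ∃ v : ℕ → M → ℝ, IsPotentialFamily g J₁ J₂ V W Set.univ v) ∧
    -- for all such potentials, the functions `H_r` on the part of phase space over `U`
    ∀ (U : Set M) (v : ℕ → M → ℝ), IsOpen U → IsPotentialFamily g J₁ J₂ V W U v →
      (∀ z : PhaseSpace n M, z.1 ∈ U →
        g.hamiltonian (kTensor J₁ J₂ 1) (v 1) z = g.hamiltonian (fun x => cof (J₁ x)) V z ∧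
        g.hamiltonian (kTensor J₁ J₂ n) (v n) z = g.hamiltonian (fun x => cof (J₂ x)) W z) ∧
      -- are constants of motion
      (∀ (s : Set ℝ) (γ : ℝ → PhaseSpace n M), s.OrdConnected → (∀ t ∈ s, (γ t).1 ∈ U) →
        IsTrajectory J₁ (g.hamiltonian (fun x => cof (J₁ x)) V) s γ →
        ∀ r ∈ Finset.Icc 1 n, ∀ t ∈ s, ∀ t' ∈ s,
          g.hamiltonian (kTensor J₁ J₂ r) (v r) (γ t) =
            g.hamiltonian (kTensor J₁ J₂ r) (v r) (γ t')) ∧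
      -- and in involution with respect to both operators
      (∀ r ∈ Finset.Icc 1 n, ∀ s ∈ Finset.Icc 1 n, ∀ e ∈ charts n M,
        ∀ z : Fin n ⊕ Fin n → ℝ, qPart z ∈ e.target → e.symm (qPart z) ∈ U →
          bracket e J₁ (g.hamiltonian (kTensor J₁ J₂ r) (v r))
              (g.hamiltonian (kTensor J₁ J₂ s) (v s)) z = 0 ∧
          bracket e J₂ (g.hamiltonian (kTensor J₁ J₂ r) (v r))
              (g.hamiltonian (kTensor J₁ J₂ s) (v s)) z = 0) := by
  have h1 : kTensor J₁ J₂ 1 = fun x => cof (J₁ x) := funext fun x => kTensor_one J₁ J₂ x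
  have h2 : kTensor J₁ J₂ n = fun x => cof (J₂ x) := funext fun x => kTensor_last J₁ J₂ x
  refine ⟨fun e he z hz => hsys.quasiHamField_eq he hz, cof_pencil_eq_sum_kTensor J₁ J₂,
    kTensor_one J₁ J₂, kTensor_last J₁ J₂, fun r _ => hsys.isKillingTensor_kTensor r,
    fun r _ x => ?_, hsys.exists_isPotentialFamily_nhds hVW,
    hsys.exists_isPotentialFamily_univ hVW, fun U v hU hv => ⟨fun z hz => ⟨?_, ?_⟩, ?_, ?_⟩⟩
  · rw [← map_smul, hsys.force_eq', map_smul]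
  · rw [h1, PseudoMetric.hamiltonian, PseudoMetric.hamiltonian, hv.2.1 _ hz]
  · rw [h2, PseudoMetric.hamiltonian, PseudoMetric.hamiltonian, hv.2.2.1 _ hz]
  · intro s γ hs hγU hγ r hr t ht t' ht'
    exact hv.constant_of_motion hn hsys hU hs hγU hγ hr ht ht'
  · intro r hr s hs e he z hz hzU
    exact hv.bracket_eq_zero hsys hU he hz hzU hr hs
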